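/- Let $\mathbf{G}$ be a connected reductive linear algebraic group over $\mathbf{R}$, with group of complex points $\mathbf{G}(\mathbf{C})\subset \mathrm{GL}_n(\mathbf{C})$. Let $\mathfrak{g}_{\mathbf{R}}$ be the Lie algebra of $\mathbf{G}(\mathbf{R})$, let $K_\infty\subset\mathbf{G}(\mathbf{R})$ be a maximal compact subgroup with Lie algebra $\mathfrak{k}_{\mathbf{R}}$ and identity component $K_\infty^\circ$, and let $\theta$ be a Cartan involution of $\mathfrak{g}_{\mathbf{R}}$ with fixed points $\mathfrak{k}_{\mathbf{R}}$: an involutive Lie algebra automorphism for which there is an invariant, $\theta$-invariant symmetric real bilinear form $\beta$ on $\mathfrak{g}_{\mathbf{R}}$ with $\beta(X,\theta X)<0$ for all $X\neq 0$. Omit the subscript $\mathbf{R}$ to denote complexifications. Consider triples $(\mathfrak{a},\mathfrak{b},\mathfrak{q})$ obtained as follows. Choose a Cartan subgroup (maximal torus) $B\subset K_\infty^\circ$, with Lie algebra $\mathfrak{b}_{\mathbf{R}}$. Let $\mathfrak{a}_{\mathbf{R}}$ be the $-1$ eigenspace of $\theta$ on the centralizer of $\mathfrak{b}_{\mathbf{R}}$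 in $\mathfrak{g}_{\mathbf{R}}$. Choose $x\in i\mathfrak{b}_{\mathbf{R}}$ generic, that is, such that no root of $\mathfrak{b}$ on $\mathfrak{g}$ (nonzero weight of $\mathfrak b$ acting on $\mathfrak g$ by $\mathrm{ad}$) vanishes at $x$, and let $\mathfrak{q}$ be the sum of the eigenspaces of $\mathrm{ad}(x)$ on $\mathfrak{g}$ with non-negative eigenvalue. Let $(\mathfrak{a},\mathfrak{b},\mathfrak{q})$ and $(\mathfrak{a}',\mathfrak{b}',\mathfrak{q}')$ be two triples obtained in this way, from $(B,x)$ and $(B',x')$. Then there exists $g\in\mathbf{G}(\mathbf{C})$ such that $\mathrm{Ad}(g)$ carries $(\mathfrak{a},\mathfrak{b},\mathfrak{q})$ to $(\mathfrak{a}',\mathfrak{b}',\mathfrak{q}')$ and carries $\mathfrak{a}_{\mathbf{R}}$ to $\mathfrak{a}'_{\mathbf{R}}$. Moreover, any two such $g$ induce the same isomorphism $\mathfrak{a}\to\mathfrak{a}'$. Hence the space $\mathfrak{a}_G:=\varprojlim\mathfrak{a}$, the inverse limit over all these triples along the isomorphisms just described, is canonically defined: for every triple the projection $\mathfrak{a}_G\to\mathfrak{a}$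 is bijective, and if the component of an element of $\mathfrak{a}_G$ at one triple lies in $\mathfrak{a}_{\mathbf{R}}$, then so does its component at every other triple. -/

import Mathlib

namespace RealReductive

/-! ### Matrix Lie groups and their Lie algebras -/

section Trotter

open Filter Topology

theorem norm_pow_sub_pow_le {A : Type*} [NormedRing A] [NormOneClass A] {a b : A} {M : ℝ}
    (hM : 1 ≤ M) (ha : ‖a‖ ≤ M) (hb : ‖b‖ ≤ M) (k : ℕ) :
    ‖a ^ k - b ^ k‖ ≤ k * M ^ k * ‖a - b‖ := by
  have hM0 : 0 ≤ M := by linarith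
  induction k with
  | zero => simp
  | succ k ih =>
    have e : a ^ (k + 1) - b ^ (k + 1) = a ^ k * (a - b) + (a ^ k - b ^ k) * b := by
      simp only [pow_succ]; noncomm_ring
    have h1 : ‖a ^ k‖ ≤ M ^ k := (norm_pow_le a k).trans (pow_le_pow_left₀ (norm_nonneg _) ha k)
    have h2 : M ^ k ≤ M ^ (k + 1) := pow_le_pow_right₀ hM (Nat.le_succ k)
    calc ‖a ^ (k + 1) - b ^ (k + 1)‖ ≤ ‖a ^ k‖ * ‖a - b‖ + ‖a ^ k - b ^ k‖ * ‖b‖ := by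
          rw [e]; exact (norm_add_le _ _).trans (add_le_add (norm_mul_le _ _) (norm_mul_le _ _))
      _ ≤ M ^ (k + 1) * ‖a - b‖ + (k * M ^ k * ‖a - b‖) * M := by
          gcongr; exact h1.trans h2
      _ = ((k + 1 : ℕ) : ℝ) * M ^ (k + 1) * ‖a - b‖ := by push_cast; ring

theorem tendsto_pow_exp {A : Type*} [NormedRing A] [NormedAlgebra ℝ A] [NormOneClass A]
    [CompleteSpace A] {f : ℝ → A} {Z : A} (hf : HasDerivAt f Z 0) (h0 : f 0 = 1) :
    Tendsto (fun k : ℕ => f (1 / ((k : ℝ) + 1)) ^ (k + 1)) atTop (𝓝 (NormedSpace.exp Z)) := by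
  let _ : NormedAlgebra ℚ A := NormedAlgebra.restrictScalars ℚ ℝ A
  have hg : HasDerivAt (fun s : ℝ => NormedSpace.exp (s • Z)) Z 0 := by
    simpa using hasDerivAt_exp_smul_const (𝕂 := ℝ) Z (0 : ℝ)
  have hs : Tendsto (fun k : ℕ => (1 : ℝ) / ((k : ℝ) + 1)) atTop (𝓝 0) :=
    tendsto_one_div_add_atTop_nhds_zero_nat
  have key : ∀ h : ℝ → A, HasDerivAt h Z 0 → h 0 = 1 →
      ∀ᶠ s in 𝓝 (0 : ℝ), ‖h s‖ ≤ Real.exp ((‖Z‖ + 1) * |s|) := by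
    intro h hh h0
    have := (hasDerivAt_iff_isLittleO_nhds_zero.1 hh).def one_pos
    filter_upwards [this] with s hs
    simp only [zero_add, h0, one_mul, Real.norm_eq_abs] at hs
    have e : h s = (h s - 1 - s • Z) + 1 + s • Z := by abel
    calc ‖h s‖ ≤ ‖h s - 1 - s • Z‖ + ‖(1 : A)‖ + ‖s • Z‖ := by
          conv_lhs => rw [e]
          exact norm_add₃_le
      _ ≤ |s| + 1 + |s| * ‖Z‖ := by rw [norm_smul, norm_one, Real.norm_eq_abs]; gcongr
      _ = (‖Z‖ + 1) * |s| + 1 := by ring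
      _ ≤ _ := Real.add_one_le_exp _
  have hd : Tendsto (fun k : ℕ => ((k : ℝ) + 1) *
      ‖f (1 / ((k : ℝ) + 1)) - NormedSpace.exp ((1 / ((k : ℝ) + 1)) • Z)‖) atTop (𝓝 0) := by
    have := hasDerivAt_iff_isLittleO_nhds_zero.1 (hf.sub hg)
    simp only [zero_add, Pi.sub_apply, h0, zero_smul, NormedSpace.exp_zero, sub_self, smul_zero,
      sub_zero] at this
    have h2 := (this.comp_tendsto hs).norm_left.tendsto_div_nhds_zero
    refine h2.congr fun k => ?_
    simp only [Function.comp]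
    field_simp
  have hE : Tendsto (fun k : ℕ => f (1 / ((k : ℝ) + 1)) ^ (k + 1)
      - NormedSpace.exp ((1 / ((k : ℝ) + 1)) • Z) ^ (k + 1)) atTop (𝓝 0) := by
    have hd2 := hd.const_mul (Real.exp (‖Z‖ + 1))
    rw [mul_zero] at hd2
    refine squeeze_zero_norm' ?_ hd2
    filter_upwards [hs.eventually (key f hf h0), hs.eventually (key _ hg (by simp))] with k h1 h2
    have hk : (0 : ℝ) < (k : ℝ) + 1 := by positivity
    have hM : 1 ≤ Real.exp ((‖Z‖ + 1) * |1 / ((k : ℝ) + 1)|) := Real.one_le_exp (by positivity)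
    refine (norm_pow_sub_pow_le hM h1 h2 (k + 1)).trans (le_of_eq ?_)
    rw [← Real.exp_nat_mul, abs_of_pos (by positivity)]
    push_cast
    rw [show ((k : ℝ) + 1) * ((‖Z‖ + 1) * (1 / ((k : ℝ) + 1))) = ‖Z‖ + 1 by field_simp]
    ring
  have hc : ∀ k : ℕ, NormedSpace.exp ((1 / ((k : ℝ) + 1)) • Z) ^ (k + 1) = NormedSpace.exp Z := by
    intro k
    rw [← NormedSpace.exp_nsmul, ← Nat.cast_smul_eq_nsmul ℝ, smul_smul]
    push_cast
    rw [mul_one_div_cancel (by positivity), one_smul]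
  simp only [hc] at hE
  simpa using hE.add_const (NormedSpace.exp Z)

end Trotter

section LieAlg

open Filter Topology

variable {n : ℕ}

attribute [local instance] LieRing.ofAssociativeRing

/-- The matrix `X` generates a one-parameter subgroup of the closure of `H`. -/
def IsInfinitesimal (H : Subgroup (GL (Fin n) ℝ)) (X : Matrix (Fin n) (Fin n) ℝ) : Prop :=
  ∀ t : ℝ, ∃ h ∈ H.topologicalClosure, (h : Matrix (Fin n) (Fin n) ℝ) = NormedSpace.exp (t • X)

theorem hasDerivAt_exp_smul_zero (X : Matrix (Fin n) (Fin n) ℝ) :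
    HasDerivAt (fun s : ℝ => NormedSpace.exp (s • X)) X 0 := by
  let _ : NormedRing (Matrix (Fin n) (Fin n) ℝ) := Matrix.linftyOpNormedRing
  let _ : NormedAlgebra ℝ (Matrix (Fin n) (Fin n) ℝ) := Matrix.linftyOpNormedAlgebra
  let _ : NormedAlgebra ℚ (Matrix (Fin n) (Fin n) ℝ) := NormedAlgebra.restrictScalars ℚ ℝ _
  have h := hasDerivAt_exp_smul_const (𝕂 := ℝ) X (0 : ℝ)
  rw [zero_smul, NormedSpace.exp_zero, one_mul] at h
  exact h

theorem hasDerivAt_matrix_mul {f g : ℝ → Matrix (Fin n) (Fin n) ℝ}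
    {X Y : Matrix (Fin n) (Fin n) ℝ} (hf : HasDerivAt f X 0) (hg : HasDerivAt g Y 0) :
    HasDerivAt (fun s => f s * g s) (X * g 0 + f 0 * Y) 0 := by
  let _ : NormedRing (Matrix (Fin n) (Fin n) ℝ) := Matrix.linftyOpNormedRing
  let _ : NormedAlgebra ℝ (Matrix (Fin n) (Fin n) ℝ) := Matrix.linftyOpNormedAlgebra
  exact HasDerivAt.mul (𝔸 := Matrix (Fin n) (Fin n) ℝ) hf hg

theorem hasDerivAt_matrix_const (Y : Matrix (Fin n) (Fin n) ℝ) :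
    HasDerivAt (fun _ : ℝ => Y) 0 0 := by
  let _ : NormedRing (Matrix (Fin n) (Fin n) ℝ) := Matrix.linftyOpNormedRing
  let _ : NormedAlgebra ℝ (Matrix (Fin n) (Fin n) ℝ) := Matrix.linftyOpNormedAlgebra
  exact hasDerivAt_const (F := Matrix (Fin n) (Fin n) ℝ) (0 : ℝ) Y

theorem tendsto_matrix_slope {f : ℝ → Matrix (Fin n) (Fin n) ℝ} {X : Matrix (Fin n) (Fin n) ℝ}
    (hf : HasDerivAt f X 0) :
    Tendsto (fun s : ℝ => s⁻¹ • (f s - f 0)) (𝓝[≠] 0) (𝓝 X) := by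
  let _ : NormedRing (Matrix (Fin n) (Fin n) ℝ) := Matrix.linftyOpNormedRing
  let _ : NormedAlgebra ℝ (Matrix (Fin n) (Fin n) ℝ) := Matrix.linftyOpNormedAlgebra
  have h := HasDerivAt.tendsto_slope (F := Matrix (Fin n) (Fin n) ℝ) hf
  refine h.congr fun s => ?_
  rw [slope_def_module, sub_zero]

theorem tendsto_matrix_pow_exp {f : ℝ → Matrix (Fin n) (Fin n) ℝ}
    {Z : Matrix (Fin n) (Fin n) ℝ} (hf : HasDerivAt f Z 0) (h0 : f 0 = 1) :
    Tendsto (fun k : ℕ => f (1 / ((k : ℝ) + 1)) ^ (k + 1)) atTop (𝓝 (NormedSpace.exp Z)) := by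
  rcases Nat.eq_zero_or_pos n with rfl | hn
  · exact tendsto_const_nhds.congr fun k => Subsingleton.elim _ _
  have : Nonempty (Fin n) := ⟨⟨0, hn⟩⟩
  let _ : NormedRing (Matrix (Fin n) (Fin n) ℝ) := Matrix.linftyOpNormedRing
  let _ : NormedAlgebra ℝ (Matrix (Fin n) (Fin n) ℝ) := Matrix.linftyOpNormedAlgebra
  have : NormOneClass (Matrix (Fin n) (Fin n) ℝ) := Matrix.linfty_opNormOneClass
  exact tendsto_pow_exp (A := Matrix (Fin n) (Fin n) ℝ) hf h0

theorem tendsto_units_of_tendsto_val {u : ℕ → GL (Fin n) ℝ} {v : GL (Fin n) ℝ}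
    (h : Tendsto (fun k => (u k : Matrix (Fin n) (Fin n) ℝ)) atTop
      (𝓝 (v : Matrix (Fin n) (Fin n) ℝ))) : Tendsto u atTop (𝓝 v) := by
  let _ : NormedRing (Matrix (Fin n) (Fin n) ℝ) := Matrix.linftyOpNormedRing
  let _ : NormedAlgebra ℝ (Matrix (Fin n) (Fin n) ℝ) := Matrix.linftyOpNormedAlgebra
  exact (Units.isOpenEmbedding_val (R := Matrix (Fin n) (Fin n) ℝ)).isEmbedding.tendsto_nhds_iff.2 h

theorem isInfinitesimal_of_curve {H : Subgroup (GL (Fin n) ℝ)} {X : Matrix (Fin n) (Fin n) ℝ}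
    (f : ℝ → ℝ → Matrix (Fin n) (Fin n) ℝ) (h0 : ∀ t, f t 0 = 1)
    (hd : ∀ t, HasDerivAt (f t) (t • X) 0)
    (hm : ∀ t s, ∃ h ∈ H.topologicalClosure, (h : Matrix (Fin n) (Fin n) ℝ) = f t s) :
    IsInfinitesimal H X := by
  intro t
  have ht := tendsto_matrix_pow_exp (hd t) (h0 t)
  choose g hg hgf using hm t
  obtain ⟨u, hu⟩ : IsUnit (NormedSpace.exp (t • X)) := Matrix.isUnit_exp _
  refine ⟨u, ?_, hu⟩
  refine H.isClosed_topologicalClosure.mem_of_tendsto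
    (f := fun k : ℕ => g (1 / ((k : ℝ) + 1)) ^ (k + 1)) (b := atTop)
    (tendsto_units_of_tendsto_val ?_) (Eventually.of_forall fun k => pow_mem (hg _) _)
  simp only [Units.val_pow_eq_pow_val, hgf, hu]
  exact ht

theorem IsInfinitesimal.add {H : Subgroup (GL (Fin n) ℝ)} {X Y : Matrix (Fin n) (Fin n) ℝ}
    (hX : IsInfinitesimal H X) (hY : IsInfinitesimal H Y) : IsInfinitesimal H (X + Y) := by
  refine isInfinitesimal_of_curve
    (fun t s => NormedSpace.exp (s • t • X) * NormedSpace.exp (s • t • Y)) ?_ ?_ ?_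
  · intro t; simp
  · intro t
    have := hasDerivAt_matrix_mul (hasDerivAt_exp_smul_zero (t • X))
      (hasDerivAt_exp_smul_zero (t • Y))
    simpa [smul_add] using this
  · intro t s
    obtain ⟨h, hh, e⟩ := hX (s * t)
    obtain ⟨k, hk, e'⟩ := hY (s * t)
    exact ⟨h * k, mul_mem hh hk, by simp [e, e', smul_smul]⟩

theorem IsInfinitesimal.conj {H : Subgroup (GL (Fin n) ℝ)} {Y : Matrix (Fin n) (Fin n) ℝ}
    (hY : IsInfinitesimal H Y) {h : GL (Fin n) ℝ} (hh : h ∈ H.topologicalClosure) :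
    IsInfinitesimal H
      ((h : Matrix (Fin n) (Fin n) ℝ) * Y * ((h⁻¹ : GL (Fin n) ℝ) : Matrix (Fin n) (Fin n) ℝ)) := by
  intro t
  obtain ⟨k, hk, e⟩ := hY t
  refine ⟨h * k * h⁻¹, mul_mem (mul_mem hh hk) (inv_mem hh), ?_⟩
  rw [← smul_mul_assoc, ← mul_smul_comm, Matrix.exp_units_conj, Units.val_mul, Units.val_mul, e]

/-- The infinitesimal generators as a linear subspace. -/
def lieSubmodule (H : Subgroup (GL (Fin n) ℝ)) : Submodule ℝ (Matrix (Fin n) (Fin n) ℝ) where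
  carrier := {X | IsInfinitesimal H X}
  add_mem' := IsInfinitesimal.add
  zero_mem' := fun t => ⟨1, one_mem _, by simp⟩
  smul_mem' := fun c X hX t => by
    obtain ⟨h, hh, e⟩ := hX (t * c)
    exact ⟨h, hh, by rw [e, mul_smul]⟩

theorem IsInfinitesimal.lie {H : Subgroup (GL (Fin n) ℝ)} {X Y : Matrix (Fin n) (Fin n) ℝ}
    (hX : IsInfinitesimal H X) (hY : IsInfinitesimal H Y) : IsInfinitesimal H ⁅X, Y⁆ := by
  change ⁅X, Y⁆ ∈ lieSubmodule H
  have hcl : IsClosed (lieSubmodule H : Set (Matrix (Fin n) (Fin n) ℝ)) :=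
    Submodule.closed_of_finiteDimensional _
  have hd : HasDerivAt (fun s : ℝ => NormedSpace.exp (s • X) * Y * NormedSpace.exp (s • -X))
      ⁅X, Y⁆ 0 := by
    have := hasDerivAt_matrix_mul (hasDerivAt_matrix_mul (hasDerivAt_exp_smul_zero X)
      (hasDerivAt_matrix_const Y)) (hasDerivAt_exp_smul_zero (-X))
    simpa [Ring.lie_def, sub_eq_add_neg] using this
  have hmem : ∀ s : ℝ, NormedSpace.exp (s • X) * Y * NormedSpace.exp (s • -X)
      ∈ lieSubmodule H := by
    intro s
    obtain ⟨h, hh, e⟩ := hX s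
    have := hY.conj hh
    rwa [Matrix.coe_units_inv, e, ← Matrix.exp_neg, ← smul_neg] at this
  refine hcl.mem_of_tendsto (tendsto_matrix_slope hd) (Eventually.of_forall fun s => ?_)
  exact Submodule.smul_mem _ _ (Submodule.sub_mem _ (hmem s) (hmem 0))

/-- The Lie algebra of a closed subgroup `H` of `GL(n, ℝ)`: all real matrices `X` such that
`exp (t X) ∈ H` for every real `t`. (A subgroup that is not closed is replaced by its closure;
all subgroups used below are closed.) -/
def lieAlg (H : Subgroup (GL (Fin n) ℝ)) : LieSubalgebra ℝ (Matrix (Fin n) (Fin n) ℝ) :=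
  { lieSubmodule H with lie_mem' := IsInfinitesimal.lie }

theorem mem_lieAlg_iff {H : Subgroup (GL (Fin n) ℝ)} (hH : IsClosed (H : Set (GL (Fin n) ℝ)))
    (X : Matrix (Fin n) (Fin n) ℝ) :
    X ∈ lieAlg H ↔
      ∀ t : ℝ, ∃ h ∈ H, (h : Matrix (Fin n) (Fin n) ℝ) = NormedSpace.exp (t • X) := by
  have e : H.topologicalClosure = H :=
    le_antisymm (Subgroup.topologicalClosure_minimal _ le_rfl hH) H.le_topologicalClosure
  change IsInfinitesimal H X ↔ _
  rw [IsInfinitesimal, e]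

end LieAlg

/-! ### Reductive algebraic groups over the real numbers

A linear algebraic group over `ℝ` is given by its group of complex points, a subgroup `G` of
`GL(n, ℂ)` which is the zero locus in `GL(n, ℂ)` of polynomials with real coefficients. -/

section Group

variable {n : ℕ}

/-- `N` is the zero locus in `GL(n, ℂ)` of a set of complex polynomials in the matrix entries. -/
def IsZariskiClosed (N : Subgroup (GL (Fin n) ℂ)) : Prop :=
  ∃ S : Set (MvPolynomial (Fin n × Fin n) ℂ), ∀ g : GL (Fin n) ℂ,
    g ∈ N ↔ ∀ p ∈ S, MvPolynomial.aeval (fun ij : Fin n × Fin n => g.val ij.1 ij.2) p = 0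

/-- `N` is the zero locus in `GL(n, ℂ)` of a set of real polynomials in the matrix entries. -/
def IsZariskiClosedOverReal (N : Subgroup (GL (Fin n) ℂ)) : Prop :=
  ∃ S : Set (MvPolynomial (Fin n × Fin n) ℝ), ∀ g : GL (Fin n) ℂ,
    g ∈ N ↔ ∀ p ∈ S, MvPolynomial.aeval (fun ij : Fin n × Fin n => g.val ij.1 ij.2) p = 0

/-- Connectedness of an algebraic group: there is no proper closed subgroup of finite index. -/
def IsZariskiConnected (N : Subgroup (GL (Fin n) ℂ)) : Prop :=
  ∀ N' : Subgroup (GL (Fin n) ℂ), N' ≤ N → IsZariskiClosed N' → N'.relIndex N ≠ 0 → N' = N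

/-- `G` is (the group of complex points of) a connected reductive algebraic group over `ℝ`:
its unipotent radical is trivial. -/
structure IsReductiveOverReal (G : Subgroup (GL (Fin n) ℂ)) : Prop where
  algebraic : IsZariskiClosedOverReal G
  connected : IsZariskiConnected G
  unipotentRadical_trivial : ∀ U : Subgroup (GL (Fin n) ℂ), U ≤ G →
    IsZariskiClosed U → IsZariskiConnected U → (∀ g ∈ G, ∀ u ∈ U, g * u * g⁻¹ ∈ U) →
    (∀ u ∈ U, IsNilpotent (u.val - 1)) → U = ⊥

/-- The group of real points of `G`. -/
noncomputable def realPoints (G : Subgroup (GL (Fin n) ℂ)) : Subgroup (GL (Fin n) ℝ) :=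
  G.comap (Matrix.GeneralLinearGroup.map (algebraMap ℝ ℂ))

/-- `K` is a maximal compact subgroup of `L`. -/
def IsMaximalCompact (L K : Subgroup (GL (Fin n) ℝ)) : Prop :=
  Maximal (fun K' : Subgroup (GL (Fin n) ℝ) =>
    K' ≤ L ∧ IsCompact (K' : Set (GL (Fin n) ℝ))) K

/-- The identity component of a topological group `K`. -/
def identityComponent (K : Subgroup (GL (Fin n) ℝ)) : Subgroup (GL (Fin n) ℝ) :=
  (Subgroup.connectedComponentOfOne K).map K.subtype

/-- `B` is a maximal torus (a Cartan subgroup, when `L` is compact and connected) of `L`: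
it is maximal among the compact connected commutative subgroups of `L`. -/
def IsMaximalTorus (L B : Subgroup (GL (Fin n) ℝ)) : Prop :=
  Maximal (fun B' : Subgroup (GL (Fin n) ℝ) =>
    B' ≤ L ∧ IsCompact (B' : Set (GL (Fin n) ℝ)) ∧ IsConnected (B' : Set (GL (Fin n) ℝ)) ∧
      ∀ g ∈ B', ∀ h ∈ B', g * h = h * g) B

end Group

section Triples

variable {n : ℕ}

attribute [local instance] LieRing.ofAssociativeRing

/-- A real matrix regarded as a complex matrix. -/
noncomputable def toComplex (X : Matrix (Fin n) (Fin n) ℝ) : Matrix (Fin n) (Fin n) ℂ :=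
  X.map (algebraMap ℝ ℂ)

/-- The complexification of a real subspace of the space of real matrices, inside the space of
complex matrices. -/
noncomputable def complexify (V : Submodule ℝ (Matrix (Fin n) (Fin n) ℝ)) :
    Submodule ℂ (Matrix (Fin n) (Fin n) ℂ) :=
  Submodule.span ℂ (toComplex '' (V : Set (Matrix (Fin n) (Fin n) ℝ)))

/-- The adjoint action `X ↦ g X g⁻¹`. -/
noncomputable def Ad (g : GL (Fin n) ℂ) : Matrix (Fin n) (Fin n) ℂ →ₗ[ℂ] Matrix (Fin n) (Fin n) ℂ :=
  LinearMap.mulLeft ℂ g.val ∘ₗ LinearMap.mulRight ℂ g⁻¹.val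

theorem Ad_apply (g : GL (Fin n) ℂ) (X : Matrix (Fin n) (Fin n) ℂ) :
    Ad g X = g.val * X * (g⁻¹).val := by
  simp [Ad, mul_assoc]

/-- The real Lie algebra of `G`. -/
noncomputable abbrev gReal (G : Subgroup (GL (Fin n) ℂ)) : LieSubalgebra ℝ (Matrix (Fin n) (Fin n) ℝ) :=
  lieAlg (realPoints G)

/-- The complexified Lie algebra of `G`. -/
noncomputable def gComplex (G : Subgroup (GL (Fin n) ℂ)) : Submodule ℂ (Matrix (Fin n) (Fin n) ℂ) :=
  complexify (gReal G).toSubmodule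

/-- `θ` is a Cartan involution of the real Lie algebra of `G` with fixed points the Lie algebra
of `K`: an involutive automorphism such that, for some invariant and `θ`-invariant symmetric
bilinear form `β`, the form `β(X, θ X)` is negative definite. -/
structure IsCartanInvolution (G : Subgroup (GL (Fin n) ℂ)) (K : Subgroup (GL (Fin n) ℝ))
    (θ : gReal G →ₗ⁅ℝ⁆ gReal G) : Prop where
  involutive : ∀ X, θ (θ X) = X
  fixed_iff : ∀ X, θ X = X ↔ (X : Matrix (Fin n) (Fin n) ℝ) ∈ lieAlg K
  exists_form : ∃ β : LinearMap.BilinForm ℝ (gReal G),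
    (∀ X Y, β X Y = β Y X) ∧ (∀ X Y Z, β ⁅X, Y⁆ Z = β X ⁅Y, Z⁆) ∧
    (∀ X Y, β (θ X) (θ Y) = β X Y) ∧ ∀ X, X ≠ 0 → β X (θ X) < 0

/-- `α` is a root of `b` on `g`: a nonzero linear form on `b` for which there is a nonzero
simultaneous eigenvector in `g`. -/
def IsRoot (g b : Submodule ℂ (Matrix (Fin n) (Fin n) ℂ)) (α : Module.Dual ℂ b) : Prop :=
  α ≠ 0 ∧ ∃ X ∈ g, X ≠ 0 ∧ ∀ Y : b, ⁅(Y : Matrix (Fin n) (Fin n) ℂ), X⁆ = α Y • X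

/-- The data from which a triple `(a, b, q)` is built: a maximal torus `B` of the identity
component of `K`, with Lie algebra `b_ℝ` and complexified Lie algebra `b`, and a generic element
`x` of `i b_ℝ`, that is, one at which no root of `b` on the Lie algebra of `G` vanishes. -/
structure TripleDatum (G : Subgroup (GL (Fin n) ℂ)) (K : Subgroup (GL (Fin n) ℝ)) where
  B : Subgroup (GL (Fin n) ℝ)
  isMaximalTorus : IsMaximalTorus (identityComponent K) B
  x : complexify (lieAlg B).toSubmodule
  x_mem : ∃ Y ∈ lieAlg B, (x : Matrix (Fin n) (Fin n) ℂ) = Complex.I • toComplex Y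
  generic : ∀ α, IsRoot (gComplex G) (complexify (lieAlg B).toSubmodule) α → α x ≠ 0

namespace TripleDatum

variable {G : Subgroup (GL (Fin n) ℂ)} {K : Subgroup (GL (Fin n) ℝ)}

/-- The real subspace `a_ℝ`: the `-1` eigenspace of `θ` on the centralizer of `b_ℝ` in the real
Lie algebra of `G`. -/
noncomputable def aReal (θ : gReal G →ₗ⁅ℝ⁆ gReal G) (T : TripleDatum G K) :
    Submodule ℝ (Matrix (Fin n) (Fin n) ℝ) :=
  Submodule.map (gReal G).toSubmodule.subtype
    { carrier := {X : gReal G | (∀ Y ∈ lieAlg T.B, ⁅Y, (X : Matrix (Fin n) (Fin n) ℝ)⁆ = 0) ∧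
        θ X = -X}
      add_mem' := fun {X Y} hX hY =>
        ⟨fun Z hZ => by
          change ⁅Z, (X : Matrix (Fin n) (Fin n) ℝ) + (Y : Matrix (Fin n) (Fin n) ℝ)⁆ = 0
          rw [lie_add, hX.1 Z hZ, hY.1 Z hZ, add_zero],
        by rw [map_add, hX.2, hY.2, neg_add]⟩
      zero_mem' := ⟨fun Z _ => lie_zero Z, by rw [map_zero, neg_zero]⟩
      smul_mem' := fun c X hX =>
        ⟨fun Z hZ => by
          change ⁅Z, c • (X : Matrix (Fin n) (Fin n) ℝ)⁆ = 0
          rw [lie_smul, hX.1 Z hZ, smul_zero],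
        by rw [map_smul, hX.2, smul_neg]⟩ }

/-- The complex subspace `a`. -/
noncomputable def a (θ : gReal G →ₗ⁅ℝ⁆ gReal G) (T : TripleDatum G K) :
    Submodule ℂ (Matrix (Fin n) (Fin n) ℂ) :=
  complexify (T.aReal θ)

/-- The complexified Lie algebra `b` of `B`. -/
noncomputable def b (T : TripleDatum G K) : Submodule ℂ (Matrix (Fin n) (Fin n) ℂ) :=
  complexify (lieAlg T.B).toSubmodule

/-- The subspace `q`: the sum of the eigenspaces of `ad x` on the complexified Lie algebra of `G`
with non-negative eigenvalue. -/
noncomputable def q (T : TripleDatum G K) : Submodule ℂ (Matrix (Fin n) (Fin n) ℂ) :=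
  ⨆ (c : ℝ) (_ : 0 ≤ c), Module.End.eigenspace
    (LieAlgebra.ad ℂ (Matrix (Fin n) (Fin n) ℂ) (T.x : Matrix (Fin n) (Fin n) ℂ)) (c : ℂ) ⊓
      gComplex G

/-- `Ad g` carries the triple `(a, b, q)` of `T` to that of `T'`, and `a_ℝ` to `a'_ℝ`. -/
structure Carries (θ : gReal G →ₗ⁅ℝ⁆ gReal G) (g : GL (Fin n) ℂ) (T T' : TripleDatum G K) :
    Prop where
  map_a : (T.a θ).map (Ad g) = T'.a θ
  map_b : T.b.map (Ad g) = T'.b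
  map_q : T.q.map (Ad g) = T'.q
  map_aReal : Ad g '' (toComplex '' (T.aReal θ : Set (Matrix (Fin n) (Fin n) ℝ))) =
    toComplex '' (T'.aReal θ : Set (Matrix (Fin n) (Fin n) ℝ))

end TripleDatum

/-- The canonical space `a_G`, the inverse limit of the spaces `a` over all triples, along the
isomorphisms `a → a'` induced by the elements of `G` that carry one triple to another. -/
noncomputable def aG (G : Subgroup (GL (Fin n) ℂ)) (K : Subgroup (GL (Fin n) ℝ))
    (θ : gReal G →ₗ⁅ℝ⁆ gReal G) : Submodule ℂ (∀ T : TripleDatum G K, T.a θ) where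
  carrier := {v | ∀ (T T' : TripleDatum G K) (g : GL (Fin n) ℂ), g ∈ G → TripleDatum.Carries θ g T T' →
    Ad g (v T : Matrix (Fin n) (Fin n) ℂ) = v T'}
  add_mem' := fun hv hw T T' g hg h => by simp [hv T T' g hg h, hw T T' g hg h]
  zero_mem' := fun T T' g hg h => by simp
  smul_mem' := fun c v hv T T' g hg h => by simp [hv T T' g hg h]

end Triples

end RealReductive

/-!
# Conjugacy of triples `(a, b, q)` and the canonical space `a_G`

**From the group to its Lie algebra.** Because `G` is defined over `ℝ`, the complexified Lie algebra
of its real points is the Zariski tangent space of `G` at the identity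
(`gComplex_eq_tangentOne`), and its exponentials lie in `G`. Because `G` is connected, these
exponentials are Zariski dense (`evS_eq_zero_of_evS_exp_eq_zero`): by Krull's intersection theorem a
polynomial vanishing on them vanishes on a Zariski neighbourhood of the identity, hence on all
entire curves in `G` through the identity, and the Zariski closure of the group of points on such
curves has finite index in `G`.

**Existence.** The Lie algebra of a maximal torus is its own centralizer in `k`
(`TripleDatum.isTorusAlgebra`). Two such torus algebras are conjugate under the elements of `K`
commuting with the Cartan involution, by the extremal argument of Cartan and Hunt
(`exists_conj_torus`), and such an element respects the spaces `a_ℝ`. This leaves two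
generic elements of one torus. The reflection in every root hyperplane of `b_ℝ` is induced by an
element of `G` preserving `a_ℝ` (`exists_mem_Ad_eq_refl`): if the root has a root vector in the
complexification of `k`, by a rotation in `K`; otherwise by the exponential of a complex multiple of
a real matrix `A` with `θ A = -A`, which commutes with `a_ℝ`. Such reflections carry any chamber to
any other (`exists_mem_chamber`), and `q` depends only on the chamber (`qOf_eq_qOf`).

**Uniqueness.** It suffices that an element `g` of `G` carrying a triple to itself acts trivially on
`a`. The centralizer of `x` is `h = a + b`, which is abelian, so `g` preserves `h`, `q`, and the sum
`n = [h, q]` of the eigenspaces of `ad x` with positive eigenvalue. No Weyl group or normalizer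
theory is used to see that `g` is unipotent on `h`. Rather, for every element of `G` the
eigenvalue `1` of the adjoint action has multiplicity at least `dim h`
(`finrank_le_finrank_maxGenEigenspace`): this holds for exponentials of conjugates of elements of
`h`, which fill a neighbourhood of a point of the Lie algebra, and it is a condition on regular
functions. For the elements `g * exp (s x)` with `s` large, neither `n` nor the quotient of the Lie
algebra by `q` contributes to this multiplicity, so that all of it is found on `h`, on which
`exp (s x)` acts trivially (`exists_pow_sub_one_apply_eq_zero`). Finally, `Ad g` preserves the
complexification of the invariant form (`complexForm_Ad`), which is real and positive definite on
`a_ℝ`, and a unipotent isometry of a positive definite form is the identity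
(`Carries.Ad_eq_self`).

Existence and uniqueness make the spaces `a` a system of canonically isomorphic spaces, which gives
the statements on the inverse limit.
-/

namespace RealReductive

/-! ### Calculus of matrix-valued functions -/

section Calculus

open Filter Topology

attribute [local instance] LieRing.ofAssociativeRing

variable {n : ℕ} {𝕜 : Type*} [RCLike 𝕜]

theorem hasDerivAt_exp_smul_of_finiteDimensional {A : Type*} [NormedRing A] [NormedAlgebra 𝕜 A]
    [FiniteDimensional 𝕜 A] (M : A) (t : 𝕜) :
    HasDerivAt (fun s : 𝕜 => NormedSpace.exp (s • M)) (NormedSpace.exp (t • M) * M) t := by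
  let _ : NormedAlgebra ℚ A := NormedAlgebra.restrictScalars ℚ 𝕜 _
  have : CompleteSpace A := FiniteDimensional.complete 𝕜 A
  exact hasDerivAt_exp_smul_const (𝕂 := 𝕜) M t

theorem continuous_exp_of_finiteDimensional (𝕜 : Type*) [RCLike 𝕜] {A : Type*} [NormedRing A]
    [NormedAlgebra 𝕜 A] [FiniteDimensional 𝕜 A] : Continuous (NormedSpace.exp : A → A) := by
  let _ : NormedAlgebra ℚ A := NormedAlgebra.restrictScalars ℚ 𝕜 _
  have : CompleteSpace A := FiniteDimensional.complete 𝕜 A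
  exact NormedSpace.exp_continuous (𝔸 := A)

theorem hasDerivAt_matrix_exp_smul (M : Matrix (Fin n) (Fin n) 𝕜) (t : 𝕜) :
    HasDerivAt (fun s : 𝕜 => NormedSpace.exp (s • M)) (NormedSpace.exp (t • M) * M) t := by
  let _ : NormedRing (Matrix (Fin n) (Fin n) 𝕜) := Matrix.linftyOpNormedRing
  let _ : NormedAlgebra 𝕜 (Matrix (Fin n) (Fin n) 𝕜) := Matrix.linftyOpNormedAlgebra
  exact hasDerivAt_exp_smul_of_finiteDimensional (A := Matrix (Fin n) (Fin n) 𝕜) M t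

theorem _root_.HasDerivAt.matrix_mul {f g : 𝕜 → Matrix (Fin n) (Fin n) 𝕜}
    {X Y : Matrix (Fin n) (Fin n) 𝕜} {t : 𝕜} (hf : HasDerivAt f X t) (hg : HasDerivAt g Y t) :
    HasDerivAt (fun s => f s * g s) (X * g t + f t * Y) t := by
  let _ : NormedRing (Matrix (Fin n) (Fin n) 𝕜) := Matrix.linftyOpNormedRing
  let _ : NormedAlgebra 𝕜 (Matrix (Fin n) (Fin n) 𝕜) := Matrix.linftyOpNormedAlgebra
  exact HasDerivAt.mul (𝔸 := Matrix (Fin n) (Fin n) 𝕜) hf hg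

theorem hasDerivAt_matrix_const' (Y : Matrix (Fin n) (Fin n) 𝕜) (t : 𝕜) :
    HasDerivAt (fun _ : 𝕜 => Y) 0 t := by
  let _ : NormedRing (Matrix (Fin n) (Fin n) 𝕜) := Matrix.linftyOpNormedRing
  let _ : NormedAlgebra 𝕜 (Matrix (Fin n) (Fin n) 𝕜) := Matrix.linftyOpNormedAlgebra
  exact hasDerivAt_const (F := Matrix (Fin n) (Fin n) 𝕜) t Y

theorem hasDerivAt_matrix_const_add_smul (Y X : Matrix (Fin n) (Fin n) 𝕜) (t : 𝕜) :
    HasDerivAt (fun s : 𝕜 => Y + s • X) X t := by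
  let _ : NormedRing (Matrix (Fin n) (Fin n) 𝕜) := Matrix.linftyOpNormedRing
  let _ : NormedAlgebra 𝕜 (Matrix (Fin n) (Fin n) 𝕜) := Matrix.linftyOpNormedAlgebra
  have := ((hasDerivAt_id t).smul_const (F := Matrix (Fin n) (Fin n) 𝕜) X).const_add Y
  rw [one_smul] at this
  exact this

/-- A linear map to a finite-dimensional space may be differentiated under the derivative sign. -/
theorem _root_.HasDerivAt.linearMap_matrix {F : Type*} [NormedAddCommGroup F] [NormedSpace 𝕜 F]
    {f : 𝕜 → Matrix (Fin n) (Fin n) 𝕜}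
    {X : Matrix (Fin n) (Fin n) 𝕜} {t : 𝕜} (hf : HasDerivAt f X t)
    (φ : Matrix (Fin n) (Fin n) 𝕜 →ₗ[𝕜] F) : HasDerivAt (fun s => φ (f s)) (φ X) t := by
  let _ : NormedRing (Matrix (Fin n) (Fin n) 𝕜) := Matrix.linftyOpNormedRing
  let _ : NormedAlgebra 𝕜 (Matrix (Fin n) (Fin n) 𝕜) := Matrix.linftyOpNormedAlgebra
  exact HasFDerivAt.comp_hasDerivAt (F := Matrix (Fin n) (Fin n) 𝕜) t
    (LinearMap.toContinuousLinearMap (E := Matrix (Fin n) (Fin n) 𝕜) φ).hasFDerivAt hf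

theorem _root_.HasDerivAt.linearMap_matrix' {f : 𝕜 → Matrix (Fin n) (Fin n) 𝕜}
    {X : Matrix (Fin n) (Fin n) 𝕜} {t : 𝕜} (hf : HasDerivAt f X t)
    (φ : Matrix (Fin n) (Fin n) 𝕜 →ₗ[𝕜] Matrix (Fin n) (Fin n) 𝕜) :
    HasDerivAt (fun s => φ (f s)) (φ X) t := by
  let _ : NormedRing (Matrix (Fin n) (Fin n) 𝕜) := Matrix.linftyOpNormedRing
  let _ : NormedAlgebra 𝕜 (Matrix (Fin n) (Fin n) 𝕜) := Matrix.linftyOpNormedAlgebra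
  exact HasFDerivAt.comp_hasDerivAt (F := Matrix (Fin n) (Fin n) 𝕜)
    (E := Matrix (Fin n) (Fin n) 𝕜) t
    (LinearMap.toContinuousLinearMap (E := Matrix (Fin n) (Fin n) 𝕜)
      (F' := Matrix (Fin n) (Fin n) 𝕜) φ).hasFDerivAt hf

theorem _root_.HasDerivAt.matrix_unique {f : 𝕜 → Matrix (Fin n) (Fin n) 𝕜}
    {X Y : Matrix (Fin n) (Fin n) 𝕜} {t : 𝕜} (hf : HasDerivAt f X t) (hg : HasDerivAt f Y t) :
    X = Y := by
  let _ : NormedRing (Matrix (Fin n) (Fin n) 𝕜) := Matrix.linftyOpNormedRing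
  let _ : NormedAlgebra 𝕜 (Matrix (Fin n) (Fin n) 𝕜) := Matrix.linftyOpNormedAlgebra
  exact HasDerivAt.unique (F := Matrix (Fin n) (Fin n) 𝕜) hf hg

theorem matrix_eq_of_hasDerivAt_zero {f : 𝕜 → Matrix (Fin n) (Fin n) 𝕜}
    (hf : ∀ t, HasDerivAt f 0 t) (s t : 𝕜) : f s = f t := by
  let _ : NormedRing (Matrix (Fin n) (Fin n) 𝕜) := Matrix.linftyOpNormedRing
  let _ : NormedAlgebra 𝕜 (Matrix (Fin n) (Fin n) 𝕜) := Matrix.linftyOpNormedAlgebra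
  exact is_const_of_deriv_eq_zero (G := Matrix (Fin n) (Fin n) 𝕜)
    (fun t => (hf t).differentiableAt) (fun t => (hf t).deriv) s t

theorem matrix_exp_mul_exp_neg (M : Matrix (Fin n) (Fin n) 𝕜) :
    NormedSpace.exp M * NormedSpace.exp (-M) = 1 := by
  rw [← Matrix.exp_add_of_commute _ _ (Commute.neg_right (Commute.refl M)), add_neg_cancel,
    NormedSpace.exp_zero]

theorem matrix_exp_neg_mul_exp (M : Matrix (Fin n) (Fin n) 𝕜) :
    NormedSpace.exp (-M) * NormedSpace.exp M = 1 := by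
  simpa using matrix_exp_mul_exp_neg (-M)

theorem commute_matrix_exp (M : Matrix (Fin n) (Fin n) 𝕜) (t : 𝕜) :
    NormedSpace.exp (t • M) * M = M * NormedSpace.exp (t • M) := by
  let _ : NormedRing (Matrix (Fin n) (Fin n) 𝕜) := Matrix.linftyOpNormedRing
  let _ : NormedAlgebra 𝕜 (Matrix (Fin n) (Fin n) 𝕜) := Matrix.linftyOpNormedAlgebra
  let _ : NormedAlgebra ℚ (Matrix (Fin n) (Fin n) 𝕜) := NormedAlgebra.restrictScalars ℚ 𝕜 _
  exact (((Commute.refl M).smul_left t).exp_left).eq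

/-- Conjugation by the one-parameter group of `M` is the flow of `ad M`. -/
theorem hasDerivAt_exp_conj (M Z : Matrix (Fin n) (Fin n) 𝕜) (t : 𝕜) :
    HasDerivAt (fun s : 𝕜 => NormedSpace.exp (s • M) * Z * NormedSpace.exp (-(s • M)))
      ⁅M, NormedSpace.exp (t • M) * Z * NormedSpace.exp (-(t • M))⁆ t := by
  have h1 := (hasDerivAt_matrix_exp_smul M t).matrix_mul (hasDerivAt_matrix_const' Z t)
  have h2 := h1.matrix_mul (hasDerivAt_matrix_exp_smul (-M) t)
  simp only [smul_neg] at h2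
  convert h2 using 1
  have e := commute_matrix_exp (-M) t
  rw [smul_neg] at e
  rw [e, commute_matrix_exp M t, Ring.lie_def]
  have e2 : NormedSpace.exp (-(t • M)) * M = M * NormedSpace.exp (-(t • M)) := by
    simpa using e
  simp only [mul_zero, add_zero, mul_assoc, neg_mul, mul_neg, sub_eq_add_neg, e2]

theorem continuous_matrix_exp :
    Continuous (NormedSpace.exp : Matrix (Fin n) (Fin n) 𝕜 → Matrix (Fin n) (Fin n) 𝕜) := by
  let _ : NormedRing (Matrix (Fin n) (Fin n) 𝕜) := Matrix.linftyOpNormedRing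
  let _ : NormedAlgebra 𝕜 (Matrix (Fin n) (Fin n) 𝕜) := Matrix.linftyOpNormedAlgebra
  exact continuous_exp_of_finiteDimensional 𝕜 (A := Matrix (Fin n) (Fin n) 𝕜)

/-- The exponential of a matrix as an element of the general linear group. -/
noncomputable def expGL (M : Matrix (Fin n) (Fin n) 𝕜) : GL (Fin n) 𝕜 :=
  ⟨NormedSpace.exp M, NormedSpace.exp (-M), matrix_exp_mul_exp_neg M, matrix_exp_neg_mul_exp M⟩

@[simp] theorem expGL_val (M : Matrix (Fin n) (Fin n) 𝕜) :
    (expGL M).val = NormedSpace.exp M := rfl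

@[simp] theorem expGL_inv_val (M : Matrix (Fin n) (Fin n) 𝕜) :
    ((expGL M)⁻¹).val = NormedSpace.exp (-M) := rfl

theorem expGL_inv (M : Matrix (Fin n) (Fin n) 𝕜) : (expGL M)⁻¹ = expGL (-M) :=
  Units.ext rfl

theorem expGL_zero : expGL (0 : Matrix (Fin n) (Fin n) 𝕜) = 1 :=
  Units.ext (by simp)

end Calculus

/-! ### Real and complex matrices -/

section Complexification

open Filter Topology

attribute [local instance] LieRing.ofAssociativeRing

variable {n : ℕ}

theorem toComplex_add (X Y : Matrix (Fin n) (Fin n) ℝ) :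
    toComplex (X + Y) = toComplex X + toComplex Y := by
  ext; simp [toComplex]

theorem toComplex_sub (X Y : Matrix (Fin n) (Fin n) ℝ) :
    toComplex (X - Y) = toComplex X - toComplex Y := by
  ext; simp [toComplex]

theorem toComplex_zero : toComplex (0 : Matrix (Fin n) (Fin n) ℝ) = 0 := by
  ext; simp [toComplex]

theorem toComplex_smul (c : ℝ) (X : Matrix (Fin n) (Fin n) ℝ) :
    toComplex (c • X) = (c : ℂ) • toComplex X := by
  ext; simp [toComplex]

theorem toComplex_mul (X Y : Matrix (Fin n) (Fin n) ℝ) :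
    toComplex (X * Y) = toComplex X * toComplex Y := Matrix.map_mul

theorem toComplex_lie (X Y : Matrix (Fin n) (Fin n) ℝ) :
    toComplex ⁅X, Y⁆ = ⁅toComplex X, toComplex Y⁆ := by
  simp [Ring.lie_def, toComplex_sub, toComplex_mul]

theorem toComplex_injective :
    Function.Injective (toComplex : Matrix (Fin n) (Fin n) ℝ → Matrix (Fin n) (Fin n) ℂ) :=
  Matrix.map_injective (algebraMap ℝ ℂ).injective

theorem continuous_toComplex :
    Continuous (toComplex : Matrix (Fin n) (Fin n) ℝ → Matrix (Fin n) (Fin n) ℂ) :=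
  Continuous.matrix_map continuous_id Complex.continuous_ofReal

theorem toComplex_exp (X : Matrix (Fin n) (Fin n) ℝ) :
    toComplex (NormedSpace.exp X) = NormedSpace.exp (toComplex X) := by
  let _ : NormedRing (Matrix (Fin n) (Fin n) ℝ) := Matrix.linftyOpNormedRing
  let _ : NormedAlgebra ℝ (Matrix (Fin n) (Fin n) ℝ) := Matrix.linftyOpNormedAlgebra
  let _ : NormedRing (Matrix (Fin n) (Fin n) ℂ) := Matrix.linftyOpNormedRing
  let _ : NormedAlgebra ℂ (Matrix (Fin n) (Fin n) ℂ) := Matrix.linftyOpNormedAlgebra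
  let _ : NormedAlgebra ℚ (Matrix (Fin n) (Fin n) ℝ) := NormedAlgebra.restrictScalars ℚ ℝ _
  let _ : NormedAlgebra ℚ (Matrix (Fin n) (Fin n) ℂ) := NormedAlgebra.restrictScalars ℚ ℂ _
  exact NormedSpace.map_exp ((algebraMap ℝ ℂ).mapMatrix (m := Fin n)) continuous_toComplex X

/-- The entrywise complex conjugate of a matrix. -/
noncomputable def conjM (X : Matrix (Fin n) (Fin n) ℂ) : Matrix (Fin n) (Fin n) ℂ :=
  X.map (starRingEnd ℂ)

theorem conjM_exp (X : Matrix (Fin n) (Fin n) ℂ) :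
    conjM (NormedSpace.exp X) = NormedSpace.exp (conjM X) := by
  let _ : NormedRing (Matrix (Fin n) (Fin n) ℂ) := Matrix.linftyOpNormedRing
  let _ : NormedAlgebra ℂ (Matrix (Fin n) (Fin n) ℂ) := Matrix.linftyOpNormedAlgebra
  let _ : NormedAlgebra ℚ (Matrix (Fin n) (Fin n) ℂ) := NormedAlgebra.restrictScalars ℚ ℂ _
  exact NormedSpace.map_exp ((starRingEnd ℂ).mapMatrix (m := Fin n))
    (Continuous.matrix_map continuous_id Complex.continuous_conj) X

/-- The entrywise real part of a complex matrix. -/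
noncomputable def reM : Matrix (Fin n) (Fin n) ℂ →ₗ[ℝ] Matrix (Fin n) (Fin n) ℝ where
  toFun X := X.map Complex.re
  map_add' X Y := by ext; simp
  map_smul' c X := by ext; simp

/-- The entrywise imaginary part of a complex matrix. -/
noncomputable def imM : Matrix (Fin n) (Fin n) ℂ →ₗ[ℝ] Matrix (Fin n) (Fin n) ℝ where
  toFun X := X.map Complex.im
  map_add' X Y := by ext; simp
  map_smul' c X := by ext; simp

theorem toComplex_re_add_im (X : Matrix (Fin n) (Fin n) ℂ) :
    toComplex (reM X) + Complex.I • toComplex (imM X) = X := by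
  ext i j
  simpa [toComplex, reM, imM, mul_comm] using Complex.re_add_im (X i j)

@[simp] theorem reM_toComplex (X : Matrix (Fin n) (Fin n) ℝ) : reM (toComplex X) = X := by
  ext; simp [toComplex, reM]

@[simp] theorem imM_toComplex (X : Matrix (Fin n) (Fin n) ℝ) : imM (toComplex X) = 0 := by
  ext; simp [toComplex, imM]

theorem reM_smul (c : ℂ) (X : Matrix (Fin n) (Fin n) ℂ) :
    reM (c • X) = c.re • reM X - c.im • imM X := by
  ext; simp [reM, imM]

theorem imM_smul (c : ℂ) (X : Matrix (Fin n) (Fin n) ℂ) :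
    imM (c • X) = c.re • imM X + c.im • reM X := by
  ext; simp [reM, imM]

theorem matrix_ext_re_im {X Y : Matrix (Fin n) (Fin n) ℂ} (h1 : reM X = reM Y)
    (h2 : imM X = imM Y) : X = Y := by
  rw [← toComplex_re_add_im X, ← toComplex_re_add_im Y, h1, h2]

theorem lie_toComplex_eq (Y : Matrix (Fin n) (Fin n) ℝ) (X : Matrix (Fin n) (Fin n) ℂ) :
    ⁅toComplex Y, X⁆ = toComplex ⁅Y, reM X⁆ + Complex.I • toComplex ⁅Y, imM X⁆ := by
  conv_lhs => rw [← toComplex_re_add_im X]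
  rw [lie_add, Ring.lie_def _ (Complex.I • _), mul_smul_comm, smul_mul_assoc, ← smul_sub,
    ← Ring.lie_def, toComplex_lie, toComplex_lie]

@[simp] theorem reM_lie_toComplex (Y : Matrix (Fin n) (Fin n) ℝ) (X : Matrix (Fin n) (Fin n) ℂ) :
    reM ⁅toComplex Y, X⁆ = ⁅Y, reM X⁆ := by
  rw [lie_toComplex_eq, map_add, reM_smul]; simp

@[simp] theorem imM_lie_toComplex (Y : Matrix (Fin n) (Fin n) ℝ) (X : Matrix (Fin n) (Fin n) ℂ) :
    imM ⁅toComplex Y, X⁆ = ⁅Y, imM X⁆ := by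
  rw [lie_toComplex_eq, map_add, imM_smul]; simp

theorem toComplex_reM_eq (X : Matrix (Fin n) (Fin n) ℂ) :
    toComplex (reM X) = (1 / 2 : ℂ) • (X + conjM X) := by
  ext i j
  apply Complex.ext
  · simp [conjM, toComplex, reM]; ring
  · simp [conjM, toComplex, reM]

theorem toComplex_imM_eq (X : Matrix (Fin n) (Fin n) ℂ) :
    toComplex (imM X) = (-Complex.I / 2 : ℂ) • (X - conjM X) := by
  ext i j
  apply Complex.ext
  · simp [conjM, toComplex, imM]; ring
  · simp [conjM, toComplex, imM]

theorem toComplex_mem_complexify {V : Submodule ℝ (Matrix (Fin n) (Fin n) ℝ)}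
    {X : Matrix (Fin n) (Fin n) ℝ} (hX : X ∈ V) : toComplex X ∈ complexify V :=
  Submodule.subset_span ⟨X, hX, rfl⟩

theorem mem_complexify_iff {V : Submodule ℝ (Matrix (Fin n) (Fin n) ℝ)}
    {X : Matrix (Fin n) (Fin n) ℂ} : X ∈ complexify V ↔ reM X ∈ V ∧ imM X ∈ V := by
  constructor
  · intro h
    induction h using Submodule.span_induction with
    | mem x hx => obtain ⟨Y, hY, rfl⟩ := hx; simpa using hY
    | zero => simp
    | add x y _ _ hx hy => simp only [map_add]; exact ⟨V.add_mem hx.1 hy.1, V.add_mem hx.2 hy.2⟩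
    | smul a x _ hx =>
      rw [reM_smul, imM_smul]
      exact ⟨V.sub_mem (V.smul_mem _ hx.1) (V.smul_mem _ hx.2),
        V.add_mem (V.smul_mem _ hx.2) (V.smul_mem _ hx.1)⟩
  · rintro ⟨h1, h2⟩
    rw [← toComplex_re_add_im X]
    exact add_mem (toComplex_mem_complexify h1)
      (Submodule.smul_mem _ _ (toComplex_mem_complexify h2))

theorem lie_mem_complexify {V W U : Submodule ℝ (Matrix (Fin n) (Fin n) ℝ)}
    (h : ∀ X ∈ V, ∀ Y ∈ W, ⁅X, Y⁆ ∈ U) {X Y : Matrix (Fin n) (Fin n) ℂ}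
    (hX : X ∈ complexify V) (hY : Y ∈ complexify W) : ⁅X, Y⁆ ∈ complexify U := by
  rw [mem_complexify_iff] at hX
  rw [← toComplex_re_add_im X, add_lie, Ring.lie_def (Complex.I • _), mul_smul_comm,
    smul_mul_assoc, ← smul_sub, ← Ring.lie_def]
  refine add_mem ?_ (Submodule.smul_mem _ _ ?_)
  all_goals
    rw [mem_complexify_iff] at hY ⊢
    simp only [reM_lie_toComplex, imM_lie_toComplex]
  exacts [⟨h _ hX.1 _ hY.1, h _ hX.1 _ hY.2⟩, ⟨h _ hX.2 _ hY.1, h _ hX.2 _ hY.2⟩]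

end Complexification

/-! ### The adjoint action -/

section Adjoint

open Filter Topology

attribute [local instance] LieRing.ofAssociativeRing

variable {n : ℕ}

theorem Ad_one (X : Matrix (Fin n) (Fin n) ℂ) : Ad 1 X = X := by
  simp [Ad_apply]

theorem Ad_mul (g h : GL (Fin n) ℂ) (X : Matrix (Fin n) (Fin n) ℂ) :
    Ad (g * h) X = Ad g (Ad h X) := by
  simp only [Ad_apply, mul_inv_rev, Units.val_mul]; noncomm_ring

@[simp] theorem Ad_inv_Ad (g : GL (Fin n) ℂ) (X : Matrix (Fin n) (Fin n) ℂ) :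
    Ad g⁻¹ (Ad g X) = X := by
  rw [← Ad_mul, inv_mul_cancel, Ad_one]

@[simp] theorem Ad_Ad_inv (g : GL (Fin n) ℂ) (X : Matrix (Fin n) (Fin n) ℂ) :
    Ad g (Ad g⁻¹ X) = X := by
  rw [← Ad_mul, mul_inv_cancel, Ad_one]

theorem Ad_injective (g : GL (Fin n) ℂ) : Function.Injective (Ad g) :=
  Function.LeftInverse.injective (Ad_inv_Ad g)

theorem Ad_lie (g : GL (Fin n) ℂ) (X Y : Matrix (Fin n) (Fin n) ℂ) :
    Ad g ⁅X, Y⁆ = ⁅Ad g X, Ad g Y⁆ := by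
  have h : g⁻¹.val * g.val = 1 := by rw [← Units.val_mul, inv_mul_cancel, Units.val_one]
  have : ∀ X Y : Matrix (Fin n) (Fin n) ℂ, Ad g (X * Y) = Ad g X * Ad g Y := by
    intro X Y
    simp only [Ad_apply]
    calc g.val * (X * Y) * g⁻¹.val = g.val * X * 1 * Y * g⁻¹.val := by noncomm_ring
      _ = _ := by rw [← h]; noncomm_ring
  rw [Ring.lie_def, Ring.lie_def, map_sub, this, this]

theorem Ad_expGL (M Z : Matrix (Fin n) (Fin n) ℂ) :
    Ad (expGL M) Z = NormedSpace.exp M * Z * NormedSpace.exp (-M) := by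
  rw [Ad_apply, expGL_val, expGL_inv_val]

theorem hasDerivAt_Ad_expGL (M Z : Matrix (Fin n) (Fin n) ℂ) (t : ℂ) :
    HasDerivAt (fun s : ℂ => Ad (expGL (s • M)) Z) ⁅M, Ad (expGL (t • M)) Z⁆ t := by
  simp only [Ad_expGL]
  exact hasDerivAt_exp_conj M Z t

/-- The exponential of `ad M` acts on an eigenvector of `ad M` by the exponential of the
eigenvalue. -/
theorem Ad_expGL_of_lie_eq_smul {M Z : Matrix (Fin n) (Fin n) ℂ} {μ : ℂ} (h : ⁅M, Z⁆ = μ • Z) :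
    Ad (expGL M) Z = Complex.exp μ • Z := by
  have hs : SemiconjBy Z (M + algebraMap ℂ _ μ) M := by
    rw [SemiconjBy, mul_add, ← Algebra.commutes, ← Algebra.smul_def, ← h, Ring.lie_def]
    abel
  let _ : NormedRing (Matrix (Fin n) (Fin n) ℂ) := Matrix.linftyOpNormedRing
  let _ : NormedAlgebra ℂ (Matrix (Fin n) (Fin n) ℂ) := Matrix.linftyOpNormedAlgebra
  let _ : NormedAlgebra ℚ (Matrix (Fin n) (Fin n) ℂ) := NormedAlgebra.restrictScalars ℚ ℂ _
  have h1 : Z * NormedSpace.exp (M + algebraMap ℂ _ μ) = NormedSpace.exp M * Z := hs.exp_right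
  rw [Ad_expGL, ← h1, Matrix.exp_add_of_commute _ _ (Algebra.commutes μ M).symm]
  have h2 : NormedSpace.exp (algebraMap ℂ (Matrix (Fin n) (Fin n) ℂ) μ)
      = algebraMap ℂ _ (Complex.exp μ) := by
    rw [Complex.exp_eq_exp_ℂ]
    exact (NormedSpace.algebraMap_exp_comm (𝔸 := Matrix (Fin n) (Fin n) ℂ) μ).symm
  rw [h2, ← Algebra.commutes, Algebra.smul_def, ← mul_assoc, ← Algebra.commutes, mul_assoc,
    mul_assoc, matrix_exp_mul_exp_neg, mul_one]

end Adjoint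

end RealReductive

namespace RealReductive

/-! ### Polynomials on the general linear group and the tangent space at the identity -/

section Polynomials

open Filter Topology MvPolynomial

variable {n : ℕ}

/-- Evaluation of a polynomial at a matrix `Z`, in the coordinates `Z - 1` centred at the
identity matrix. -/
noncomputable def evS (Z : Matrix (Fin n) (Fin n) ℂ) :
    MvPolynomial (Fin n × Fin n) ℂ →ₐ[ℂ] ℂ :=
  aeval fun ij => (Z - 1) ij.1 ij.2

/-- The generic matrix in the coordinates centred at the identity matrix. -/
noncomputable def genM (n : ℕ) : Matrix (Fin n) (Fin n) (MvPolynomial (Fin n × Fin n) ℂ) :=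
  Matrix.of (fun i j => X (i, j)) + 1

@[simp] theorem map_genM (Z : Matrix (Fin n) (Fin n) ℂ) : (genM n).map (evS Z) = Z := by
  ext i j
  simp only [genM, Matrix.map_apply, Matrix.add_apply, Matrix.of_apply, map_add, evS, aeval_X,
    Matrix.sub_apply, Matrix.one_apply]
  split_ifs <;> simp

@[simp] theorem evS_genM (Z : Matrix (Fin n) (Fin n) ℂ) (i j : Fin n) :
    evS Z (genM n i j) = Z i j := congrFun (congrFun (map_genM Z) i) j

/-- Substitution of a matrix of polynomials for the generic matrix. -/
noncomputable def substM (M : Matrix (Fin n) (Fin n) (MvPolynomial (Fin n × Fin n) ℂ)) :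
    MvPolynomial (Fin n × Fin n) ℂ →ₐ[ℂ] MvPolynomial (Fin n × Fin n) ℂ :=
  aeval fun ij => (M - 1) ij.1 ij.2

theorem evS_substM (M : Matrix (Fin n) (Fin n) (MvPolynomial (Fin n × Fin n) ℂ))
    (Z : Matrix (Fin n) (Fin n) ℂ) (p : MvPolynomial (Fin n × Fin n) ℂ) :
    evS Z (substM M p) = evS (M.map (evS Z)) p := by
  have : (evS Z).comp (substM M) = evS (M.map (evS Z)) := by
    apply MvPolynomial.algHom_ext
    intro ij
    simp only [evS, substM, AlgHom.comp_apply, aeval_X, Matrix.sub_apply, Matrix.map_apply,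
      map_sub, Matrix.one_apply]
    split_ifs <;> simp
  exact DFunLike.congr_fun this p

theorem map_evS_map_C (h Z : Matrix (Fin n) (Fin n) ℂ) :
    (h.map (C : ℂ → MvPolynomial (Fin n × Fin n) ℂ)).map (evS Z) = h := by
  ext i j
  simp only [Matrix.map_apply, evS, aeval_C, Algebra.algebraMap_self, RingHom.id_apply]

theorem evS_substM_left (h Z : Matrix (Fin n) (Fin n) ℂ) (p : MvPolynomial (Fin n × Fin n) ℂ) :
    evS Z (substM (h.map C * genM n) p) = evS (h * Z) p := by
  rw [evS_substM, Matrix.map_mul, map_genM, map_evS_map_C]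

theorem evS_substM_right (h Z : Matrix (Fin n) (Fin n) ℂ) (p : MvPolynomial (Fin n × Fin n) ℂ) :
    evS Z (substM (genM n * h.map C) p) = evS (Z * h) p := by
  rw [evS_substM, Matrix.map_mul, map_genM, map_evS_map_C]

theorem evS_aeval_genM (Z : Matrix (Fin n) (Fin n) ℂ) (p : MvPolynomial (Fin n × Fin n) ℂ) :
    evS Z (aeval (fun ij : Fin n × Fin n => genM n ij.1 ij.2) p) =
      aeval (fun ij : Fin n × Fin n => Z ij.1 ij.2) p := by
  have : (evS Z).comp (aeval (fun ij : Fin n × Fin n => genM n ij.1 ij.2)) =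
      aeval (fun ij : Fin n × Fin n => Z ij.1 ij.2) := by
    apply MvPolynomial.algHom_ext
    intro ij
    simp
  exact DFunLike.congr_fun this p

/-- Up to a power of the determinant, composing a polynomial with the inversion of the general
linear group gives a polynomial. -/
theorem exists_evS_inv (p : MvPolynomial (Fin n × Fin n) ℂ) :
    ∃ (N : ℕ) (q : MvPolynomial (Fin n × Fin n) ℂ), ∀ g : GL (Fin n) ℂ,
      evS g.val q = g.val.det ^ N * evS (g⁻¹).val p := by
  induction p using MvPolynomial.induction_on with
  | C a => exact ⟨0, C a, fun g => by simp [evS]⟩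
  | add p q hp hq =>
    obtain ⟨N, p', hp⟩ := hp
    obtain ⟨M, q', hq⟩ := hq
    refine ⟨N + M, (genM n).det ^ M * p' + (genM n).det ^ N * q', fun g => ?_⟩
    have hd : evS g.val (genM n).det = g.val.det := by
      rw [AlgHom.map_det, AlgHom.mapMatrix_apply, map_genM]
    rw [map_add, map_mul, map_mul, map_pow, map_pow, hd, hp, hq, map_add]
    ring
  | mul_X p ij hp =>
    obtain ⟨N, p', hp⟩ := hp
    refine ⟨N + 1, p' * ((genM n).adjugate ij.1 ij.2 -
        (genM n).det * C ((1 : Matrix (Fin n) (Fin n) ℂ) ij.1 ij.2)),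
      fun g => ?_⟩
    have hd : evS g.val (genM n).det = g.val.det := by
      rw [AlgHom.map_det, AlgHom.mapMatrix_apply, map_genM]
    have ha : evS g.val ((genM n).adjugate ij.1 ij.2) = g.val.det * (g⁻¹).val ij.1 ij.2 := by
      have h1 : ((genM n).adjugate).map (evS g.val) = g.val.adjugate := by
        have := AlgHom.map_adjugate (evS g.val) (genM n)
        rwa [AlgHom.mapMatrix_apply, AlgHom.mapMatrix_apply, map_genM] at this
      have h2 : g.val.adjugate = g.val.det • (g⁻¹).val := by
        have h3 : g.val * g⁻¹.val = 1 := by rw [← Units.val_mul, mul_inv_cancel, Units.val_one]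
        calc g.val.adjugate = g.val.adjugate * (g.val * g⁻¹.val) := by rw [h3, mul_one]
          _ = _ := by rw [← mul_assoc, Matrix.adjugate_mul, smul_mul_assoc, one_mul]
      have := congrFun (congrFun (h1.trans h2) ij.1) ij.2
      simpa using this
    rw [map_mul, map_sub, map_mul, hd, ha, hp, map_mul]
    simp only [evS, aeval_X, aeval_C, Matrix.sub_apply, Algebra.algebraMap_self, RingHom.id_apply]
    ring

/-- The chain rule for the composition of a polynomial with a curve of matrices. -/
theorem hasDerivAt_evS {γ : ℂ → Matrix (Fin n) (Fin n) ℂ} {V : Matrix (Fin n) (Fin n) ℂ} {t : ℂ}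
    (hγ : HasDerivAt γ V t) (p : MvPolynomial (Fin n × Fin n) ℂ) :
    HasDerivAt (fun s => evS (γ s) p)
      (∑ ij : Fin n × Fin n, evS (γ t) (pderiv ij p) * V ij.1 ij.2) t := by
  induction p using MvPolynomial.induction_on with
  | C a => simpa [evS] using hasDerivAt_const (F := ℂ) t a
  | add p q hp hq =>
    simp only [map_add, add_mul, Finset.sum_add_distrib]
    exact hp.add hq
  | mul_X p kl hp =>
    have h1 : HasDerivAt (fun s => evS (γ s) (X kl)) (V kl.1 kl.2) t := by
      have := (hγ.linearMap_matrix (Matrix.entryLinearMap ℂ ℂ kl.1 kl.2)).sub_const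
        ((1 : Matrix (Fin n) (Fin n) ℂ) kl.1 kl.2)
      simpa [evS] using this
    have h2 := hp.mul h1
    have h3 : (fun s => evS (γ s) (p * X kl)) = (fun s => evS (γ s) p) * fun s => evS (γ s) (X kl) :=
      funext fun s => map_mul _ _ _
    rw [h3]
    refine h2.congr_deriv ?_
    simp only [Derivation.leibniz, pderiv_X, smul_eq_mul, map_add, map_mul, add_mul,
      Finset.sum_add_distrib, Finset.sum_mul]
    rw [add_comm]
    congr 1
    · rw [Finset.sum_eq_single kl]
      · rw [Pi.single_eq_same, map_one, mul_one]
      · intro ij _ hij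
        rw [Pi.single_eq_of_ne hij.symm, map_zero, mul_zero, zero_mul]
      · simp
    · exact Finset.sum_congr rfl fun ij _ => by ring

/-- The derivation of the polynomial ring given by the left-invariant vector field `Z ↦ Z * X`. -/
noncomputable def dirDeriv (A : Matrix (Fin n) (Fin n) ℂ) (p : MvPolynomial (Fin n × Fin n) ℂ) :
    MvPolynomial (Fin n × Fin n) ℂ :=
  ∑ ij : Fin n × Fin n, pderiv ij p *
    (genM n * A.map (C : ℂ → MvPolynomial (Fin n × Fin n) ℂ)) ij.1 ij.2

theorem evS_dirDeriv (A Z : Matrix (Fin n) (Fin n) ℂ) (p : MvPolynomial (Fin n × Fin n) ℂ) :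
    evS Z (dirDeriv A p) = ∑ ij : Fin n × Fin n, evS Z (pderiv ij p) * (Z * A) ij.1 ij.2 := by
  have h : (genM n * A.map (C : ℂ → MvPolynomial (Fin n × Fin n) ℂ)).map (evS Z) = Z * A := by
    rw [Matrix.map_mul, map_genM, map_evS_map_C]
  simp only [dirDeriv, map_sum, map_mul]
  refine Finset.sum_congr rfl fun ij _ => ?_
  rw [← h]; rfl

theorem hasDerivAt_evS_exp (A : Matrix (Fin n) (Fin n) ℂ) (p : MvPolynomial (Fin n × Fin n) ℂ)
    (t : ℂ) : HasDerivAt (fun s : ℂ => evS (NormedSpace.exp (s • A)) p)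
      (evS (NormedSpace.exp (t • A)) (dirDeriv A p)) t := by
  rw [evS_dirDeriv]
  exact hasDerivAt_evS (hasDerivAt_matrix_exp_smul A t) p

theorem continuous_evS (p : MvPolynomial (Fin n × Fin n) ℂ) :
    Continuous fun Z : Matrix (Fin n) (Fin n) ℂ => evS Z p := by
  have h : Continuous fun Z : Matrix (Fin n) (Fin n) ℂ =>
      eval (fun ij : Fin n × Fin n => (Z - 1) ij.1 ij.2) p := by
    refine (MvPolynomial.continuous_eval p).comp ?_
    exact continuous_pi fun ij => (continuous_id.matrix_elem ij.1 ij.2).sub continuous_const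
  simpa [evS, aeval_eq_eval] using h

end Polynomials

section VanishingIdeal

open Filter Topology MvPolynomial

variable {n : ℕ}

/-- The ideal of all polynomials, in the coordinates centred at the identity, that vanish on a set
of invertible matrices. -/
noncomputable def vanIdeal (G : Set (GL (Fin n) ℂ)) : Ideal (MvPolynomial (Fin n × Fin n) ℂ) where
  carrier := {p | ∀ g ∈ G, evS g.val p = 0}
  add_mem' hp hq g hg := by rw [map_add, hp g hg, hq g hg, add_zero]
  zero_mem' g _ := map_zero _
  smul_mem' c p hp g hg := by rw [smul_eq_mul, map_mul, hp g hg, mul_zero]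

theorem mem_vanIdeal {G : Set (GL (Fin n) ℂ)} {p : MvPolynomial (Fin n × Fin n) ℂ} :
    p ∈ vanIdeal G ↔ ∀ g ∈ G, evS g.val p = 0 := Iff.rfl

theorem isZariskiClosed_iff {G : Subgroup (GL (Fin n) ℂ)} :
    IsZariskiClosed G ↔ ∀ g : GL (Fin n) ℂ,
      (∀ p ∈ vanIdeal (G : Set (GL (Fin n) ℂ)), evS g.val p = 0) → g ∈ G := by
  constructor
  · rintro ⟨S, hS⟩ g hg
    rw [hS]
    intro p hp
    rw [← evS_aeval_genM]
    refine hg _ fun h hh => ?_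
    rw [evS_aeval_genM]
    exact (hS h).1 hh p hp
  · intro h
    let τ : MvPolynomial (Fin n × Fin n) ℂ →ₐ[ℂ] MvPolynomial (Fin n × Fin n) ℂ :=
      aeval fun ij => X ij - C ((1 : Matrix (Fin n) (Fin n) ℂ) ij.1 ij.2)
    have hτ : ∀ (Z : Matrix (Fin n) (Fin n) ℂ) p,
        aeval (fun ij : Fin n × Fin n => Z ij.1 ij.2) (τ p) = evS Z p := by
      intro Z p
      have : (aeval (fun ij : Fin n × Fin n => Z ij.1 ij.2)).comp τ = evS Z := by
        apply MvPolynomial.algHom_ext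
        intro ij
        simp [τ, evS]
      exact DFunLike.congr_fun this p
    refine ⟨τ '' vanIdeal (G : Set (GL (Fin n) ℂ)), fun g => ⟨?_, fun hg => h g fun p hp => ?_⟩⟩
    · rintro hg _ ⟨p, hp, rfl⟩
      rw [hτ]
      exact hp g hg
    · rw [← hτ]
      exact hg _ ⟨p, hp, rfl⟩

theorem IsZariskiClosedOverReal.isZariskiClosed {G : Subgroup (GL (Fin n) ℂ)}
    (hG : IsZariskiClosedOverReal G) : IsZariskiClosed G := by
  obtain ⟨S, hS⟩ := hG
  refine ⟨MvPolynomial.map (algebraMap ℝ ℂ) '' S, fun g => ?_⟩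
  rw [hS, Set.forall_mem_image]
  simp only [MvPolynomial.aeval_map_algebraMap]

theorem IsZariskiClosedOverReal.conj_mem {G : Subgroup (GL (Fin n) ℂ)}
    (hG : IsZariskiClosedOverReal G) {g : GL (Fin n) ℂ} (hg : g ∈ G) :
    Matrix.GeneralLinearGroup.map (starRingEnd ℂ) g ∈ G := by
  obtain ⟨S, hS⟩ := hG
  rw [hS] at hg ⊢
  intro p hp
  have h1 : aeval (fun ij : Fin n × Fin n => starRingEnd ℂ (g.val ij.1 ij.2)) p =
      starRingEnd ℂ (aeval (fun ij : Fin n × Fin n => g.val ij.1 ij.2) p) := by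
    have : aeval (fun ij : Fin n × Fin n => starRingEnd ℂ (g.val ij.1 ij.2)) =
      (Complex.conjAe : ℂ →ₐ[ℝ] ℂ).comp (aeval (fun ij : Fin n × Fin n => g.val ij.1 ij.2)) := by
      apply MvPolynomial.algHom_ext
      intro ij
      simp
    exact DFunLike.congr_fun this p
  rw [hg p hp, map_zero] at h1
  exact h1

/-- The Zariski tangent space at the identity. -/
noncomputable def tangentOne (G : Set (GL (Fin n) ℂ)) :
    Submodule ℂ (Matrix (Fin n) (Fin n) ℂ) where
  carrier := {A | ∀ p ∈ vanIdeal G, ∑ ij : Fin n × Fin n, evS 1 (pderiv ij p) * A ij.1 ij.2 = 0}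
  add_mem' hA hB p hp := by
    simp only [Matrix.add_apply, mul_add, Finset.sum_add_distrib, hA p hp, hB p hp, add_zero]
  zero_mem' p _ := by simp
  smul_mem' c A hA p hp := by
    have : ∀ ij : Fin n × Fin n, evS 1 (pderiv ij p) * (c • A) ij.1 ij.2 =
      c * (evS 1 (pderiv ij p) * A ij.1 ij.2) := fun ij => by
        rw [Matrix.smul_apply, smul_eq_mul]; ring
    simp only [this, ← Finset.mul_sum, hA p hp, mul_zero]

theorem dirDeriv_mem_vanIdeal {G : Subgroup (GL (Fin n) ℂ)} {A : Matrix (Fin n) (Fin n) ℂ}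
    (hA : A ∈ tangentOne (G : Set (GL (Fin n) ℂ))) {p : MvPolynomial (Fin n × Fin n) ℂ}
    (hp : p ∈ vanIdeal (G : Set (GL (Fin n) ℂ))) :
    dirDeriv A p ∈ vanIdeal (G : Set (GL (Fin n) ℂ)) := by
  intro g hg
  rw [evS_dirDeriv]
  have h1 : substM (g.val.map C * genM n) p ∈ vanIdeal (G : Set (GL (Fin n) ℂ)) := by
    intro h hh
    rw [evS_substM_left]
    exact hp (g * h) (G.mul_mem hg hh)
  have h2 := hasDerivAt_evS (hasDerivAt_matrix_const_add_smul 1 A 0)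
    (substM (g.val.map C * genM n) p)
  rw [zero_smul, add_zero, hA _ h1] at h2
  have h3 : HasDerivAt (fun s : ℂ => g.val * (1 + s • A)) (g.val * A) 0 := by
    have := (hasDerivAt_matrix_const' g.val (0 : ℂ)).matrix_mul
      (hasDerivAt_matrix_const_add_smul 1 A (0 : ℂ))
    simpa using this
  have h4 := hasDerivAt_evS h3 p
  simp only [evS_substM_left] at h2
  rw [zero_smul, add_zero, mul_one] at h4
  exact h4.unique h2

/-- The one-parameter groups generated by tangent vectors stay in the group: all derivatives at
the origin of a polynomial vanishing on the group vanish along such a one-parameter group. -/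
theorem expGL_mem_of_mem_tangentOne {G : Subgroup (GL (Fin n) ℂ)} (hG : IsZariskiClosed G)
    {A : Matrix (Fin n) (Fin n) ℂ} (hA : A ∈ tangentOne (G : Set (GL (Fin n) ℂ))) :
    expGL A ∈ G := by
  refine isZariskiClosed_iff.1 hG _ fun p hp => ?_
  have hD : ∀ k : ℕ, (dirDeriv A)^[k] p ∈ vanIdeal (G : Set (GL (Fin n) ℂ)) := by
    intro k
    induction k with
    | zero => exact hp
    | succ k ih => rw [Function.iterate_succ_apply']; exact dirDeriv_mem_vanIdeal hA ih
  have hit : ∀ k : ℕ, iteratedDeriv k (fun s : ℂ => evS (NormedSpace.exp (s • A)) p) =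
      fun s : ℂ => evS (NormedSpace.exp (s • A)) ((dirDeriv A)^[k] p) := by
    intro k
    induction k with
    | zero => simp
    | succ k ih =>
      rw [iteratedDeriv_succ, ih]
      funext t
      rw [Function.iterate_succ_apply']
      exact (hasDerivAt_evS_exp A _ t).deriv
  have hdiff : Differentiable ℂ (fun s : ℂ => evS (NormedSpace.exp (s • A)) p) :=
    fun t => (hasDerivAt_evS_exp A p t).differentiableAt
  have h := Complex.taylorSeries_eq_of_entire hdiff 0 1
  have hz : ∀ k : ℕ, evS (NormedSpace.exp ((0 : ℂ) • A)) ((dirDeriv A)^[k] p) = 0 := by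
    intro k
    have := hD k 1 G.one_mem
    rwa [zero_smul, NormedSpace.exp_zero, ← Units.val_one]
  simp only [hit, hz, smul_zero, tsum_zero, one_smul] at h
  exact h.symm

theorem mem_tangentOne_of_expGL_mem {G : Set (GL (Fin n) ℂ)} {A : Matrix (Fin n) (Fin n) ℂ}
    (hA : ∀ t : ℝ, expGL ((t : ℂ) • A) ∈ G) : A ∈ tangentOne G := by
  intro p hp
  have h0 := hasDerivAt_evS (hasDerivAt_matrix_exp_smul A 0) p
  rw [zero_smul, NormedSpace.exp_zero, one_mul] at h0
  generalize ∑ ij : Fin n × Fin n, evS 1 (pderiv ij p) * A ij.1 ij.2 = d at h0 ⊢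
  have h2 : ∀ s : ℝ, evS (NormedSpace.exp ((s : ℂ) • A)) p = 0 := by
    intro t
    have := mem_vanIdeal.1 hp _ (hA t)
    rwa [expGL_val] at this
  generalize hφ : (fun s : ℂ => evS (NormedSpace.exp (s • A)) p) = φ at h0
  have h1 : HasDerivAt (fun s : ℝ => φ s) d 0 := HasDerivAt.comp_ofReal (z := 0) (by simpa using h0)
  have h3 : (fun s : ℝ => φ s) = fun _ => 0 := by
    funext s
    rw [← hφ]
    exact h2 s
  rw [h3] at h1
  exact h1.unique (hasDerivAt_const (0 : ℝ) (0 : ℂ))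

theorem mem_realPoints {G : Subgroup (GL (Fin n) ℂ)} {h : GL (Fin n) ℝ} :
    h ∈ realPoints G ↔ Matrix.GeneralLinearGroup.map (algebraMap ℝ ℂ) h ∈ G := Iff.rfl

theorem map_val (h : GL (Fin n) ℝ) :
    (Matrix.GeneralLinearGroup.map (algebraMap ℝ ℂ) h).val = toComplex h.val := rfl

theorem isClosed_realPoints {G : Subgroup (GL (Fin n) ℂ)} (hG : IsZariskiClosed G) :
    IsClosed (realPoints G : Set (GL (Fin n) ℝ)) := by
  have : (realPoints G : Set (GL (Fin n) ℝ)) =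
      ⋂ p ∈ vanIdeal (G : Set (GL (Fin n) ℂ)), {h | evS (toComplex h.val) p = 0} := by
    ext h
    simp only [Set.mem_iInter, SetLike.mem_coe, mem_realPoints, Set.mem_ofPred_eq, ← map_val]
    exact ⟨fun hh p hp => mem_vanIdeal.1 hp _ hh, fun hh => isZariskiClosed_iff.1 hG _ hh⟩
  rw [this]
  refine isClosed_biInter fun p _ => ?_
  exact isClosed_singleton.preimage
    ((continuous_evS p).comp (continuous_toComplex.comp Units.continuous_val))

theorem map_expGL (A : Matrix (Fin n) (Fin n) ℝ) :
    Matrix.GeneralLinearGroup.map (algebraMap ℝ ℂ) (expGL A) = expGL (toComplex A) :=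
  Units.ext (toComplex_exp A)

theorem mem_gReal_iff {G : Subgroup (GL (Fin n) ℂ)} (hG : IsZariskiClosed G)
    {A : Matrix (Fin n) (Fin n) ℝ} :
    A ∈ gReal G ↔ toComplex A ∈ tangentOne (G : Set (GL (Fin n) ℂ)) := by
  rw [mem_lieAlg_iff (isClosed_realPoints hG)]
  constructor
  · intro h
    refine mem_tangentOne_of_expGL_mem fun t => ?_
    obtain ⟨k, hk, e⟩ := h t
    have : k = expGL (t • A) := Units.ext e
    rw [← toComplex_smul, ← map_expGL, ← this]
    exact hk
  · intro h t
    refine ⟨expGL (t • A), ?_, rfl⟩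
    change Matrix.GeneralLinearGroup.map (algebraMap ℝ ℂ) (expGL (t • A)) ∈ G
    rw [map_expGL, toComplex_smul]
    exact expGL_mem_of_mem_tangentOne hG (Submodule.smul_mem _ _ h)

/-- The complexified Lie algebra of the real points is the Zariski tangent space at the identity,
because the group is stable under complex conjugation. -/
theorem gComplex_eq_tangentOne {G : Subgroup (GL (Fin n) ℂ)} (hG : IsZariskiClosedOverReal G) :
    gComplex G = tangentOne (G : Set (GL (Fin n) ℂ)) := by
  have hZ := hG.isZariskiClosed
  ext A
  rw [gComplex, mem_complexify_iff]
  constructor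
  · rintro ⟨h1, h2⟩
    rw [← toComplex_re_add_im A]
    exact add_mem ((mem_gReal_iff hZ).1 h1) (Submodule.smul_mem _ _ ((mem_gReal_iff hZ).1 h2))
  · intro h
    have hc : conjM A ∈ tangentOne (G : Set (GL (Fin n) ℂ)) := by
      refine mem_tangentOne_of_expGL_mem fun t => ?_
      have h1 : (t : ℂ) • conjM A = conjM ((t : ℂ) • A) := by
        ext i j; simp [conjM]
      have h2 : expGL ((t : ℂ) • conjM A) =
          Matrix.GeneralLinearGroup.map (starRingEnd ℂ) (expGL ((t : ℂ) • A)) := by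
        rw [h1]
        exact Units.ext (conjM_exp _).symm
      rw [h2]
      exact hG.conj_mem (expGL_mem_of_mem_tangentOne hZ (Submodule.smul_mem _ _ h))
    constructor
    · refine (mem_gReal_iff hZ).2 ?_
      rw [toComplex_reM_eq]
      exact Submodule.smul_mem _ _ (add_mem h hc)
    · refine (mem_gReal_iff hZ).2 ?_
      rw [toComplex_imM_eq]
      exact Submodule.smul_mem _ _ (sub_mem h hc)

theorem expGL_mem {G : Subgroup (GL (Fin n) ℂ)} (hG : IsZariskiClosedOverReal G)
    {A : Matrix (Fin n) (Fin n) ℂ} (hA : A ∈ gComplex G) : expGL A ∈ G :=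
  expGL_mem_of_mem_tangentOne hG.isZariskiClosed (gComplex_eq_tangentOne hG ▸ hA)

theorem Ad_mem_gComplex {G : Subgroup (GL (Fin n) ℂ)} (hG : IsZariskiClosedOverReal G)
    {g : GL (Fin n) ℂ} (hg : g ∈ G) {A : Matrix (Fin n) (Fin n) ℂ} (hA : A ∈ gComplex G) :
    Ad g A ∈ gComplex G := by
  rw [gComplex_eq_tangentOne hG]
  refine mem_tangentOne_of_expGL_mem fun t => ?_
  have h : expGL ((t : ℂ) • Ad g A) = g * expGL ((t : ℂ) • A) * g⁻¹ := by
    refine Units.ext ?_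
    rw [expGL_val, Ad_apply, ← smul_mul_assoc, ← mul_smul_comm]
    exact Matrix.exp_units_conj g _
  rw [h]
  exact G.mul_mem (G.mul_mem hg (expGL_mem hG (Submodule.smul_mem _ _ hA))) (G.inv_mem hg)

end VanishingIdeal

end RealReductive

namespace RealReductive

/-! ### Density of the exponential image in the Zariski topology -/

section MadicFiltration

open Filter Topology MvPolynomial

variable {n : ℕ}

theorem _root_.MvPolynomial.IsHomogeneous.eval_smul {σ : Type*} {d : ℕ} {p : MvPolynomial σ ℂ}
    (hp : p.IsHomogeneous d) (c : ℂ) (x : σ → ℂ) : eval (c • x) p = c ^ d * eval x p := by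
  rw [eval_eq, eval_eq, Finset.mul_sum]
  refine Finset.sum_congr rfl fun m hm => ?_
  have h1 : m.degree = d := by
    have := hp (mem_support_iff.1 hm)
    rwa [Pi.one_def, ← Finsupp.degree_eq_weight_one] at this
  simp only [Pi.smul_apply, smul_eq_mul, mul_pow, Finset.prod_mul_distrib]
  rw [Finset.prod_pow_eq_pow_sum, ← Finsupp.degree_apply, h1]
  ring

/-- The lowest homogeneous component of a polynomial that vanishes along a curve
`t ↦ t • W t` vanishes at the tangent direction `W 0`. -/
theorem eval_homogeneousComponent_eq_zero {σ : Type*} {k : ℕ} {f : MvPolynomial σ ℂ}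
    (hf : f ∈ idealOfVars σ ℂ ^ k) {W : ℂ → σ → ℂ} {w : σ → ℂ}
    (hW : Tendsto W (𝓝[≠] 0) (𝓝 w)) (h0 : ∀ t, t ≠ 0 → eval (t • W t) f = 0) :
    eval w (homogeneousComponent k f) = 0 := by
  have hlow : ∀ d, d < k → homogeneousComponent d f = 0 := by
    intro d hd
    ext m
    rw [coeff_homogeneousComponent, coeff_zero]
    split_ifs with h
    · exact (mem_pow_idealOfVars_iff' k f).1 hf m (by omega)
    · rfl
  set S : (σ → ℂ) → ℂ → ℂ := fun x t => ∑ d ∈ Finset.range (f.totalDegree + 1 + k),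
    t ^ (d - k) * eval x (homogeneousComponent d f) with hS
  have hsum : ∑ d ∈ Finset.range (f.totalDegree + 1 + k), homogeneousComponent d f = f := by
    conv_rhs => rw [← sum_homogeneousComponent f]
    symm
    refine Finset.sum_subset (Finset.range_mono (by omega)) fun d _ hd => ?_
    exact homogeneousComponent_eq_zero _ _ (by simpa [Nat.lt_succ_iff] using hd)
  have hz : ∀ t, t ≠ 0 → S (W t) t = 0 := by
    intro t ht
    have h1 := h0 t ht
    rw [← hsum, map_sum] at h1
    have h2 : t ^ k * S (W t) t = 0 := by
      rw [← h1, hS, Finset.mul_sum]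
      refine Finset.sum_congr rfl fun d _ => ?_
      rw [(homogeneousComponent_isHomogeneous d f).eval_smul, ← mul_assoc, ← pow_add]
      rcases lt_or_ge d k with hd | hd
      · simp [hlow d hd]
      · rw [Nat.add_sub_cancel' hd]
    exact (mul_eq_zero.1 h2).resolve_left (pow_ne_zero _ ht)
  have hlim : Tendsto (fun t => S (W t) t) (𝓝[≠] 0) (𝓝 (S w 0)) := by
    refine tendsto_finsetSum _ fun d _ => ?_
    refine Tendsto.mul ?_ (((MvPolynomial.continuous_eval _).tendsto w).comp hW)
    exact ((continuous_pow (d - k)).tendsto (0 : ℂ)).mono_left nhdsWithin_le_nhds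
  have hlim0 : Tendsto (fun t => S (W t) t) (𝓝[≠] 0) (𝓝 0) :=
    tendsto_const_nhds.congr' (by
      filter_upwards [self_mem_nhdsWithin] with t ht using (hz t ht).symm)
  have hS0 : S w 0 = eval w (homogeneousComponent k f) := by
    rw [hS]
    simp only
    rw [Finset.sum_eq_single k]
    · simp
    · intro d _ hd
      rcases lt_or_ge d k with hdk | hdk
      · simp [hlow d hdk]
      · rw [zero_pow (by omega), zero_mul]
    · intro h
      exact absurd (Finset.mem_range.2 (by omega)) h
  rw [← hS0]
  exact tendsto_nhds_unique hlim hlim0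

theorem sub_homogeneousComponent_mem {σ : Type*} {k : ℕ} {f : MvPolynomial σ ℂ}
    (hf : f ∈ idealOfVars σ ℂ ^ k) :
    f - homogeneousComponent k f ∈ idealOfVars σ ℂ ^ (k + 1) := by
  rw [mem_pow_idealOfVars_iff'] at hf ⊢
  intro m hm
  rw [coeff_sub, coeff_homogeneousComponent]
  split_ifs with h
  · exact sub_self _
  · rw [hf m (by omega), sub_zero]

theorem homogeneousComponent_mem_pow {σ : Type*} (k : ℕ) (f : MvPolynomial σ ℂ) :
    homogeneousComponent k f ∈ idealOfVars σ ℂ ^ k := by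
  rw [mem_pow_idealOfVars_iff']
  intro m hm
  rw [coeff_homogeneousComponent, if_neg (by omega)]

/-- The substitution of linear forms for the variables given by a linear endomorphism of the
matrix space. -/
noncomputable def substLin (π : Matrix (Fin n) (Fin n) ℂ →ₗ[ℂ] Matrix (Fin n) (Fin n) ℂ) :
    MvPolynomial (Fin n × Fin n) ℂ →ₐ[ℂ] MvPolynomial (Fin n × Fin n) ℂ :=
  aeval fun ij => ∑ kl : Fin n × Fin n, C (π (Matrix.single kl.1 kl.2 1) ij.1 ij.2) * X kl

theorem sum_apply_single (π : Matrix (Fin n) (Fin n) ℂ →ₗ[ℂ] Matrix (Fin n) (Fin n) ℂ)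
    (Z : Matrix (Fin n) (Fin n) ℂ) (i j : Fin n) :
    ∑ kl : Fin n × Fin n, π (Matrix.single kl.1 kl.2 1) i j * Z kl.1 kl.2 = π Z i j := by
  conv_rhs => rw [Matrix.matrix_eq_sum_single Z]
  simp only [map_sum, Matrix.sum_apply, Fintype.sum_prod_type]
  refine Finset.sum_congr rfl fun k _ => Finset.sum_congr rfl fun l _ => ?_
  rw [show Matrix.single k l (Z k l) = Z k l • Matrix.single k l (1 : ℂ) by
    rw [Matrix.smul_single, smul_eq_mul, mul_one], map_smul, Matrix.smul_apply, smul_eq_mul,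
    mul_comm]

theorem eval_substLin (π : Matrix (Fin n) (Fin n) ℂ →ₗ[ℂ] Matrix (Fin n) (Fin n) ℂ)
    (Z : Matrix (Fin n) (Fin n) ℂ) (p : MvPolynomial (Fin n × Fin n) ℂ) :
    eval (fun ij : Fin n × Fin n => Z ij.1 ij.2) (substLin π p) =
      eval (fun ij : Fin n × Fin n => π Z ij.1 ij.2) p := by
  have : (aeval fun ij : Fin n × Fin n => Z ij.1 ij.2).comp (substLin π) =
      aeval (R := ℂ) fun ij : Fin n × Fin n => π Z ij.1 ij.2 := by
    apply MvPolynomial.algHom_ext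
    intro ij
    simp [substLin, ← sum_apply_single π Z]
  have h := DFunLike.congr_fun this p
  simpa [aeval_eq_eval] using h

theorem substLin_X_mem (π : Matrix (Fin n) (Fin n) ℂ →ₗ[ℂ] Matrix (Fin n) (Fin n) ℂ)
    (ij : Fin n × Fin n) : substLin π (X ij) ∈ idealOfVars (Fin n × Fin n) ℂ := by
  rw [substLin, aeval_X]
  exact Ideal.sum_mem _ fun kl _ => Ideal.mul_mem_left _ _ (Ideal.subset_span ⟨kl, rfl⟩)

/-- The ideal generated by the differences of the variables and the linear forms substituted
for them. -/
noncomputable def substIdeal (π : Matrix (Fin n) (Fin n) ℂ →ₗ[ℂ] Matrix (Fin n) (Fin n) ℂ) :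
    Ideal (MvPolynomial (Fin n × Fin n) ℂ) :=
  Ideal.span (Set.range fun ij => X ij - substLin π (X ij))

theorem sub_substLin_mem (π : Matrix (Fin n) (Fin n) ℂ →ₗ[ℂ] Matrix (Fin n) (Fin n) ℂ)
    (p : MvPolynomial (Fin n × Fin n) ℂ) : p - substLin π p ∈ substIdeal π := by
  induction p using MvPolynomial.induction_on with
  | C a => simp [substLin]
  | add p q hp hq =>
    rw [map_add, add_sub_add_comm]
    exact add_mem hp hq
  | mul_X p ij hp =>
    have : p * X ij - substLin π (p * X ij) =
        X ij * (p - substLin π p) + substLin π p * (X ij - substLin π (X ij)) := by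
      rw [map_mul]; ring
    rw [this]
    exact add_mem (Ideal.mul_mem_left _ _ hp)
      (Ideal.mul_mem_left _ _ (Ideal.subset_span ⟨ij, rfl⟩))

theorem sub_substLin_mem_mul_pow (π : Matrix (Fin n) (Fin n) ℂ →ₗ[ℂ] Matrix (Fin n) (Fin n) ℂ)
    (k : ℕ) {p : MvPolynomial (Fin n × Fin n) ℂ}
    (hp : p ∈ idealOfVars (Fin n × Fin n) ℂ ^ (k + 1)) :
    p - substLin π p ∈ substIdeal π * idealOfVars (Fin n × Fin n) ℂ ^ k := by
  have hm : ∀ a ∈ idealOfVars (Fin n × Fin n) ℂ,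
      substLin π a ∈ idealOfVars (Fin n × Fin n) ℂ := by
    intro a ha
    have : idealOfVars (Fin n × Fin n) ℂ ≤ (idealOfVars (Fin n × Fin n) ℂ).comap (substLin π) := by
      rw [idealOfVars, Ideal.span_le]
      rintro _ ⟨ij, rfl⟩
      exact substLin_X_mem π ij
    exact this ha
  induction k generalizing p with
  | zero => rw [pow_zero, mul_one]; exact sub_substLin_mem π p
  | succ k ih =>
    rw [pow_succ'] at hp
    induction hp using Submodule.mul_induction_on' with
    | mem_mul_mem a ha b hb =>
      have e : a * b - substLin π (a * b) =
          (a - substLin π a) * b + substLin π a * (b - substLin π b) := by rw [map_mul]; ring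
      rw [e]
      refine add_mem (Ideal.mul_mem_mul (sub_substLin_mem π a) hb) ?_
      rw [pow_succ', mul_left_comm]
      exact Ideal.mul_mem_mul (hm a ha) (ih hb)
    | add x _ y _ hx hy =>
      rw [map_add, add_sub_add_comm]
      exact add_mem hx hy

theorem evS_one_eq_coeff (p : MvPolynomial (Fin n × Fin n) ℂ) : evS 1 p = coeff 0 p := by
  rw [evS, sub_self, ← constantCoeff_eq, ← eval_zero', aeval_eq_eval]
  rfl

/-- The differential at the identity matrix, as a map from polynomials to linear forms. -/
noncomputable def diffOne (n : ℕ) : MvPolynomial (Fin n × Fin n) ℂ →ₗ[ℂ]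
    Module.Dual ℂ (Matrix (Fin n) (Fin n) ℂ) :=
  ∑ ij : Fin n × Fin n, ((evS 1).toLinearMap ∘ₗ (pderiv ij).toLinearMap).smulRight
    (Matrix.entryLinearMap ℂ ℂ ij.1 ij.2)

theorem diffOne_apply (p : MvPolynomial (Fin n × Fin n) ℂ) (A : Matrix (Fin n) (Fin n) ℂ) :
    diffOne n p A = ∑ ij : Fin n × Fin n, evS 1 (pderiv ij p) * A ij.1 ij.2 := by
  simp [diffOne, LinearMap.sum_apply]

theorem mem_sq_of_diffOne_eq_zero {p : MvPolynomial (Fin n × Fin n) ℂ} (h0 : evS 1 p = 0)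
    (h1 : diffOne n p = 0) : p ∈ idealOfVars (Fin n × Fin n) ℂ ^ 2 := by
  classical
  rw [mem_pow_idealOfVars_iff']
  intro m hm
  have hm' : m.degree = 0 ∨ m.degree = 1 := by omega
  rcases hm' with hm0 | hm1
  · rw [(Finsupp.degree_eq_zero_iff m).1 hm0, ← evS_one_eq_coeff, h0]
  · obtain ⟨ij, rfl⟩ : ∃ ij, m = Finsupp.single ij 1 := by
      have h2 : m ∈ Set.range fun ij => Finsupp.single ij 1 := by
        rw [Finsupp.range_single_one]
        exact hm1
      exact h2.imp fun ij h => h.symm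
    have h2 := DFunLike.congr_fun h1 (Matrix.single ij.1 ij.2 1)
    rw [diffOne_apply, Finset.sum_eq_single ij] at h2
    · rw [evS_one_eq_coeff, coeff_pderiv] at h2
      simpa using h2
    · intro kl _ hkl
      rw [Matrix.single_apply_of_ne, mul_zero]
      rintro ⟨h3, h4⟩
      exact hkl (Prod.ext h3.symm h4.symm)
    · simp

theorem diffOne_X (ij : Fin n × Fin n) (A : Matrix (Fin n) (Fin n) ℂ) :
    diffOne n (X ij) A = A ij.1 ij.2 := by
  rw [diffOne_apply, Finset.sum_eq_single ij]
  · simp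
  · intro kl _ hkl
    rw [pderiv_X_of_ne hkl.symm, map_zero, zero_mul]
  · simp

/-- If `π` is a linear projection onto the tangent space then every linear form `y - y ∘ π` is, up
to terms of order two, a polynomial vanishing on the group. -/
theorem substIdeal_le {G : Set (GL (Fin n) ℂ)} (h1G : 1 ∈ G)
    {π : Matrix (Fin n) (Fin n) ℂ →ₗ[ℂ] Matrix (Fin n) (Fin n) ℂ}
    (hπ : ∀ A ∈ tangentOne G, π A = A) :
    substIdeal π ≤ vanIdeal G ⊔ idealOfVars (Fin n × Fin n) ℂ ^ 2 := by
  rw [substIdeal, Ideal.span_le]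
  rintro _ ⟨ij, rfl⟩
  set L : Submodule ℂ (Module.Dual ℂ (Matrix (Fin n) (Fin n) ℂ)) :=
    ((vanIdeal G).restrictScalars ℂ).map (diffOne n) with hL
  have hT : L.dualCoannihilator = tangentOne G := by
    ext A
    rw [Submodule.mem_dualCoannihilator]
    constructor
    · intro h p hp
      rw [← diffOne_apply]
      exact h _ ⟨p, hp, rfl⟩
    · rintro h _ ⟨p, hp, rfl⟩
      rw [diffOne_apply]
      exact h p hp
  set q : MvPolynomial (Fin n × Fin n) ℂ := X ij - substLin π (X ij) with hq
  have hqd : ∀ A, diffOne n q A = A ij.1 ij.2 - π A ij.1 ij.2 := by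
    intro A
    rw [hq, map_sub, LinearMap.sub_apply, diffOne_X, substLin, aeval_X, map_sum,
      LinearMap.sum_apply, ← sum_apply_single π A]
    congr 1
    refine Finset.sum_congr rfl fun kl _ => ?_
    rw [← smul_eq_C_mul, map_smul, LinearMap.smul_apply, diffOne_X, smul_eq_mul]
  have hmem : diffOne n q ∈ L := by
    rw [← Subspace.dualCoannihilator_dualAnnihilator_eq (W := L), hT,
      Submodule.mem_dualAnnihilator]
    intro A hA
    rw [hqd, hπ A hA, sub_self]
  obtain ⟨p, hp, hpq⟩ := hmem
  have hq0 : evS 1 q = 0 := by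
    rw [hq, map_sub, substLin, aeval_X, evS]
    simp
  have hp0 : evS 1 p = 0 := by
    have := mem_vanIdeal.1 hp 1 h1G
    rwa [Units.val_one] at this
  have hr : q - p ∈ idealOfVars (Fin n × Fin n) ℂ ^ 2 :=
    mem_sq_of_diffOne_eq_zero (by rw [map_sub, hq0, hp0, sub_zero])
      (by rw [map_sub, hpq, sub_self])
  change q ∈ _
  rw [← add_sub_cancel p q]
  exact Submodule.add_mem_sup hp hr

/-- A polynomial that vanishes on all exponentials of tangent vectors lies in every power of the
maximal ideal at the identity, modulo the vanishing ideal of the group. -/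
theorem mem_sup_pow_of_evS_exp_eq_zero {G : Subgroup (GL (Fin n) ℂ)} (hG : IsZariskiClosed G)
    {f : MvPolynomial (Fin n × Fin n) ℂ}
    (hf : ∀ A ∈ tangentOne (G : Set (GL (Fin n) ℂ)), evS (NormedSpace.exp A) f = 0) (k : ℕ) :
    f ∈ vanIdeal (G : Set (GL (Fin n) ℂ)) ⊔ idealOfVars (Fin n × Fin n) ℂ ^ k := by
  set I := vanIdeal (G : Set (GL (Fin n) ℂ)) with hI
  induction k with
  | zero => simp
  | succ k ih =>
    obtain ⟨i, hi, F, hF, rfl⟩ := Submodule.mem_sup.1 ih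
    have hFe : ∀ A ∈ tangentOne (G : Set (GL (Fin n) ℂ)), evS (NormedSpace.exp A) F = 0 := by
      intro A hA
      have h1 := hf A hA
      have h2 := mem_vanIdeal.1 hi _ (expGL_mem_of_mem_tangentOne hG hA)
      rw [expGL_val] at h2
      rwa [map_add, h2, zero_add] at h1
    have hFk : ∀ A ∈ tangentOne (G : Set (GL (Fin n) ℂ)),
        eval (fun ij : Fin n × Fin n => A ij.1 ij.2) (homogeneousComponent k F) = 0 := by
      intro A hA
      refine eval_homogeneousComponent_eq_zero hF
        (W := fun t ij => t⁻¹ * (NormedSpace.exp (t • A) - 1) ij.1 ij.2) ?_ ?_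
      · rw [tendsto_pi_nhds]
        intro ij
        have h1 := (hasDerivAt_matrix_exp_smul A 0).linearMap_matrix
          (Matrix.entryLinearMap ℂ ℂ ij.1 ij.2)
        have h2 := h1.tendsto_slope
        simp only [zero_smul, NormedSpace.exp_zero, one_mul] at h2
        refine h2.congr fun t => ?_
        rw [slope_def_field]
        simp [div_eq_inv_mul]
      · intro t ht
        have h1 := hFe (t • A) (Submodule.smul_mem _ _ hA)
        rw [evS, aeval_eq_eval] at h1
        rw [← h1]
        congr 2
        funext ij
        simp only [Pi.smul_apply, smul_eq_mul]
        rw [← mul_assoc, mul_inv_cancel₀ ht, one_mul]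
    obtain ⟨π₀, hπ₀⟩ := LinearMap.exists_leftInverse_of_injective
      (tangentOne (G : Set (GL (Fin n) ℂ))).subtype (Submodule.ker_subtype _)
    set π := (tangentOne (G : Set (GL (Fin n) ℂ))).subtype ∘ₗ π₀ with hπ
    have hπ1 : ∀ A ∈ tangentOne (G : Set (GL (Fin n) ℂ)), π A = A := by
      intro A hA
      have := DFunLike.congr_fun hπ₀ ⟨A, hA⟩
      simpa [hπ] using congrArg Subtype.val this
    have hsub : substLin π (homogeneousComponent k F) = 0 := by
      refine MvPolynomial.funext fun x => ?_
      have h1 := eval_substLin π (Matrix.of fun i j => x (i, j)) (homogeneousComponent k F)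
      rw [hFk (π (Matrix.of fun i j => x (i, j))) (π₀ (Matrix.of fun i j => x (i, j))).2] at h1
      rw [map_zero, ← h1]
      rfl
    have hcomp : homogeneousComponent k F ∈ I ⊔ idealOfVars (Fin n × Fin n) ℂ ^ (k + 1) := by
      rcases Nat.eq_zero_or_pos k with rfl | hk
      · have h1 := hFk 0 (Submodule.zero_mem _)
        rw [homogeneousComponent_zero, eval_C] at h1
        rw [homogeneousComponent_zero, h1, C_0]
        exact Submodule.zero_mem _
      · obtain ⟨l, rfl⟩ := Nat.exists_eq_add_of_le' hk
        have h1 := sub_substLin_mem_mul_pow π l (homogeneousComponent_mem_pow (l + 1) F)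
        rw [hsub, sub_zero] at h1
        have h2 := Ideal.mul_mono (substIdeal_le G.one_mem hπ1)
          (le_refl (idealOfVars (Fin n × Fin n) ℂ ^ l)) h1
        rw [Ideal.sup_mul, ← pow_add, add_comm 2 l] at h2
        have h3 : I * idealOfVars (Fin n × Fin n) ℂ ^ l ≤ I := Ideal.mul_le_left
        exact (sup_le_sup_right h3 _ :) h2
    have e : i + F = i + (homogeneousComponent k F + (F - homogeneousComponent k F)) := by ring
    rw [e]
    exact add_mem (Submodule.mem_sup_left hi)
      (add_mem hcomp (Submodule.mem_sup_right (sub_homogeneousComponent_mem hF)))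

/-- By Krull's intersection theorem, a polynomial vanishing on all exponentials of tangent vectors
vanishes on a Zariski neighbourhood of the identity in the group. -/
theorem exists_mul_mem_vanIdeal {G : Subgroup (GL (Fin n) ℂ)} (hG : IsZariskiClosed G)
    {f : MvPolynomial (Fin n × Fin n) ℂ}
    (hf : ∀ A ∈ tangentOne (G : Set (GL (Fin n) ℂ)), evS (NormedSpace.exp A) f = 0) :
    ∃ u : MvPolynomial (Fin n × Fin n) ℂ, evS 1 u = 1 ∧
      u * f ∈ vanIdeal (G : Set (GL (Fin n) ℂ)) := by
  set I := vanIdeal (G : Set (GL (Fin n) ℂ)) with hI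
  have hmem : (Ideal.Quotient.mk I f) ∈ (⨅ i : ℕ, idealOfVars (Fin n × Fin n) ℂ ^ i • ⊤ :
      Submodule (MvPolynomial (Fin n × Fin n) ℂ) (MvPolynomial (Fin n × Fin n) ℂ ⧸ I)) := by
    rw [Submodule.mem_iInf]
    intro k
    obtain ⟨i, hi, F, hF, e⟩ := Submodule.mem_sup.1 (mem_sup_pow_of_evS_exp_eq_zero hG hf k)
    have h1 : Ideal.Quotient.mk I f = F • (1 : MvPolynomial (Fin n × Fin n) ℂ ⧸ I) := by
      rw [← e, map_add, Ideal.Quotient.eq_zero_iff_mem.2 hi, zero_add]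
      change _ = Ideal.Quotient.mk I (F * 1)
      rw [mul_one]
    rw [h1]
    exact Submodule.smul_mem_smul hF trivial
  obtain ⟨r, hr⟩ := (Ideal.mem_iInf_smul_pow_eq_bot_iff _ _).1 hmem
  refine ⟨1 - r, ?_, ?_⟩
  · have h0 : evS 1 (r : MvPolynomial (Fin n × Fin n) ℂ) = 0 := by
      have h1 : (r : MvPolynomial (Fin n × Fin n) ℂ) ∈ idealOfVars (Fin n × Fin n) ℂ ^ 1 := by
        rw [pow_one]; exact r.2
      rw [evS_one_eq_coeff]
      exact (mem_pow_idealOfVars_iff' 1 _).1 h1 0 (by simp)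
    rw [map_sub, map_one, h0, sub_zero]
  · rw [← Ideal.Quotient.eq_zero_iff_mem, sub_mul, one_mul, map_sub, sub_eq_zero]
    exact hr.symm

end MadicFiltration

end RealReductive

namespace RealReductive

/-! ### Groups generated by entire curves -/

section Density

open Filter Topology MvPolynomial

variable {n : ℕ}

theorem differentiable_evS {γ : ℂ → Matrix (Fin n) (Fin n) ℂ}
    (hγ : ∀ i j, Differentiable ℂ fun t => γ t i j) (p : MvPolynomial (Fin n × Fin n) ℂ) :
    Differentiable ℂ fun t => evS (γ t) p := by
  induction p using MvPolynomial.induction_on with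
  | C a => simp [evS]
  | add p q hp hq =>
    simp only [map_add]
    exact hp.add hq
  | mul_X p ij hp =>
    have h1 : Differentiable ℂ fun t => evS (γ t) (X ij) := by
      simpa [evS] using (hγ ij.1 ij.2).sub_const ((1 : Matrix (Fin n) (Fin n) ℂ) ij.1 ij.2)
    have h2 : (fun t => evS (γ t) (p * X ij)) = fun t => evS (γ t) p * evS (γ t) (X ij) :=
      funext fun t => map_mul _ _ _
    rw [h2]
    exact hp.mul h1

theorem differentiable_exp_smul_apply (A : Matrix (Fin n) (Fin n) ℂ) (i j : Fin n) :
    Differentiable ℂ fun t : ℂ => NormedSpace.exp (t • A) i j := fun t =>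
  ((hasDerivAt_matrix_exp_smul A t).linearMap_matrix
    (Matrix.entryLinearMap ℂ ℂ i j)).differentiableAt

theorem differentiable_mul_apply {γ δ : ℂ → Matrix (Fin n) (Fin n) ℂ}
    (hγ : ∀ i j, Differentiable ℂ fun t => γ t i j)
    (hδ : ∀ i j, Differentiable ℂ fun t => δ t i j) (i j : Fin n) :
    Differentiable ℂ fun t => (γ t * δ t) i j := by
  simp only [Matrix.mul_apply]
  exact Differentiable.fun_sum fun k _ => (hγ i k).mul (hδ k j)

/-- The subgroup of all elements that are joined to the identity by an entire curve. -/
def arcSubgroup (G : Subgroup (GL (Fin n) ℂ)) : Subgroup (GL (Fin n) ℂ) where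
  carrier := {g | ∃ γ : ℂ → GL (Fin n) ℂ, (∀ i j, Differentiable ℂ fun t => (γ t).val i j) ∧
    (∀ i j, Differentiable ℂ fun t => (γ t)⁻¹.val i j) ∧ γ 0 = 1 ∧ γ 1 = g ∧ ∀ t, γ t ∈ G}
  mul_mem' := by
    rintro _ _ ⟨γ, h1, h2, h3, rfl, h5⟩ ⟨δ, k1, k2, k3, rfl, k5⟩
    refine ⟨fun t => γ t * δ t, ?_, ?_, by simp only [h3, k3, mul_one], rfl,
      fun t => G.mul_mem (h5 t) (k5 t)⟩
    · simpa only [Units.val_mul] using differentiable_mul_apply h1 k1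
    · simpa only [mul_inv_rev, Units.val_mul] using differentiable_mul_apply k2 h2
  one_mem' := ⟨fun _ => 1, fun _ _ => differentiable_const _, fun _ _ => differentiable_const _,
    rfl, rfl, fun _ => G.one_mem⟩
  inv_mem' := by
    rintro _ ⟨γ, h1, h2, h3, rfl, h5⟩
    refine ⟨fun t => (γ t)⁻¹, h2, ?_, by simp only [h3, inv_one], rfl, fun t => G.inv_mem (h5 t)⟩
    simpa only [inv_inv] using h1

theorem expGL_mem_arcSubgroup {G : Subgroup (GL (Fin n) ℂ)} (hG : IsZariskiClosed G)
    {A : Matrix (Fin n) (Fin n) ℂ} (hA : A ∈ tangentOne (G : Set (GL (Fin n) ℂ))) :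
    expGL A ∈ arcSubgroup G := by
  refine ⟨fun t => expGL (t • A), fun i j => differentiable_exp_smul_apply A i j, fun i j => ?_,
    by simp only [zero_smul, expGL_zero], by simp only [one_smul],
    fun t => expGL_mem_of_mem_tangentOne hG (Submodule.smul_mem _ _ hA)⟩
  simp only [expGL_inv_val, ← smul_neg]
  exact differentiable_exp_smul_apply (-A) i j

/-- A polynomial vanishing on all exponentials of tangent vectors vanishes on all entire curves
through the identity. -/
theorem mem_vanIdeal_arcSubgroup {G : Subgroup (GL (Fin n) ℂ)} (hG : IsZariskiClosed G)
    {f : MvPolynomial (Fin n × Fin n) ℂ}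
    (hf : ∀ A ∈ tangentOne (G : Set (GL (Fin n) ℂ)), evS (NormedSpace.exp A) f = 0) :
    f ∈ vanIdeal (arcSubgroup G : Set (GL (Fin n) ℂ)) := by
  obtain ⟨u, hu1, huf⟩ := exists_mul_mem_vanIdeal hG hf
  rintro _ ⟨γ, h1, -, h3, rfl, h5⟩
  have hdu := differentiable_evS h1 u
  have hdf := differentiable_evS h1 f
  have hne : ∀ᶠ t in 𝓝 (0 : ℂ), evS (γ t).val u ≠ 0 := by
    refine hdu.continuous.continuousAt.eventually_ne ?_
    rw [h3, Units.val_one, hu1]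
    exact one_ne_zero
  have hev : (fun t => evS (γ t).val f) =ᶠ[𝓝 0] 0 := by
    filter_upwards [hne] with t ht
    have := mem_vanIdeal.1 huf _ (h5 t)
    rw [map_mul] at this
    exact (mul_eq_zero.1 this).resolve_left ht
  have han : AnalyticOnNhd ℂ (fun t => evS (γ t).val f) Set.univ :=
    hdf.differentiableOn.analyticOnNhd isOpen_univ
  exact congrFun (han.eq_of_eventuallyEq (analyticOnNhd_const (v := (0 : ℂ))) hev) 1

/-- A single polynomial `u` with `u(1) = 1` multiplies every polynomial vanishing on the arc subgroup
into the vanishing ideal of `G`: near the identity, the two sets have the same Zariski closure. -/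
theorem exists_mul_mem_vanIdeal_of_mem_arc {G : Subgroup (GL (Fin n) ℂ)} (hG : IsZariskiClosed G) :
    ∃ u : MvPolynomial (Fin n × Fin n) ℂ, evS 1 u = 1 ∧
      ∀ f ∈ vanIdeal (arcSubgroup G : Set (GL (Fin n) ℂ)),
        u * f ∈ vanIdeal (G : Set (GL (Fin n) ℂ)) := by
  obtain ⟨s, hs⟩ := IsNoetherian.noetherian (vanIdeal (arcSubgroup G : Set (GL (Fin n) ℂ)))
  have h1 : ∀ f : s, ∃ u : MvPolynomial (Fin n × Fin n) ℂ, evS 1 u = 1 ∧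
      u * f ∈ vanIdeal (G : Set (GL (Fin n) ℂ)) := by
    intro f
    have hf : (f : MvPolynomial (Fin n × Fin n) ℂ) ∈
        vanIdeal (arcSubgroup G : Set (GL (Fin n) ℂ)) := hs ▸ Submodule.subset_span f.2
    refine exists_mul_mem_vanIdeal hG fun A hA => ?_
    have h0 := mem_vanIdeal.1 hf (expGL A) (expGL_mem_arcSubgroup hG hA)
    rwa [expGL_val] at h0
  choose u hu1 hu using h1
  refine ⟨∏ f : s, u f, by rw [map_prod]; simp [hu1], fun f hf => ?_⟩
  rw [← hs] at hf
  induction hf using Submodule.span_induction with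
  | mem x hx =>
    rw [Finset.prod_eq_prod_sdiff_singleton_mul (Finset.mem_univ (⟨x, hx⟩ : s)), mul_assoc]
    exact Ideal.mul_mem_left _ _ (hu ⟨x, hx⟩)
  | zero => rw [mul_zero]; exact Submodule.zero_mem _
  | add x y _ _ hx hy => rw [mul_add]; exact add_mem hx hy
  | smul a x _ hx => rw [smul_eq_mul, mul_left_comm]; exact Ideal.mul_mem_left _ _ hx

/-- The Zariski closure of the group of all elements joined to the identity by an entire curve,
described as the group of those elements whose right translations preserve its vanishing ideal. -/
def arcClosure (G : Subgroup (GL (Fin n) ℂ)) : Subgroup (GL (Fin n) ℂ) where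
  carrier := {g | g ∈ G ∧ ∀ f ∈ vanIdeal (arcSubgroup G : Set (GL (Fin n) ℂ)),
    ∀ h ∈ arcSubgroup G, evS (h * g).val f = 0 ∧ evS (h * g⁻¹).val f = 0}
  mul_mem' := by
    rintro a b ⟨ha, ha'⟩ ⟨hb, hb'⟩
    refine ⟨G.mul_mem ha hb, fun f hf h hh => ⟨?_, ?_⟩⟩
    · have h1 : substM (genM n * b.val.map C) f ∈
          vanIdeal (arcSubgroup G : Set (GL (Fin n) ℂ)) := fun k hk => by
        rw [evS_substM_right]
        exact (hb' f hf k hk).1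
      have h2 := (ha' _ h1 h hh).1
      rwa [evS_substM_right, ← Units.val_mul, mul_assoc] at h2
    · have h1 : substM (genM n * a⁻¹.val.map C) f ∈
          vanIdeal (arcSubgroup G : Set (GL (Fin n) ℂ)) := fun k hk => by
        rw [evS_substM_right]
        exact (ha' f hf k hk).2
      have h2 := (hb' _ h1 h hh).2
      rwa [evS_substM_right, ← Units.val_mul, mul_assoc, ← mul_inv_rev] at h2
  one_mem' := ⟨G.one_mem, fun f hf h hh => by
    rw [inv_one, mul_one]
    exact ⟨hf h hh, hf h hh⟩⟩
  inv_mem' := by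
    rintro a ⟨ha, ha'⟩
    refine ⟨G.inv_mem ha, fun f hf h hh => ?_⟩
    rw [inv_inv]
    exact (ha' f hf h hh).symm

theorem isZariskiClosed_arcClosure {G : Subgroup (GL (Fin n) ℂ)} (hG : IsZariskiClosed G) :
    IsZariskiClosed (arcClosure G) := by
  refine isZariskiClosed_iff.2 fun g hg => ⟨?_, fun f hf h hh => ⟨?_, ?_⟩⟩
  · exact isZariskiClosed_iff.1 hG g fun p hp => hg p fun k hk => hp k hk.1
  · have h1 := hg (substM (h.val.map C * genM n) f) fun k hk => by
      rw [evS_substM_left]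
      exact (hk.2 f hf h hh).1
    rwa [evS_substM_left] at h1
  · obtain ⟨N, q, hq⟩ := exists_evS_inv (substM (h.val.map C * genM n) f)
    have h1 := hg q fun k hk => by
      rw [hq, evS_substM_left, ← Units.val_mul, (hk.2 f hf h hh).2, mul_zero]
    rw [hq, evS_substM_left, ← Units.val_mul] at h1
    exact (mul_eq_zero.1 h1).resolve_left
      (pow_ne_zero _ ((Matrix.isUnit_iff_isUnit_det _).1 g.isUnit).ne_zero)

/-- The closure of the arc subgroup contains a Zariski neighbourhood of the identity in `G`. -/
theorem exists_mem_arcClosure_of_ne_zero {G : Subgroup (GL (Fin n) ℂ)} (hG : IsZariskiClosed G) :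
    ∃ u : MvPolynomial (Fin n × Fin n) ℂ, evS 1 u = 1 ∧
      ∀ g ∈ G, evS g.val u ≠ 0 → g ∈ arcClosure G := by
  obtain ⟨u, hu1, hu⟩ := exists_mul_mem_vanIdeal_of_mem_arc hG
  have key : ∀ g ∈ G, evS g.val u ≠ 0 →
      ∀ f ∈ vanIdeal (arcSubgroup G : Set (GL (Fin n) ℂ)),
      ∀ h ∈ arcSubgroup G, evS (h * g).val f = 0 := by
    intro g hg hgu f hf h hh
    have h1 : substM (h.val.map C * genM n) f ∈
        vanIdeal (arcSubgroup G : Set (GL (Fin n) ℂ)) := fun k hk => by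
      have h0 := mem_vanIdeal.1 hf (h * k) ((arcSubgroup G).mul_mem hh hk)
      rwa [evS_substM_left, ← Units.val_mul]
    have h2 := mem_vanIdeal.1 (hu _ h1) g hg
    rw [map_mul, evS_substM_left] at h2
    exact (mul_eq_zero.1 h2).resolve_left hgu
  obtain ⟨N, q, hq⟩ := exists_evS_inv u
  refine ⟨u * q, ?_, fun g hg hne => ?_⟩
  · have := hq 1
    rw [inv_one, Units.val_one, Matrix.det_one, one_pow, one_mul] at this
    rw [map_mul, this, hu1, mul_one]
  · rw [map_mul, hq] at hne
    have h1 := left_ne_zero_of_mul hne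
    have h2 := right_ne_zero_of_mul (right_ne_zero_of_mul hne)
    exact ⟨hg, fun f hf h hh => ⟨key g hg h1 f hf h hh, key _ (G.inv_mem hg) h2 f hf h hh⟩⟩

/-- The closure has finite index because the translates of a Zariski neighbourhood of the identity
form an open cover of a quasi-compact space. -/
theorem relIndex_arcClosure_ne_zero {G : Subgroup (GL (Fin n) ℂ)} (hG : IsZariskiClosed G) :
    (arcClosure G).relIndex G ≠ 0 := by
  obtain ⟨u, hu1, hu⟩ := exists_mem_arcClosure_of_ne_zero hG
  set v : G → MvPolynomial (Fin n × Fin n) ℂ :=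
    fun h => substM ((h : GL (Fin n) ℂ)⁻¹.val.map C * genM n) u with hv
  have hve : ∀ (h : G) (g : GL (Fin n) ℂ), evS g.val (v h) = evS ((h : GL (Fin n) ℂ)⁻¹ * g).val u := by
    intro h g
    rw [hv]
    simp only
    rw [evS_substM_left, Units.val_mul]
  obtain ⟨s, hs, hsv⟩ := (Submodule.fg_span_iff_fg_span_finset_subset
    (R := MvPolynomial (Fin n × Fin n) ℂ) (Set.range v)).1 (IsNoetherian.noetherian _)
  choose w hw using fun p : s => hs p.2
  have hcov : ∀ g : G, ∃ p : s, (w p : GL (Fin n) ℂ)⁻¹ * g ∈ arcClosure G := by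
    intro g
    by_contra! hcon
    have h1 : ∀ p : s, evS (g : GL (Fin n) ℂ).val p = 0 := by
      intro p
      by_contra hne
      rw [← hw p, hve] at hne
      exact hcon p (hu _ (G.mul_mem (G.inv_mem (w p).2) g.2) hne)
    have h2 : v g ∈ Submodule.span (MvPolynomial (Fin n × Fin n) ℂ) (s : Set _) :=
      hsv ▸ Submodule.subset_span ⟨g, rfl⟩
    have h3 : Submodule.span (MvPolynomial (Fin n × Fin n) ℂ) (s : Set _) ≤
        RingHom.ker (evS (g : GL (Fin n) ℂ).val) := by
      rw [Submodule.span_le]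
      exact fun p hp => h1 ⟨p, hp⟩
    have h4 := RingHom.mem_ker.1 (h3 h2)
    rw [hve, inv_mul_cancel, Units.val_one, hu1] at h4
    exact one_ne_zero h4
  have hsurj : Function.Surjective
      (fun p : s => (QuotientGroup.mk (w p) : G ⧸ (arcClosure G).subgroupOf G)) := by
    intro x
    induction x using QuotientGroup.induction_on with
    | H g =>
      obtain ⟨p, hp⟩ := hcov g
      refine ⟨p, QuotientGroup.eq.2 ?_⟩
      rw [Subgroup.mem_subgroupOf]
      simpa using hp
  have : Finite (G ⧸ (arcClosure G).subgroupOf G) := Finite.of_surjective _ hsurj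
  exact Subgroup.index_ne_zero_of_finite

/-- In a connected algebraic group the exponentials of the elements of the Lie algebra are dense
in the Zariski topology. -/
theorem evS_eq_zero_of_evS_exp_eq_zero {G : Subgroup (GL (Fin n) ℂ)}
    (hG : IsZariskiClosedOverReal G) (hc : IsZariskiConnected G)
    {f : MvPolynomial (Fin n × Fin n) ℂ}
    (hf : ∀ A ∈ gComplex G, evS (NormedSpace.exp A) f = 0) {g : GL (Fin n) ℂ} (hg : g ∈ G) :
    evS g.val f = 0 := by
  have hZ := hG.isZariskiClosed
  rw [gComplex_eq_tangentOne hG] at hf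
  have h1 : arcClosure G = G := hc _ (fun g hg => hg.1) (isZariskiClosed_arcClosure hZ)
    (relIndex_arcClosure_ne_zero hZ)
  rw [← h1] at hg
  have h2 := (hg.2 f (mem_vanIdeal_arcSubgroup hZ hf) 1 (one_mem _)).1
  rwa [one_mul] at h2

end Density

end RealReductive

namespace RealReductive

/-! ### One-parameter groups in closed subgroups and maximal tori -/

section ClosedSubgroup

open Filter Topology

/-- A closed subgroup `S` of the unit group of a finite-dimensional algebra is covered, near the
identity, by the exponentials of its infinitesimal generators. -/
theorem exists_nhds_forall_mem_exp {A : Type*} [NormedRing A] [NormedAlgebra ℝ A]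
    [FiniteDimensional ℝ A] {S : Subgroup Aˣ} (hS : IsClosed (S : Set Aˣ)) {b : Submodule ℝ A}
    (hb : ∀ X, X ∈ b ↔ ∀ t : ℝ, ∃ h ∈ S, (h : A) = NormedSpace.exp (t • X)) :
    ∀ᶠ h in 𝓝 (1 : Aˣ), h ∈ S → ∃ X ∈ b, (h : A) = NormedSpace.exp X := by
  let _ : NormedAlgebra ℚ A := NormedAlgebra.restrictScalars ℚ ℝ A
  have : CompleteSpace A := FiniteDimensional.complete ℝ A
  obtain ⟨c, hbc⟩ := b.exists_isCompl
  let F : b × c → A := fun v => NormedSpace.exp (v.1 : A) * NormedSpace.exp (v.2 : A)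
  let e : (b × c) ≃L[ℝ] A := (Submodule.prodEquivOfIsCompl b c hbc).toContinuousLinearEquiv
  have hF0 : F 0 = 1 := by simp [F]
  have hF : HasStrictFDerivAt F (e : b × c →L[ℝ] A) 0 := by
    have h1 : HasStrictFDerivAt (fun v : b × c => NormedSpace.exp (v.1 : A))
        (b.subtypeL.comp (ContinuousLinearMap.fst ℝ b c)) 0 := by
      have h2 := (hasStrictFDerivAt_exp_zero (𝕂 := ℝ) (𝔸 := A))
      have h3 := (b.subtypeL.comp (ContinuousLinearMap.fst ℝ b c)).hasStrictFDerivAt (x := 0)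
      have h4 : (b.subtypeL.comp (ContinuousLinearMap.fst ℝ b c)) 0 = (0 : A) := map_zero _
      rw [← h4] at h2
      exact h2.comp 0 h3
    have h1' : HasStrictFDerivAt (fun v : b × c => NormedSpace.exp (v.2 : A))
        (c.subtypeL.comp (ContinuousLinearMap.snd ℝ b c)) 0 := by
      have h2 := (hasStrictFDerivAt_exp_zero (𝕂 := ℝ) (𝔸 := A))
      have h3 := (c.subtypeL.comp (ContinuousLinearMap.snd ℝ b c)).hasStrictFDerivAt (x := 0)
      have h4 : (c.subtypeL.comp (ContinuousLinearMap.snd ℝ b c)) 0 = (0 : A) := map_zero _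
      rw [← h4] at h2
      exact h2.comp 0 h3
    refine (h1.mul' h1').congr_fderiv ?_
    ext v <;> simp [e]
  have hmap : map F (𝓝 0) = 𝓝 1 := by
    rw [← hF0]
    exact hF.map_nhds_eq_of_equiv
  by_contra hcon
  rw [Filter.not_eventually] at hcon
  have hfreq : ∃ᶠ Z in 𝓝 (1 : A), ∃ h ∈ S, (h : A) = Z ∧ ¬ ∃ X ∈ b, Z = NormedSpace.exp X := by
    have h1 : Tendsto (fun h : Aˣ => (h : A)) (𝓝 1) (𝓝 1) := by
      have := (Units.continuous_val (M := A)).tendsto 1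
      rwa [Units.val_one] at this
    refine h1.frequently (hcon.mono fun h hh => ?_)
    push Not at hh
    exact ⟨h, hh.1, rfl, by push Not; exact hh.2⟩
  have hexpS : ∀ X ∈ b, ∃ h ∈ S, (h : A) = NormedSpace.exp X := fun X hX => by
    simpa using (hb X).1 hX 1
  rw [← hmap, Filter.frequently_map] at hfreq
  have hfreq2 : Filter.Frequently
      (fun Y : c => Y ≠ 0 ∧ ∃ h ∈ S, (h : A) = NormedSpace.exp (Y : A)) (𝓝 0) := by
    have h1 : Tendsto (fun v : b × c => v.2) (𝓝 0) (𝓝 0) := continuous_snd.tendsto 0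
    refine h1.frequently (hfreq.mono ?_)
    rintro ⟨X, Y⟩ ⟨h, hh, hhF, hne⟩
    refine ⟨fun hY => hne ⟨X, X.2, ?_⟩, ?_⟩
    · have : Y = 0 := hY
      simp [F, this]
    · obtain ⟨k, hk, hkX⟩ := hexpS X X.2
      refine ⟨k⁻¹ * h, S.mul_mem (S.inv_mem hk) hh, ?_⟩
      rw [Units.val_mul, hhF, Units.inv_mul_eq_iff_eq_mul, hkX]
  obtain ⟨Y, hY0, hY⟩ := Filter.exists_seq_forall_of_frequently hfreq2
  have hYne : ∀ k, ‖Y k‖ ≠ 0 := fun k => norm_ne_zero_iff.2 (hY k).1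
  obtain ⟨Z, hZ, φ, hφ, hlim⟩ := (isCompact_sphere (0 : c) 1).tendsto_subseq
    (x := fun k => ‖Y k‖⁻¹ • Y k) (fun k => by
      rw [mem_sphere_zero_iff_norm, norm_smul, norm_inv, norm_norm, inv_mul_cancel₀ (hYne k)])
  have hpow : ∀ (m : ℕ) (X : A), (∃ h ∈ S, (h : A) = NormedSpace.exp X) →
      ∃ h ∈ S, (h : A) = NormedSpace.exp (m • X) := by
    rintro m X ⟨h, hh, he⟩
    exact ⟨h ^ m, S.pow_mem hh m, by rw [Units.val_pow_eq_pow_val, he, NormedSpace.exp_nsmul]⟩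
  have hpos : ∀ t : ℝ, 0 ≤ t → ∃ h ∈ S, (h : A) = NormedSpace.exp (t • (Z : A)) := by
    intro t ht
    set m : ℕ → ℕ := fun k => ⌊t / ‖Y (φ k)‖⌋₊ with hm
    have hY0φ : Tendsto (fun k => ‖Y (φ k)‖) atTop (𝓝 0) := by
      have := (hY0.comp hφ.tendsto_atTop).norm
      simpa using this
    have hmt : Tendsto (fun k => (m k : ℝ) * ‖Y (φ k)‖) atTop (𝓝 t) := by
      have hlow : Tendsto (fun k => t - ‖Y (φ k)‖) atTop (𝓝 t) := by
        simpa using hY0φ.const_sub t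
      refine tendsto_of_tendsto_of_tendsto_of_le_of_le hlow tendsto_const_nhds ?_ ?_
      · intro k
        have hp : 0 < ‖Y (φ k)‖ := lt_of_le_of_ne (norm_nonneg _) (hYne _).symm
        have h1 := (Nat.lt_floor_add_one (t / ‖Y (φ k)‖)).le
        rw [div_le_iff₀ hp] at h1
        change t - ‖Y (φ k)‖ ≤ (m k : ℝ) * ‖Y (φ k)‖
        linarith
      · intro k
        have hp : 0 < ‖Y (φ k)‖ := lt_of_le_of_ne (norm_nonneg _) (hYne _).symm
        have h1 := Nat.floor_le (div_nonneg ht hp.le)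
        rwa [le_div_iff₀ hp] at h1
    have hmY : Tendsto (fun k => (m k) • (Y (φ k) : A)) atTop (𝓝 (t • (Z : A))) := by
      have h1 := hmt.smul ((continuous_subtype_val.tendsto Z).comp hlim)
      refine h1.congr fun k => ?_
      simp only [Function.comp, Submodule.coe_smul]
      rw [smul_smul, mul_assoc, mul_inv_cancel₀ (hYne _), mul_one, Nat.cast_smul_eq_nsmul]
    obtain ⟨u, hu⟩ : IsUnit (NormedSpace.exp (t • (Z : A))) := NormedSpace.isUnit_exp _
    choose g hgS hg using fun k => hpow (m k) _ (hY (φ k)).2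
    refine ⟨u, ?_, hu⟩
    refine hS.mem_of_tendsto (f := g) (b := atTop) ?_ (Eventually.of_forall hgS)
    rw [(Units.isOpenEmbedding_val (R := A)).isEmbedding.tendsto_nhds_iff]
    change Tendsto (fun k => (g k : A)) atTop (𝓝 (u : A))
    rw [hu]
    simp only [hg]
    exact ((NormedSpace.exp_continuous (𝔸 := A)).tendsto _).comp hmY
  have hZb : (Z : A) ∈ b := by
    rw [hb]
    intro t
    rcases le_total 0 t with ht | ht
    · exact hpos t ht
    · obtain ⟨h, hh, he⟩ := hpos (-t) (by linarith)
      refine ⟨h⁻¹, S.inv_mem hh, ?_⟩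
      have h1 : (h : A) * NormedSpace.exp (t • (Z : A)) = 1 := by
        rw [he, ← NormedSpace.exp_add_of_commute
          (((Commute.refl (Z : A)).smul_right t).smul_left (-t)), ← add_smul, neg_add_cancel,
          zero_smul, NormedSpace.exp_zero]
      exact Units.inv_eq_of_mul_eq_one_right h1
  have hZ0 : (Z : A) = 0 := by
    have := hbc.disjoint.le_bot (Submodule.mem_inf.2 ⟨hZb, Z.2⟩)
    exact (Submodule.mem_bot ℝ).1 this
  have hZ1 : ‖Z‖ = 1 := mem_sphere_zero_iff_norm.1 hZ
  rw [Submodule.coe_eq_zero.1 hZ0, norm_zero] at hZ1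
  exact zero_ne_one hZ1

attribute [local instance] LieRing.ofAssociativeRing

variable {n : ℕ}

/-- Near the identity, a closed subgroup of the general linear group is the exponential image of its
Lie algebra. -/
theorem eventually_exists_exp {H : Subgroup (GL (Fin n) ℝ)}
    (hH : IsClosed (H : Set (GL (Fin n) ℝ))) :
    ∀ᶠ h in 𝓝 (1 : GL (Fin n) ℝ), h ∈ H → ∃ X ∈ lieAlg H, h = expGL X := by
  let _ : NormedRing (Matrix (Fin n) (Fin n) ℝ) := Matrix.linftyOpNormedRing
  let _ : NormedAlgebra ℝ (Matrix (Fin n) (Fin n) ℝ) := Matrix.linftyOpNormedAlgebra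
  have h := exists_nhds_forall_mem_exp (A := Matrix (Fin n) (Fin n) ℝ) (S := H) hH
    (b := (lieAlg H).toSubmodule) (mem_lieAlg_iff hH)
  filter_upwards [h] with k hk hkH
  obtain ⟨X, hX, e⟩ := hk hkH
  exact ⟨X, hX, Units.ext e⟩

theorem expGL_smul_mem {H : Subgroup (GL (Fin n) ℝ)} (hH : IsClosed (H : Set (GL (Fin n) ℝ)))
    {X : Matrix (Fin n) (Fin n) ℝ} (hX : X ∈ lieAlg H) (t : ℝ) : expGL (t • X) ∈ H := by
  obtain ⟨h, hh, e⟩ := (mem_lieAlg_iff hH X).1 hX t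
  rwa [show expGL (t • X) = h from Units.ext e.symm]

theorem mem_lieAlg_of_expGL_mem {H : Subgroup (GL (Fin n) ℝ)}
    (hH : IsClosed (H : Set (GL (Fin n) ℝ))) {X : Matrix (Fin n) (Fin n) ℝ}
    (hX : ∀ t : ℝ, expGL (t • X) ∈ H) : X ∈ lieAlg H :=
  (mem_lieAlg_iff hH X).2 fun t => ⟨_, hX t, rfl⟩

theorem lieAlg_mono {H L : Subgroup (GL (Fin n) ℝ)} (hH : IsClosed (H : Set (GL (Fin n) ℝ)))
    (hL : IsClosed (L : Set (GL (Fin n) ℝ))) (h : H ≤ L) {X : Matrix (Fin n) (Fin n) ℝ}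
    (hX : X ∈ lieAlg H) : X ∈ lieAlg L :=
  mem_lieAlg_of_expGL_mem hL fun t => h (expGL_smul_mem hH hX t)

/-- A matrix commuting with a one-parameter group commutes with its generator. -/
theorem lie_eq_zero_of_forall_commute {X M : Matrix (Fin n) (Fin n) ℝ}
    (h : ∀ t : ℝ, NormedSpace.exp (t • X) * M = M * NormedSpace.exp (t • X)) : ⁅X, M⁆ = 0 := by
  have h1 := (hasDerivAt_matrix_exp_smul X 0).matrix_mul (hasDerivAt_matrix_const' M (0 : ℝ))
  have h2 := (hasDerivAt_matrix_const' M (0 : ℝ)).matrix_mul (hasDerivAt_matrix_exp_smul X 0)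
  simp only [h] at h1
  have h3 := h1.matrix_unique h2
  simp only [zero_smul, NormedSpace.exp_zero, one_mul, zero_mul, mul_zero, add_zero,
    zero_add] at h3
  rw [Ring.lie_def, h3, sub_self]

theorem exp_mul_eq_mul_exp_of_lie_eq_zero {X M : Matrix (Fin n) (Fin n) ℝ} (h : ⁅X, M⁆ = 0) :
    NormedSpace.exp X * M = M * NormedSpace.exp X := by
  have h1 : Commute X M := sub_eq_zero.1 ((Ring.lie_def X M).symm.trans h)
  let _ : NormedRing (Matrix (Fin n) (Fin n) ℝ) := Matrix.linftyOpNormedRing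
  let _ : NormedAlgebra ℝ (Matrix (Fin n) (Fin n) ℝ) := Matrix.linftyOpNormedAlgebra
  let _ : NormedAlgebra ℚ (Matrix (Fin n) (Fin n) ℝ) := NormedAlgebra.restrictScalars ℚ ℝ _
  exact h1.exp_left.eq

theorem lie_eq_zero_of_commutative {B : Subgroup (GL (Fin n) ℝ)}
    (hB : IsClosed (B : Set (GL (Fin n) ℝ))) (hc : ∀ g ∈ B, ∀ h ∈ B, g * h = h * g)
    {X Y : Matrix (Fin n) (Fin n) ℝ} (hX : X ∈ lieAlg B) (hY : Y ∈ lieAlg B) : ⁅X, Y⁆ = 0 := by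
  refine lie_eq_zero_of_forall_commute fun s => ?_
  have h1 : ⁅Y, NormedSpace.exp (s • X)⁆ = 0 := lie_eq_zero_of_forall_commute fun t =>
    congrArg Units.val (hc _ (expGL_smul_mem hB hY t) _ (expGL_smul_mem hB hX s))
  rw [Ring.lie_def, sub_eq_zero] at h1
  exact h1.symm

/-- A matrix commuting with the Lie algebra of a closed connected group commutes with the
group. -/
theorem commute_of_forall_lie_eq_zero {B : Subgroup (GL (Fin n) ℝ)}
    (hB : IsClosed (B : Set (GL (Fin n) ℝ))) (hc : IsConnected (B : Set (GL (Fin n) ℝ)))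
    {Y : Matrix (Fin n) (Fin n) ℝ} (hY : ∀ X ∈ lieAlg B, ⁅X, Y⁆ = 0) {h : GL (Fin n) ℝ}
    (hh : h ∈ B) : h.val * Y = Y * h.val := by
  let C : Subgroup (GL (Fin n) ℝ) :=
    { carrier := {g | g.val * Y = Y * g.val}
      mul_mem' := fun {a b} ha hb => by
        change a.val * b.val * Y = Y * (a.val * b.val)
        rw [mul_assoc, (hb : b.val * Y = _), ← mul_assoc, (ha : a.val * Y = _), mul_assoc]
      one_mem' := by change (1 : Matrix _ _ ℝ) * Y = Y * 1; rw [one_mul, mul_one]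
      inv_mem' := fun {a} ha => by
        change a⁻¹.val * Y = Y * a⁻¹.val
        rw [Units.inv_mul_eq_iff_eq_mul, ← mul_assoc, Units.eq_mul_inv_iff_mul_eq]
        exact (ha : a.val * Y = _).symm }
  have hopen : IsOpen (C.subgroupOf B : Set B) := by
    refine Subgroup.isOpen_of_mem_nhds _ (g := 1) ?_
    have h1 : Tendsto (fun g : B => (g : GL (Fin n) ℝ)) (𝓝 1) (𝓝 1) :=
      continuous_subtype_val.tendsto 1
    filter_upwards [h1.eventually (eventually_exists_exp hB)] with g hg
    obtain ⟨X, hX, e⟩ := hg g.2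
    change (g : GL (Fin n) ℝ).val * Y = Y * (g : GL (Fin n) ℝ).val
    rw [e]
    exact exp_mul_eq_mul_exp_of_lie_eq_zero (hY X hX)
  have : ConnectedSpace B := isConnected_iff_connectedSpace.1 hc
  have huniv : (C.subgroupOf B : Set B) = Set.univ :=
    IsClopen.eq_univ ⟨Subgroup.isClosed_of_isOpen _ hopen, hopen⟩ ⟨1, one_mem _⟩
  have h1 : (⟨h, hh⟩ : B) ∈ (C.subgroupOf B : Set B) := huniv ▸ trivial
  exact h1

theorem identityComponent_le (K : Subgroup (GL (Fin n) ℝ)) : identityComponent K ≤ K := by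
  rintro _ ⟨k, -, rfl⟩
  exact k.2

theorem subset_identityComponent {K : Subgroup (GL (Fin n) ℝ)} {S : Set (GL (Fin n) ℝ)}
    (hS : IsPreconnected S) (h1 : 1 ∈ S) (hK : S ⊆ K) {g : GL (Fin n) ℝ} (hg : g ∈ S) :
    g ∈ identityComponent K := by
  have h2 : Subtype.val '' ((Subtype.val : K → GL (Fin n) ℝ) ⁻¹' S) = S :=
    Subtype.image_preimage_coe _ _ |>.trans (Set.inter_eq_right.2 hK)
  have h3 : IsPreconnected ((Subtype.val : K → GL (Fin n) ℝ) ⁻¹' S) :=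
    Topology.IsInducing.subtypeVal.isPreconnected_image.1 (h2.symm ▸ hS)
  exact ⟨⟨g, hK hg⟩, h3.subset_connectedComponent (x := 1) h1 hg, rfl⟩

theorem continuous_expGL_smul (Y : Matrix (Fin n) (Fin n) ℝ) :
    Continuous fun t : ℝ => expGL (t • Y) := by
  refine Units.continuous_iff.2 ⟨?_, ?_⟩
  · exact continuous_matrix_exp.comp (continuous_id.smul continuous_const)
  · exact continuous_matrix_exp.comp (continuous_id.smul continuous_const).neg

/-- The Lie algebra of a maximal torus is its own centralizer in the Lie algebra of the compact
group. -/
theorem mem_lieAlg_of_isMaximalTorus {K B : Subgroup (GL (Fin n) ℝ)}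
    (hK : IsCompact (K : Set (GL (Fin n) ℝ))) (hB : IsMaximalTorus (identityComponent K) B)
    {Y : Matrix (Fin n) (Fin n) ℝ} (hYK : Y ∈ lieAlg K) (hY : ∀ X ∈ lieAlg B, ⁅X, Y⁆ = 0) :
    Y ∈ lieAlg B := by
  obtain ⟨⟨hBK, hBc, hBconn, hBcomm⟩, hmax⟩ := hB
  have hBcl := hBc.isClosed
  have hYB : ∀ b ∈ B, ∀ t : ℝ, b * expGL (t • Y) = expGL (t • Y) * b := by
    intro b hb t
    have h1 := commute_of_forall_lie_eq_zero hBcl hBconn hY hb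
    refine Units.ext ?_
    rw [Units.val_mul, Units.val_mul, expGL_val]
    refine (exp_mul_eq_mul_exp_of_lie_eq_zero ?_).symm
    rw [Ring.lie_def, smul_mul_assoc, mul_smul_comm, h1, sub_self]
  have hadd : ∀ s t : ℝ, expGL (s • Y) * expGL (t • Y) = expGL ((s + t) • Y) := by
    intro s t
    refine Units.ext ?_
    rw [Units.val_mul, expGL_val, expGL_val, expGL_val, add_smul,
      Matrix.exp_add_of_commute _ _ (((Commute.refl Y).smul_right t).smul_left s)]
  let D : Subgroup (GL (Fin n) ℝ) :=
    { carrier := {g | ∃ b ∈ B, ∃ t : ℝ, g = b * expGL (t • Y)}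
      mul_mem' := by
        rintro _ _ ⟨b, hb, t, rfl⟩ ⟨b', hb', t', rfl⟩
        refine ⟨b * b', B.mul_mem hb hb', t + t', ?_⟩
        rw [← hadd, mul_assoc, ← mul_assoc (expGL _), ← hYB b' hb' t]
        simp only [mul_assoc]
      one_mem' := ⟨1, B.one_mem, 0, by rw [zero_smul, expGL_zero, mul_one]⟩
      inv_mem' := by
        rintro _ ⟨b, hb, t, rfl⟩
        refine ⟨b⁻¹, B.inv_mem hb, -t, ?_⟩
        rw [mul_inv_rev, hYB _ (B.inv_mem hb), expGL_inv, neg_smul] }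
  have hBD : B ≤ D := fun b hb => ⟨b, hb, 0, by rw [zero_smul, expGL_zero, mul_one]⟩
  have hYD : ∀ t : ℝ, expGL (t • Y) ∈ D := fun t => ⟨1, B.one_mem, t, by rw [one_mul]⟩
  have hDK : D ≤ K := by
    rintro _ ⟨b, hb, t, rfl⟩
    exact K.mul_mem (identityComponent_le K (hBK hb)) (expGL_smul_mem hK.isClosed hYK t)
  have hDconn : IsConnected (D : Set (GL (Fin n) ℝ)) := by
    have h1 : (D : Set (GL (Fin n) ℝ)) = (fun p : GL (Fin n) ℝ × ℝ => p.1 * expGL (p.2 • Y)) ''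
        ((B : Set (GL (Fin n) ℝ)) ×ˢ Set.univ) := by
      ext g
      constructor
      · rintro ⟨b, hb, t, rfl⟩
        exact ⟨(b, t), ⟨hb, trivial⟩, rfl⟩
      · rintro ⟨⟨b, t⟩, ⟨hb, -⟩, rfl⟩
        exact ⟨b, hb, t, rfl⟩
    rw [h1]
    refine (hBconn.prod isConnected_univ).image _ (Continuous.continuousOn ?_)
    exact continuous_fst.mul ((continuous_expGL_smul Y).comp continuous_snd)
  have hDcomm : ∀ x y : D, x * y = y * x := by
    rintro ⟨_, b, hb, t, rfl⟩ ⟨_, b', hb', t', rfl⟩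
    refine Subtype.ext ?_
    change b * expGL (t • Y) * (b' * expGL (t' • Y)) = b' * expGL (t' • Y) * (b * expGL (t • Y))
    calc b * expGL (t • Y) * (b' * expGL (t' • Y))
        = b * (expGL (t • Y) * b') * expGL (t' • Y) := by simp only [mul_assoc]
      _ = (b * b') * (expGL (t • Y) * expGL (t' • Y)) := by
          rw [← hYB b' hb' t]; simp only [mul_assoc]
      _ = (b' * b) * (expGL (t' • Y) * expGL (t • Y)) := by
          rw [hBcomm b hb b' hb', hadd, hadd, add_comm]
      _ = b' * (b * expGL (t' • Y)) * expGL (t • Y) := by simp only [mul_assoc]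
      _ = _ := by rw [hYB b hb t']; simp only [mul_assoc]
  have hcK : D.topologicalClosure ≤ K := D.topologicalClosure_minimal hDK hK.isClosed
  have hcconn : IsConnected (D.topologicalClosure : Set (GL (Fin n) ℝ)) := by
    rw [Subgroup.topologicalClosure_coe]
    exact hDconn.closure
  have hle : D.topologicalClosure ≤ B := by
    refine hmax ⟨?_, ?_, hcconn, ?_⟩ (hBD.trans D.le_topologicalClosure)
    · exact fun g hg => subset_identityComponent hcconn.isPreconnected (one_mem _) hcK hg
    · exact hK.of_isClosed_subset D.isClosed_topologicalClosure hcK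
    · intro g hg h hh
      let _ := D.commGroupTopologicalClosure hDcomm
      exact congrArg Subtype.val
        (mul_comm (⟨g, hg⟩ : D.topologicalClosure) ⟨h, hh⟩)
  exact mem_lieAlg_of_expGL_mem hBcl fun t => hle (D.le_topologicalClosure (hYD t))

end ClosedSubgroup

end RealReductive

namespace RealReductive

/-! ### Simultaneous eigenspaces -/

section JointEigen

variable {ι V : Type*} [AddCommGroup V] [Module ℂ V] [FiniteDimensional ℂ V]

/-- Commuting endomorphisms without Jordan blocks can be diagonalized simultaneously. -/
theorem span_joint_eigenvectors_eq_top (f : ι → Module.End ℂ V)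
    (hc : ∀ i j v, f i (f j v) = f j (f i v))
    (hs : ∀ i (μ : ℂ) v, f i (f i v - μ • v) = μ • (f i v - μ • v) → f i v = μ • v) :
    Submodule.span ℂ {v | ∃ χ : ι → ℂ, ∀ i, f i v = χ i • v} = ⊤ := by
  rw [eq_top_iff, ← Module.End.iSup_iInf_maxGenEigenspace_eq_top_of_iSup_maxGenEigenspace_eq_top_of_commute f
    (fun i j _ => LinearMap.ext (hc i j)) fun i => Module.End.iSup_maxGenEigenspace_eq_top _]
  refine iSup_le fun χ v hv => Submodule.subset_span ⟨χ, fun i => ?_⟩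
  obtain ⟨k, hk⟩ := (Module.End.mem_maxGenEigenspace _ _ _).1 ((Submodule.mem_iInf _).1 hv i)
  have key : ∀ w, ((f i - χ i • (1 : Module.End ℂ V)) ^ k) w = 0 → f i w = χ i • w := by
    clear hk
    induction k with
    | zero =>
      intro w hw
      have : w = 0 := by simpa using hw
      simp [this]
    | succ k ih =>
      intro w hw
      rw [pow_succ, Module.End.mul_apply] at hw
      have h1 := ih _ hw
      simp only [LinearMap.sub_apply, LinearMap.smul_apply, Module.End.one_apply] at h1
      exact hs i (χ i) w h1
  exact key v hk

theorem finite_joint_eigenvalues (f : ι → Module.End ℂ V)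
    (hc : ∀ i j v, f i (f j v) = f j (f i v)) :
    {χ : ι → ℂ | ∃ v, v ≠ 0 ∧ ∀ i, f i v = χ i • v}.Finite := by
  have h1 := Module.End.independent_iInf_maxGenEigenspace_of_forall_mapsTo f fun i j φ =>
    Module.End.mapsTo_maxGenEigenspace_of_comm (LinearMap.ext (hc j i)) φ
  refine (WellFoundedGT.finite_ne_bot_of_iSupIndep h1).subset ?_
  rintro χ ⟨v, hv0, hv⟩ hbot
  refine hv0 ((Submodule.mem_bot ℂ).1 (hbot ▸ (Submodule.mem_iInf _).2 fun i => ?_))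
  rw [Module.End.mem_maxGenEigenspace]
  exact ⟨1, by simp [hv i]⟩

end JointEigen

/-! ### The Cartan involution and the invariant form -/

section Cartan

open Filter Topology

attribute [local instance] LieRing.ofAssociativeRing

variable {n : ℕ}

/-- A Cartan involution of the real matrix Lie algebra `g` with fixed points `k`, together with an
invariant form, both extended (arbitrarily) to linear maps on the space of all matrices. -/
structure CartanForm (g k : LieSubalgebra ℝ (Matrix (Fin n) (Fin n) ℝ)) where
  theta : Matrix (Fin n) (Fin n) ℝ →ₗ[ℝ] Matrix (Fin n) (Fin n) ℝ
  form : LinearMap.BilinForm ℝ (Matrix (Fin n) (Fin n) ℝ)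
  theta_mem : ∀ X ∈ g, theta X ∈ g
  theta_theta : ∀ X ∈ g, theta (theta X) = X
  theta_lie : ∀ X ∈ g, ∀ Y ∈ g, theta ⁅X, Y⁆ = ⁅theta X, theta Y⁆
  le : k ≤ g
  fixed_iff : ∀ X ∈ g, theta X = X ↔ X ∈ k
  symm : ∀ X ∈ g, ∀ Y ∈ g, form X Y = form Y X
  invariant : ∀ X ∈ g, ∀ Y ∈ g, ∀ Z ∈ g, form ⁅X, Y⁆ Z = form X ⁅Y, Z⁆
  form_theta : ∀ X ∈ g, ∀ Y ∈ g, form (theta X) (theta Y) = form X Y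
  neg : ∀ X ∈ g, X ≠ 0 → form X (theta X) < 0

/-- A Cartan involution in the sense of `IsCartanInvolution` extends to a `CartanForm`. -/
theorem IsCartanInvolution.exists_cartanForm {G : Subgroup (GL (Fin n) ℂ)}
    {K : Subgroup (GL (Fin n) ℝ)} {θ : gReal G →ₗ⁅ℝ⁆ gReal G} (hθ : IsCartanInvolution G K θ)
    (hle : lieAlg K ≤ gReal G) :
    ∃ C : CartanForm (gReal G) (lieAlg K), ∀ X : gReal G, C.theta X = θ X := by
  obtain ⟨β, hs, hi, hθβ, hneg⟩ := hθ.exists_form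
  obtain ⟨P, hP⟩ := LinearMap.exists_leftInverse_of_injective
    (gReal G).toSubmodule.subtype (Submodule.ker_subtype _)
  have hP' : ∀ X (hX : X ∈ gReal G), P X = (⟨X, hX⟩ : gReal G) :=
    fun X hX => DFunLike.congr_fun hP (⟨X, hX⟩ : gReal G)
  let t : Matrix (Fin n) (Fin n) ℝ →ₗ[ℝ] Matrix (Fin n) (Fin n) ℝ :=
    (gReal G).toSubmodule.subtype ∘ₗ (θ : gReal G →ₗ[ℝ] gReal G) ∘ₗ P
  let B : LinearMap.BilinForm ℝ (Matrix (Fin n) (Fin n) ℝ) :=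
    LinearMap.compl₁₂ β P P
  have ht : ∀ X (hX : X ∈ gReal G), t X = θ ⟨X, hX⟩ := fun X hX => by
    change ((θ (P X) : gReal G) : Matrix (Fin n) (Fin n) ℝ) = _
    rw [hP' X hX]
  have hB : ∀ X (hX : X ∈ gReal G) Y (hY : Y ∈ gReal G), B X Y = β ⟨X, hX⟩ ⟨Y, hY⟩ :=
    fun X hX Y hY => by
      change β (P X) (P Y) = _
      rw [hP' X hX, hP' Y hY]
  have htm : ∀ X ∈ gReal G, t X ∈ gReal G := fun X hX => by rw [ht X hX]; exact (θ _).2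
  have hte : ∀ X (hX : X ∈ gReal G), (⟨t X, htm X hX⟩ : gReal G) = θ ⟨X, hX⟩ :=
    fun X hX => Subtype.ext (ht X hX)
  refine ⟨⟨t, B, htm, ?_, ?_, hle, ?_, ?_, ?_, ?_, ?_⟩, fun X => ht X X.2⟩
  · intro X hX
    rw [ht _ (htm X hX), hte X hX, hθ.involutive]
  · intro X hX Y hY
    rw [ht _ ((gReal G).lie_mem hX hY), ht X hX, ht Y hY]
    exact congrArg Subtype.val (θ.map_lie ⟨X, hX⟩ ⟨Y, hY⟩)
  · intro X hX
    rw [← hθ.fixed_iff ⟨X, hX⟩, ht X hX, Subtype.ext_iff]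
  · intro X hX Y hY
    rw [hB X hX Y hY, hB Y hY X hX, hs]
  · intro X hX Y hY Z hZ
    rw [hB _ ((gReal G).lie_mem hX hY) _ hZ, hB _ hX _ ((gReal G).lie_mem hY hZ)]
    exact hi ⟨X, hX⟩ ⟨Y, hY⟩ ⟨Z, hZ⟩
  · intro X hX Y hY
    rw [hB _ (htm X hX) _ (htm Y hY), hB X hX Y hY, hte X hX, hte Y hY, hθβ]
  · intro X hX hX0
    rw [hB X hX _ (htm X hX), hte X hX]
    exact hneg _ fun h => hX0 (congrArg Subtype.val h)

namespace CartanForm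

variable {g k : LieSubalgebra ℝ (Matrix (Fin n) (Fin n) ℝ)} (C : CartanForm g k)

theorem half_add_theta_mem {X : Matrix (Fin n) (Fin n) ℝ} (hX : X ∈ g) : X + C.theta X ∈ k := by
  rw [← C.fixed_iff _ (add_mem hX (C.theta_mem X hX)), map_add, C.theta_theta X hX, add_comm]

theorem theta_of_mem {X : Matrix (Fin n) (Fin n) ℝ} (hX : X ∈ k) : C.theta X = X :=
  (C.fixed_iff X (C.le hX)).2 hX

theorem theta_sub_theta {X : Matrix (Fin n) (Fin n) ℝ} (hX : X ∈ g) :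
    C.theta (X - C.theta X) = -(X - C.theta X) := by
  rw [map_sub, C.theta_theta X hX, neg_sub]

theorem form_pos {X : Matrix (Fin n) (Fin n) ℝ} (hX : X ∈ g) (hθ : C.theta X = -X)
    (h0 : X ≠ 0) : 0 < C.form X X := by
  have := C.neg X hX h0
  rw [hθ, map_neg] at this
  linarith

theorem form_neg {X : Matrix (Fin n) (Fin n) ℝ} (hX : X ∈ k) (h0 : X ≠ 0) : C.form X X < 0 := by
  have := C.neg X (C.le hX) h0
  rwa [C.theta_of_mem hX] at this

theorem theta_lie_of_mem {X Y : Matrix (Fin n) (Fin n) ℝ} (hX : X ∈ k) (hY : Y ∈ g) :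
    C.theta ⁅X, Y⁆ = ⁅X, C.theta Y⁆ := by
  rw [C.theta_lie X (C.le hX) Y hY, C.theta_of_mem hX]

theorem form_lie_theta {X Z Y : Matrix (Fin n) (Fin n) ℝ} (hY : Y ∈ k) (hX : X ∈ g)
    (hZ : Z ∈ g) : C.form ⁅Y, X⁆ (C.theta Z) = -C.form X (C.theta ⁅Y, Z⁆) := by
  rw [C.theta_lie_of_mem hY hZ, ← lie_skew, map_neg, LinearMap.neg_apply,
    C.invariant X hX Y (C.le hY) _ (C.theta_mem Z hZ)]

theorem form_theta_comm {X Z : Matrix (Fin n) (Fin n) ℝ} (hX : X ∈ g) (hZ : Z ∈ g) :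
    C.form X (C.theta Z) = C.form Z (C.theta X) := by
  rw [C.symm X hX _ (C.theta_mem Z hZ), ← C.form_theta _ (C.theta_mem Z hZ) X hX,
    C.theta_theta Z hZ]

/-- The real part of the Hermitian form on the complexification that extends
`-β(X, θ Y)`. -/
noncomputable def hermRe (X Z : Matrix (Fin n) (Fin n) ℂ) : ℝ :=
  -C.form (reM X) (C.theta (reM Z)) - C.form (imM X) (C.theta (imM Z))

theorem hermRe_pos {X : Matrix (Fin n) (Fin n) ℂ} (hX : X ∈ complexify g.toSubmodule)
    (h0 : X ≠ 0) : 0 < C.hermRe X X := by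
  rw [mem_complexify_iff] at hX
  have h1 : ∀ A ∈ g, C.form A (C.theta A) ≤ 0 := by
    intro A hA
    by_cases hA0 : A = 0
    · simp [hA0]
    · exact (C.neg A hA hA0).le
  have h2 : reM X ≠ 0 ∨ imM X ≠ 0 := by
    by_contra! h
    exact h0 (matrix_ext_re_im (by rw [h.1, map_zero]) (by rw [h.2, map_zero]))
  unfold hermRe
  rcases h2 with h | h
  · linarith [C.neg _ hX.1 h, h1 _ hX.2]
  · linarith [C.neg _ hX.2 h, h1 _ hX.1]

theorem hermRe_sub (X X' Z : Matrix (Fin n) (Fin n) ℂ) :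
    C.hermRe (X - X') Z = C.hermRe X Z - C.hermRe X' Z := by
  simp only [hermRe, map_sub, LinearMap.sub_apply]; ring

theorem hermRe_lie {Y : Matrix (Fin n) (Fin n) ℝ} (hY : Y ∈ k) {X Z : Matrix (Fin n) (Fin n) ℂ}
    (hX : X ∈ complexify g.toSubmodule) (hZ : Z ∈ complexify g.toSubmodule) :
    C.hermRe ⁅toComplex Y, X⁆ Z = -C.hermRe X ⁅toComplex Y, Z⁆ := by
  rw [mem_complexify_iff] at hX hZ
  simp only [hermRe, reM_lie_toComplex, imM_lie_toComplex]
  rw [C.form_lie_theta hY hX.1 hZ.1, C.form_lie_theta hY hX.2 hZ.2]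
  ring

theorem hermRe_smul_I (τ : ℝ) (X Z : Matrix (Fin n) (Fin n) ℂ) :
    C.hermRe ((τ * Complex.I) • X) Z = -C.hermRe X ((τ * Complex.I) • Z) := by
  simp only [hermRe, reM_smul, imM_smul, map_sub, map_add, map_smul, LinearMap.sub_apply,
    LinearMap.add_apply, LinearMap.smul_apply, smul_eq_mul]
  simp

theorem hermRe_smul_ofReal (s : ℝ) (X Z : Matrix (Fin n) (Fin n) ℂ) :
    C.hermRe ((s : ℂ) • X) Z = s * C.hermRe X Z := by
  simp [hermRe]
  ring

theorem hermRe_comm {X Z : Matrix (Fin n) (Fin n) ℂ} (hX : X ∈ complexify g.toSubmodule)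
    (hZ : Z ∈ complexify g.toSubmodule) : C.hermRe X Z = C.hermRe Z X := by
  rw [mem_complexify_iff] at hX hZ
  rw [hermRe, hermRe, C.form_theta_comm hX.1 hZ.1, C.form_theta_comm hX.2 hZ.2]

theorem lie_toComplex_mem (C : CartanForm g k) {Y : Matrix (Fin n) (Fin n) ℝ} (hY : Y ∈ k)
    {X : Matrix (Fin n) (Fin n) ℂ} (hX : X ∈ complexify g.toSubmodule) :
    ⁅toComplex Y, X⁆ ∈ complexify g.toSubmodule :=
  lie_mem_complexify (V := g.toSubmodule) (fun _ h1 _ h2 => g.lie_mem h1 h2)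
    (toComplex_mem_complexify (C.le hY)) hX

/-- Elements of `k` act on the complexification of `g` with imaginary eigenvalues. -/
theorem re_eq_zero_of_lie_eq_smul (C : CartanForm g k) {Y : Matrix (Fin n) (Fin n) ℝ} (hY : Y ∈ k)
    {X : Matrix (Fin n) (Fin n) ℂ} (hX : X ∈ complexify g.toSubmodule) (h0 : X ≠ 0) {μ : ℂ}
    (h : ⁅toComplex Y, X⁆ = μ • X) : μ.re = 0 := by
  have h1 := C.hermRe_lie hY hX hX
  rw [C.hermRe_comm hX (C.lie_toComplex_mem hY hX)] at h1
  have h2 : C.hermRe ⁅toComplex Y, X⁆ X = 0 := by linarith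
  have h3 := C.hermRe_smul_I μ.im X X
  rw [C.hermRe_comm hX (Submodule.smul_mem _ _ hX)] at h3
  have h4 : C.hermRe ((μ.im * Complex.I) • X) X = 0 := by linarith
  have h5 : (μ.re : ℂ) • X = μ • X - (μ.im * Complex.I) • X := by
    rw [← sub_smul]
    congr 1
    apply Complex.ext <;> simp
  have h6 := C.hermRe_smul_ofReal μ.re X X
  rw [h5, C.hermRe_sub, ← h, h2, h4, sub_zero] at h6
  exact (mul_eq_zero.1 h6.symm).resolve_right (C.hermRe_pos hX h0).ne'

/-- Elements of `k` act on the complexification of `g` without Jordan blocks. -/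
theorem lie_eq_smul_of_sq (C : CartanForm g k) {Y : Matrix (Fin n) (Fin n) ℝ} (hY : Y ∈ k)
    {X : Matrix (Fin n) (Fin n) ℂ} (hX : X ∈ complexify g.toSubmodule) {μ : ℂ}
    (h : ⁅toComplex Y, ⁅toComplex Y, X⁆ - μ • X⁆ = μ • (⁅toComplex Y, X⁆ - μ • X)) :
    ⁅toComplex Y, X⁆ = μ • X := by
  by_contra hne
  set Z := ⁅toComplex Y, X⁆ - μ • X with hZ
  have hZ0 : Z ≠ 0 := fun h0 => hne (sub_eq_zero.1 h0)
  have hZm : Z ∈ complexify g.toSubmodule :=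
    sub_mem (C.lie_toComplex_mem hY hX) (Submodule.smul_mem _ _ hX)
  have hre := C.re_eq_zero_of_lie_eq_smul hY hZm hZ0 h
  have hμ : μ = μ.im * Complex.I := by
    apply Complex.ext <;> simp [hre]
  have h1 : C.hermRe Z Z = 0 := by
    conv_lhs => rw [hZ]
    rw [C.hermRe_sub, C.hermRe_lie hY hX hZm, h, hμ, C.hermRe_smul_I, ← hμ]
    ring
  exact (C.hermRe_pos hZm hZ0).ne' h1

end CartanForm

/-- `c` is a weight of the space `b` of real matrices on the complexification of `g`: the
elements `Y` of `b` have a common eigenvector in it, with eigenvalues `i c(Y)`. -/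
def IsWeight (g b : Submodule ℝ (Matrix (Fin n) (Fin n) ℝ)) (c : Module.Dual ℝ b) : Prop :=
  ∃ X ∈ complexify g, X ≠ 0 ∧
    ∀ Y : b, ⁅toComplex (Y : Matrix (Fin n) (Fin n) ℝ), X⁆ = (Complex.I * c Y) • X

section Weights

variable {g k : LieSubalgebra ℝ (Matrix (Fin n) (Fin n) ℝ)}
  {b : Submodule ℝ (Matrix (Fin n) (Fin n) ℝ)}

theorem lie_lie_toComplex_comm {Y Z : Matrix (Fin n) (Fin n) ℝ} (h : ⁅Y, Z⁆ = 0)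
    (X : Matrix (Fin n) (Fin n) ℂ) :
    ⁅toComplex Y, ⁅toComplex Z, X⁆⁆ = ⁅toComplex Z, ⁅toComplex Y, X⁆⁆ := by
  rw [leibniz_lie, ← toComplex_lie, h, toComplex_zero, zero_lie, zero_add]

/-- A joint eigenvector of `b` has a real-linear eigenvalue function, up to the factor `i`. -/
theorem exists_dual_of_joint_eigenvector (C : CartanForm g k) (hbk : ∀ Y ∈ b, Y ∈ k)
    {X : Matrix (Fin n) (Fin n) ℂ} (hX : X ∈ complexify g.toSubmodule) {χ : b → ℂ}
    (h : ∀ Y : b, ⁅toComplex (Y : Matrix (Fin n) (Fin n) ℝ), X⁆ = χ Y • X) :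
    ∃ c : Module.Dual ℝ b, ∀ Y : b,
      ⁅toComplex (Y : Matrix (Fin n) (Fin n) ℝ), X⁆ = (Complex.I * c Y) • X := by
  by_cases h0 : X = 0
  · exact ⟨0, fun Y => by simp [h0]⟩
  have hre : ∀ Y : b, (χ Y).re = 0 := fun Y =>
    C.re_eq_zero_of_lie_eq_smul (hbk Y Y.2) hX h0 (h Y)
  have hinj : ∀ a a' : ℂ, a • X = a' • X → a = a' := fun a a' e => smul_left_injective ℂ h0 e
  refine ⟨{ toFun := fun Y => (χ Y).im, map_add' := fun Y Z => ?_, map_smul' := fun a Y => ?_ },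
    fun Y => ?_⟩
  · rw [← Complex.add_im]
    congr 1
    refine hinj _ _ ?_
    rw [← h, Submodule.coe_add, toComplex_add, add_lie, h, h, add_smul]
  · have : χ (a • Y) = a * χ Y := by
      refine hinj _ _ ?_
      rw [← h, Submodule.coe_smul, toComplex_smul, mul_smul, ← h, Ring.lie_def, Ring.lie_def,
        smul_mul_assoc, mul_smul_comm, smul_sub]
    simp [this]
  · rw [h]
    congr 1
    apply Complex.ext <;> simp [hre]

/-- A subspace of the complexification of `g` that is stable under an abelian subalgebra `b` of
`k` is spanned by weight vectors. -/
theorem mem_span_weight_vectors (C : CartanForm g k) (hbk : ∀ Y ∈ b, Y ∈ k)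
    (hbb : ∀ Y ∈ b, ∀ Z ∈ b, ⁅Y, Z⁆ = 0)
    {W : Submodule ℂ (Matrix (Fin n) (Fin n) ℂ)} (hW : W ≤ complexify g.toSubmodule)
    (hst : ∀ Y ∈ b, ∀ X ∈ W, ⁅toComplex Y, X⁆ ∈ W) {X : Matrix (Fin n) (Fin n) ℂ} (hX : X ∈ W) :
    X ∈ Submodule.span ℂ {Z | Z ∈ W ∧ ∃ c : Module.Dual ℝ b, ∀ Y : b,
      ⁅toComplex (Y : Matrix (Fin n) (Fin n) ℝ), Z⁆ = (Complex.I * c Y) • Z} := by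
  let f : b → Module.End ℂ W := fun Y =>
    (LieAlgebra.ad ℂ (Matrix (Fin n) (Fin n) ℂ) (toComplex (Y : Matrix (Fin n) (Fin n) ℝ))).restrict
      (hst Y Y.2)
  have hf : ∀ Y v, ((f Y v : W) : Matrix (Fin n) (Fin n) ℂ) =
    ⁅toComplex (Y : Matrix (Fin n) (Fin n) ℝ), (v : Matrix (Fin n) (Fin n) ℂ)⁆ := fun _ _ => rfl
  have h := span_joint_eigenvectors_eq_top f
    (fun Y Z v => Subtype.ext (by
      rw [hf, hf, hf, hf]
      exact lie_lie_toComplex_comm (hbb Y Y.2 Z Z.2) _))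
    (fun Y μ v hv => Subtype.ext (by
      refine C.lie_eq_smul_of_sq (hbk Y Y.2) (hW v.2) (μ := μ) ?_
      have := congrArg Subtype.val hv
      rwa [hf] at this))
  have hXt : (⟨X, hX⟩ : W) ∈ (⊤ : Submodule ℂ W) := trivial
  rw [← h] at hXt
  have h2 := Submodule.mem_map_of_mem (f := W.subtype) hXt
  rw [Submodule.map_span] at h2
  refine Submodule.span_mono ?_ h2
  rintro _ ⟨v, ⟨χ, hχ⟩, rfl⟩
  exact ⟨v.2, exists_dual_of_joint_eigenvector C hbk (hW v.2) (χ := χ)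
    fun Y => (hf Y v).symm.trans (congrArg Subtype.val (hχ Y))⟩

theorem finite_weights (C : CartanForm g k) (hbk : ∀ Y ∈ b, Y ∈ k)
    (hbb : ∀ Y ∈ b, ∀ Z ∈ b, ⁅Y, Z⁆ = 0) :
    {c : Module.Dual ℝ b | IsWeight g.toSubmodule b c}.Finite := by
  let f : b → Module.End ℂ (complexify g.toSubmodule) := fun Y =>
    (LieAlgebra.ad ℂ (Matrix (Fin n) (Fin n) ℂ) (toComplex (Y : Matrix (Fin n) (Fin n) ℝ))).restrict
      (fun X hX => C.lie_toComplex_mem (hbk Y Y.2) hX)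
  have hf : ∀ Y v, ((f Y v : complexify g.toSubmodule) : Matrix (Fin n) (Fin n) ℂ) =
    ⁅toComplex (Y : Matrix (Fin n) (Fin n) ℝ), (v : Matrix (Fin n) (Fin n) ℂ)⁆ := fun _ _ => rfl
  have h := finite_joint_eigenvalues f (fun Y Z v => Subtype.ext (by
      rw [hf, hf, hf, hf]
      exact lie_lie_toComplex_comm (hbb Y Y.2 Z Z.2) _))
  refine Set.Finite.of_finite_image (f := fun c Y => Complex.I * (c Y : ℂ)) (h.subset ?_) ?_
  · rintro _ ⟨c, ⟨X, hX, h0, hc⟩, rfl⟩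
    exact ⟨⟨X, hX⟩, fun e => h0 (congrArg Subtype.val e), fun Y => Subtype.ext (hc Y)⟩
  · intro c _ c' _ e
    ext Y
    have := congrFun e Y
    simpa using this

end Weights

end Cartan

end RealReductive

namespace RealReductive

/-! ### Parabolic subalgebras attached to generic elements -/

section Generic

open Filter Topology

attribute [local instance] LieRing.ofAssociativeRing

variable {n : ℕ}

/-- `b` is an abelian subalgebra of `k` that is its own centralizer in `k`. -/
structure IsTorusAlgebra (k : LieSubalgebra ℝ (Matrix (Fin n) (Fin n) ℝ))
    (b : Submodule ℝ (Matrix (Fin n) (Fin n) ℝ)) : Prop where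
  le : ∀ Y ∈ b, Y ∈ k
  abelian : ∀ Y ∈ b, ∀ Z ∈ b, ⁅Y, Z⁆ = 0
  mem_of_centralizes : ∀ Y ∈ k, (∀ X ∈ b, ⁅X, Y⁆ = 0) → Y ∈ b

/-- No nonzero weight of `b` on the complexification of `g` vanishes at `Y`. -/
def IsGeneric (g b : Submodule ℝ (Matrix (Fin n) (Fin n) ℝ)) (Y : b) : Prop :=
  ∀ c, IsWeight g b c → c ≠ 0 → c Y ≠ 0

/-- The sum of the eigenspaces of `ad x` with non-negative eigenvalue on the complexification
of `g`. -/
noncomputable def qOf (g : Submodule ℝ (Matrix (Fin n) (Fin n) ℝ))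
    (x : Matrix (Fin n) (Fin n) ℂ) : Submodule ℂ (Matrix (Fin n) (Fin n) ℂ) :=
  ⨆ (c : ℝ) (_ : 0 ≤ c), Module.End.eigenspace
    (LieAlgebra.ad ℂ (Matrix (Fin n) (Fin n) ℂ) x) (c : ℂ) ⊓ complexify g

theorem mem_eigenspace_ad {x X : Matrix (Fin n) (Fin n) ℂ} {c : ℂ} :
    X ∈ Module.End.eigenspace (LieAlgebra.ad ℂ (Matrix (Fin n) (Fin n) ℂ) x) c ↔
      ⁅x, X⁆ = c • X := Module.End.mem_eigenspace_iff

theorem mem_qOf {g : Submodule ℝ (Matrix (Fin n) (Fin n) ℝ)} {x X : Matrix (Fin n) (Fin n) ℂ}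
    {c : ℝ} (hc : 0 ≤ c) (h : ⁅x, X⁆ = (c : ℂ) • X) (hX : X ∈ complexify g) : X ∈ qOf g x :=
  (le_iSup₂_of_le c hc le_rfl : _ ≤ qOf g x) ⟨mem_eigenspace_ad.2 h, hX⟩

theorem map_Ad_qOf_le {g : Submodule ℝ (Matrix (Fin n) (Fin n) ℝ)} {a : GL (Fin n) ℂ}
    (ha : ∀ X ∈ complexify g, Ad a X ∈ complexify g) (x : Matrix (Fin n) (Fin n) ℂ) :
    (qOf g x).map (Ad a) ≤ qOf g (Ad a x) := by
  rw [qOf, Submodule.map_iSup]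
  refine iSup_le fun c => ?_
  rw [Submodule.map_iSup]
  refine iSup_le fun hc => ?_
  rintro _ ⟨X, ⟨h1, h2⟩, rfl⟩
  rw [SetLike.mem_coe, mem_eigenspace_ad] at h1
  exact mem_qOf hc (by rw [← Ad_lie, h1, map_smul]) (ha X h2)

theorem map_Ad_qOf {g : Submodule ℝ (Matrix (Fin n) (Fin n) ℝ)} {a : GL (Fin n) ℂ}
    (ha : ∀ X ∈ complexify g, Ad a X ∈ complexify g)
    (ha' : ∀ X ∈ complexify g, Ad a⁻¹ X ∈ complexify g) (x : Matrix (Fin n) (Fin n) ℂ) :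
    (qOf g x).map (Ad a) = qOf g (Ad a x) := by
  refine le_antisymm (map_Ad_qOf_le ha x) fun X hX => ?_
  have h1 := map_Ad_qOf_le ha' (Ad a x) (Submodule.mem_map_of_mem hX)
  rw [Ad_inv_Ad] at h1
  exact ⟨_, h1, Ad_Ad_inv a X⟩

theorem smul_lie_matrix (c : ℂ) (X Y : Matrix (Fin n) (Fin n) ℂ) : ⁅c • X, Y⁆ = c • ⁅X, Y⁆ := by
  rw [Ring.lie_def, Ring.lie_def, smul_mul_assoc, mul_smul_comm, smul_sub]

theorem lie_smul_matrix (c : ℂ) (X Y : Matrix (Fin n) (Fin n) ℂ) : ⁅X, c • Y⁆ = c • ⁅X, Y⁆ := by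
  rw [Ring.lie_def, Ring.lie_def, smul_mul_assoc, mul_smul_comm, smul_sub]

variable {g k : LieSubalgebra ℝ (Matrix (Fin n) (Fin n) ℝ)}
  {b : Submodule ℝ (Matrix (Fin n) (Fin n) ℝ)}

/-- A generic element has the same centralizer as the whole torus. -/
theorem IsGeneric.lie_eq_zero (C : CartanForm g k) (hb : IsTorusAlgebra k b) {Y : b}
    (hY : IsGeneric g.toSubmodule b Y) {X : Matrix (Fin n) (Fin n) ℂ}
    (hX : X ∈ complexify g.toSubmodule)
    (h : ⁅toComplex (Y : Matrix (Fin n) (Fin n) ℝ), X⁆ = 0) (Z : b) :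
    ⁅toComplex (Z : Matrix (Fin n) (Fin n) ℝ), X⁆ = 0 := by
  set W : Submodule ℂ (Matrix (Fin n) (Fin n) ℂ) := Module.End.eigenspace
    (LieAlgebra.ad ℂ (Matrix (Fin n) (Fin n) ℂ) (toComplex (Y : Matrix (Fin n) (Fin n) ℝ))) 0 ⊓
      complexify g.toSubmodule with hW
  have hXW : X ∈ W := ⟨mem_eigenspace_ad.2 (by rw [h, zero_smul]), hX⟩
  have hst : ∀ Z ∈ b, ∀ X ∈ W, ⁅toComplex Z, X⁆ ∈ W := by
    rintro Z hZ X ⟨h1, h2⟩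
    refine ⟨mem_eigenspace_ad.2 ?_, C.lie_toComplex_mem (hb.le Z hZ) h2⟩
    rw [SetLike.mem_coe, mem_eigenspace_ad] at h1
    rw [lie_lie_toComplex_comm (hb.abelian _ Y.2 _ hZ), h1, zero_smul, lie_zero, zero_smul]
  have h1 := mem_span_weight_vectors C hb.le hb.abelian inf_le_right hst hXW
  refine (Submodule.span_le.2 ?_ h1 : X ∈ LinearMap.ker
    (LieAlgebra.ad ℂ (Matrix (Fin n) (Fin n) ℂ) (toComplex (Z : Matrix (Fin n) (Fin n) ℝ))))
  rintro X ⟨⟨hx1, hx2⟩, c, hc⟩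
  rw [SetLike.mem_coe, mem_eigenspace_ad, zero_smul, hc] at hx1
  rw [SetLike.mem_coe, LinearMap.mem_ker, LieAlgebra.ad_apply]
  by_cases h0 : X = 0
  · rw [h0, lie_zero]
  have hcY : c Y = 0 := by
    have := (smul_eq_zero.1 hx1).resolve_right h0
    simpa using this
  have hc0 : c = 0 := by
    by_contra hne
    exact hY c ⟨X, hx2, h0, hc⟩ hne hcY
  rw [hc, hc0]
  simp

/-- The parabolic subalgebra of an element of the torus depends only on the signs of the weights
at this element. -/
theorem qOf_le_qOf (C : CartanForm g k) (hb : IsTorusAlgebra k b) {Y Y' : b}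
    (h : ∀ c, IsWeight g.toSubmodule b c → c ≠ 0 → c Y ≤ 0 → c Y' ≤ 0) :
    qOf g.toSubmodule (Complex.I • toComplex (Y : Matrix (Fin n) (Fin n) ℝ)) ≤
      qOf g.toSubmodule (Complex.I • toComplex (Y' : Matrix (Fin n) (Fin n) ℝ)) := by
  refine iSup₂_le fun d hd X hX => ?_
  have hst : ∀ Z ∈ b, ∀ X ∈ Module.End.eigenspace (LieAlgebra.ad ℂ (Matrix (Fin n) (Fin n) ℂ)
      (Complex.I • toComplex (Y : Matrix (Fin n) (Fin n) ℝ))) (d : ℂ) ⊓ complexify g.toSubmodule,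
      ⁅toComplex Z, X⁆ ∈ Module.End.eigenspace (LieAlgebra.ad ℂ (Matrix (Fin n) (Fin n) ℂ)
      (Complex.I • toComplex (Y : Matrix (Fin n) (Fin n) ℝ))) (d : ℂ) ⊓
        complexify g.toSubmodule := by
    rintro Z hZ X ⟨h1, h2⟩
    refine ⟨mem_eigenspace_ad.2 ?_, C.lie_toComplex_mem (hb.le Z hZ) h2⟩
    rw [SetLike.mem_coe, mem_eigenspace_ad, smul_lie_matrix] at h1
    rw [smul_lie_matrix, lie_lie_toComplex_comm (hb.abelian _ Y.2 _ hZ), ← lie_smul_matrix, h1,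
      lie_smul_matrix]
  have h1 := mem_span_weight_vectors C hb.le hb.abelian inf_le_right hst hX
  refine Submodule.span_le.2 ?_ h1
  rintro Z ⟨⟨hz1, hz2⟩, c, hc⟩
  by_cases h0 : Z = 0
  · rw [h0]; exact Submodule.zero_mem _
  have hII : ∀ Y'' : b, ⁅Complex.I • toComplex (Y'' : Matrix (Fin n) (Fin n) ℝ), Z⁆ =
      ((-c Y'' : ℝ) : ℂ) • Z := by
    intro Y''
    rw [smul_lie_matrix, hc, smul_smul, ← mul_assoc, Complex.I_mul_I]
    congr 1
    push_cast
    ring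
  rw [SetLike.mem_coe, mem_eigenspace_ad, hII] at hz1
  have hcd : -c Y = d := by
    have := smul_left_injective ℂ h0 hz1
    exact_mod_cast this
  refine mem_qOf (c := -c Y') ?_ (hII Y') hz2
  by_cases hc0 : c = 0
  · simp [hc0]
  · linarith [h c ⟨Z, hz2, h0, hc⟩ hc0 (by linarith)]

/-- The parabolic subalgebra depends on the generic element only through the signs of the weights. -/
theorem qOf_eq_qOf (C : CartanForm g k) (hb : IsTorusAlgebra k b) {Y Y' : b}
    (h : ∀ c, IsWeight g.toSubmodule b c → c ≠ 0 → (c Y ≤ 0 ↔ c Y' ≤ 0)) :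
    qOf g.toSubmodule (Complex.I • toComplex (Y : Matrix (Fin n) (Fin n) ℝ)) =
      qOf g.toSubmodule (Complex.I • toComplex (Y' : Matrix (Fin n) (Fin n) ℝ)) :=
  le_antisymm (qOf_le_qOf C hb fun c hc h0 => (h c hc h0).1)
    (qOf_le_qOf C hb fun c hc h0 => (h c hc h0).2)

end Generic

/-! ### Conjugacy of maximal tori -/

section Conjugacy

open Filter Topology

attribute [local instance] LieRing.ofAssociativeRing

variable {n : ℕ}

/-- The adjoint action of a real matrix. -/
noncomputable def rAd (h : GL (Fin n) ℝ) :
    Matrix (Fin n) (Fin n) ℝ →ₗ[ℝ] Matrix (Fin n) (Fin n) ℝ :=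
  LinearMap.mulLeft ℝ h.val ∘ₗ LinearMap.mulRight ℝ h⁻¹.val

theorem rAd_apply (h : GL (Fin n) ℝ) (X : Matrix (Fin n) (Fin n) ℝ) :
    rAd h X = h.val * X * (h⁻¹).val := by
  simp [rAd, mul_assoc]

theorem toComplex_rAd (h : GL (Fin n) ℝ) (X : Matrix (Fin n) (Fin n) ℝ) :
    toComplex (rAd h X) = Ad (Matrix.GeneralLinearGroup.map (algebraMap ℝ ℂ) h) (toComplex X) := by
  rw [rAd_apply, Ad_apply, ← map_inv, map_val, map_val, toComplex_mul, toComplex_mul]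

theorem rAd_mul (h h' : GL (Fin n) ℝ) (X : Matrix (Fin n) (Fin n) ℝ) :
    rAd (h * h') X = rAd h (rAd h' X) := by
  simp only [rAd_apply, mul_inv_rev, Units.val_mul]; noncomm_ring

theorem rAd_one (X : Matrix (Fin n) (Fin n) ℝ) : rAd 1 X = X := by simp [rAd_apply]

@[simp] theorem rAd_inv_rAd (h : GL (Fin n) ℝ) (X : Matrix (Fin n) (Fin n) ℝ) :
    rAd h⁻¹ (rAd h X) = X := by rw [← rAd_mul, inv_mul_cancel, rAd_one]

@[simp] theorem rAd_rAd_inv (h : GL (Fin n) ℝ) (X : Matrix (Fin n) (Fin n) ℝ) :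
    rAd h (rAd h⁻¹ X) = X := by rw [← rAd_mul, mul_inv_cancel, rAd_one]

theorem rAd_lie (h : GL (Fin n) ℝ) (X Y : Matrix (Fin n) (Fin n) ℝ) :
    rAd h ⁅X, Y⁆ = ⁅rAd h X, rAd h Y⁆ := by
  apply toComplex_injective
  rw [toComplex_rAd, toComplex_lie, toComplex_lie, Ad_lie, toComplex_rAd, toComplex_rAd]

theorem rAd_mem_lieAlg {H : Subgroup (GL (Fin n) ℝ)} {h : GL (Fin n) ℝ} (hh : h ∈ H)
    {X : Matrix (Fin n) (Fin n) ℝ} (hX : X ∈ lieAlg H) : rAd h X ∈ lieAlg H := by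
  rw [rAd_apply]
  exact IsInfinitesimal.conj hX (H.le_topologicalClosure hh)

theorem continuous_rAd (X : Matrix (Fin n) (Fin n) ℝ) :
    Continuous fun h : GL (Fin n) ℝ => rAd h X := by
  simp only [rAd_apply]
  exact (Units.continuous_val.mul continuous_const).mul
    (Units.continuous_val.comp continuous_inv)

/-- A solution of the linear differential equation `u' = [Z, u]` is a conjugation orbit. -/
theorem eq_exp_conj_of_hasDerivAt {Z : Matrix (Fin n) (Fin n) ℝ}
    {u : ℝ → Matrix (Fin n) (Fin n) ℝ} (hu : ∀ t, HasDerivAt u ⁅Z, u t⁆ t) (t : ℝ) :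
    u t = rAd (expGL (t • Z)) (u 0) := by
  have h1 : ∀ t : ℝ, HasDerivAt
      (fun s : ℝ => NormedSpace.exp (s • -Z) * u s * NormedSpace.exp (s • Z)) 0 t := by
    intro t
    have h := ((hasDerivAt_matrix_exp_smul (-Z) t).matrix_mul (hu t)).matrix_mul
      (hasDerivAt_matrix_exp_smul Z t)
    convert h using 1
    rw [commute_matrix_exp Z t, Ring.lie_def]
    noncomm_ring
  have h2 := matrix_eq_of_hasDerivAt_zero h1 t 0
  simp only [zero_smul, NormedSpace.exp_zero, one_mul, mul_one] at h2
  rw [← h2, rAd_apply, expGL_val, expGL_inv_val, smul_neg]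
  calc u t = (NormedSpace.exp (t • Z) * NormedSpace.exp (-(t • Z))) * u t *
        (NormedSpace.exp (t • Z) * NormedSpace.exp (-(t • Z))) := by
          rw [matrix_exp_mul_exp_neg, one_mul, mul_one]
    _ = _ := by simp only [mul_assoc]

variable {G : Subgroup (GL (Fin n) ℂ)} {K : Subgroup (GL (Fin n) ℝ)}

/-- The elements of `K` whose adjoint action commutes with the Cartan involution. -/
noncomputable def thetaStab (C : CartanForm (gReal G) (lieAlg K)) (hKG : K ≤ realPoints G) :
    Subgroup (GL (Fin n) ℝ) where
  carrier := {h | h ∈ K ∧ ∀ X ∈ gReal G, C.theta (rAd h X) = rAd h (C.theta X)}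
  mul_mem' := by
    rintro a c ⟨ha, ha'⟩ ⟨hc, hc'⟩
    refine ⟨K.mul_mem ha hc, fun X hX => ?_⟩
    rw [rAd_mul, ha' _ (rAd_mem_lieAlg (hKG hc) hX), hc' X hX, rAd_mul]
  one_mem' := ⟨K.one_mem, fun X _ => by rw [rAd_one, rAd_one]⟩
  inv_mem' := by
    rintro a ⟨ha, ha'⟩
    refine ⟨K.inv_mem ha, fun X hX => ?_⟩
    have h1 := ha' _ (rAd_mem_lieAlg (hKG (K.inv_mem ha)) hX)
    rw [rAd_rAd_inv] at h1
    rw [h1, rAd_inv_rAd]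

theorem isCompact_thetaStab (C : CartanForm (gReal G) (lieAlg K)) (hKG : K ≤ realPoints G)
    (hK : IsCompact (K : Set (GL (Fin n) ℝ))) :
    IsCompact (thetaStab C hKG : Set (GL (Fin n) ℝ)) := by
  have h1 : (thetaStab C hKG : Set (GL (Fin n) ℝ)) =
      (K : Set (GL (Fin n) ℝ)) ∩ ⋂ X ∈ gReal G, {h | C.theta (rAd h X) = rAd h (C.theta X)} := by
    ext h
    simp only [Set.mem_inter_iff, Set.mem_iInter]
    rfl
  rw [h1]
  refine hK.inter_right (isClosed_biInter fun X _ => isClosed_eq ?_ (continuous_rAd _))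
  exact (LinearMap.continuous_of_finiteDimensional C.theta).comp (continuous_rAd X)

theorem expGL_mem_thetaStab (C : CartanForm (gReal G) (lieAlg K)) (hKG : K ≤ realPoints G)
    (hK : IsClosed (K : Set (GL (Fin n) ℝ))) {Z : Matrix (Fin n) (Fin n) ℝ} (hZ : Z ∈ lieAlg K)
    (t : ℝ) : expGL (t • Z) ∈ thetaStab C hKG := by
  refine ⟨expGL_smul_mem hK hZ t, fun X hX => ?_⟩
  have h1 : ∀ t : ℝ, HasDerivAt (fun s : ℝ => C.theta (rAd (expGL (s • Z)) X))
      ⁅Z, C.theta (rAd (expGL (t • Z)) X)⁆ t := by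
    intro t
    have h2 := (hasDerivAt_exp_conj Z X t).linearMap_matrix' C.theta
    have h3 : ∀ s : ℝ, rAd (expGL (s • Z)) X =
        NormedSpace.exp (s • Z) * X * NormedSpace.exp (-(s • Z)) := fun s => rAd_apply _ _
    rw [← h3, C.theta_lie_of_mem hZ
      (rAd_mem_lieAlg (hKG (expGL_smul_mem hK hZ t)) hX)] at h2
    simpa only [h3] using h2
  have h2 := eq_exp_conj_of_hasDerivAt h1 t
  rwa [zero_smul, expGL_zero, rAd_one] at h2

/-- Two maximal torus algebras are conjugate under the stabilizer of the Cartan involution: a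
conjugate of a generic element of the first commutes with a generic element of the second if its
inner product with the latter is extremal among all conjugates. -/
theorem exists_conj_torus (C : CartanForm (gReal G) (lieAlg K)) (hKG : K ≤ realPoints G)
    (hK : IsCompact (K : Set (GL (Fin n) ℝ))) {b b' : Submodule ℝ (Matrix (Fin n) (Fin n) ℝ)}
    (hb : IsTorusAlgebra (lieAlg K) b) (hb' : IsTorusAlgebra (lieAlg K) b')
    {Y Y' : Matrix (Fin n) (Fin n) ℝ} (hYb : Y ∈ b) (hYb' : Y' ∈ b')
    (hY : ∀ X ∈ lieAlg K, ⁅Y, X⁆ = 0 → ∀ Z ∈ b, ⁅Z, X⁆ = 0)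
    (hY' : ∀ X ∈ lieAlg K, ⁅Y', X⁆ = 0 → ∀ Z ∈ b', ⁅Z, X⁆ = 0) :
    ∃ h ∈ thetaStab C hKG, (∀ Z ∈ b, rAd h Z ∈ b') ∧ ∀ Z ∈ b', rAd h⁻¹ Z ∈ b := by
  have hcont : Continuous fun h : GL (Fin n) ℝ => C.form (rAd h Y) Y' :=
    (LinearMap.continuous_of_finiteDimensional (C.form.flip Y')).comp (continuous_rAd Y)
  obtain ⟨h, hh, hmax⟩ := (isCompact_thetaStab C hKG hK).exists_isMaxOn ⟨1, one_mem _⟩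
    hcont.continuousOn
  refine ⟨h, hh, ?_⟩
  have hX0 : rAd h Y ∈ lieAlg K := rAd_mem_lieAlg hh.1 (hb.le Y hYb)
  have hY'K := hb'.le Y' hYb'
  have hcomm : ⁅rAd h Y, Y'⁆ = 0 := by
    have hder : ∀ Z ∈ lieAlg K, C.form Z ⁅rAd h Y, Y'⁆ = 0 := by
      intro Z hZ
      rw [← C.invariant Z (C.le hZ) _ (C.le hX0) _ (C.le hY'K)]
      have h1 := (hasDerivAt_exp_conj Z (rAd h Y) (0 : ℝ)).linearMap_matrix (C.form.flip Y')
      simp only [zero_smul, NormedSpace.exp_zero, neg_zero, one_mul, mul_one] at h1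
      refine IsLocalMax.hasDerivAt_eq_zero (Eventually.of_forall fun t => ?_) h1
      have h2 := hmax ((thetaStab C hKG).mul_mem (expGL_mem_thetaStab C hKG hK.isClosed hZ t) hh)
      simp only [Set.mem_ofPred_eq, rAd_mul] at h2
      rw [rAd_apply (expGL _), expGL_val, expGL_inv_val] at h2
      simp only [zero_smul, NormedSpace.exp_zero, neg_zero, one_mul, mul_one]
      exact h2
    by_contra hne
    have hk := (lieAlg K).lie_mem hX0 hY'K
    exact (C.form_neg hk hne).ne (hder _ hk)
  have hXb' : rAd h Y ∈ b' := by
    refine hb'.mem_of_centralizes _ hX0 (hY' _ hX0 ?_)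
    rw [← lie_skew, hcomm, neg_zero]
  have hYb1 : rAd h⁻¹ Y' ∈ b := by
    have hm : rAd h⁻¹ Y' ∈ lieAlg K := rAd_mem_lieAlg (K.inv_mem hh.1) hY'K
    refine hb.mem_of_centralizes _ hm (hY _ hm ?_)
    have : ⁅Y, rAd h⁻¹ Y'⁆ = rAd h⁻¹ ⁅rAd h Y, Y'⁆ := by rw [rAd_lie, rAd_inv_rAd]
    rw [this, hcomm, map_zero]
  constructor
  · intro Z hZ
    have hm : rAd h Z ∈ lieAlg K := rAd_mem_lieAlg hh.1 (hb.le Z hZ)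
    refine hb'.mem_of_centralizes _ hm (hY' _ hm ?_)
    have : ⁅Y', rAd h Z⁆ = rAd h ⁅rAd h⁻¹ Y', Z⁆ := by rw [rAd_lie, rAd_rAd_inv]
    rw [this, hb.abelian _ hYb1 _ hZ, map_zero]
  · intro Z hZ
    have hm : rAd h⁻¹ Z ∈ lieAlg K := rAd_mem_lieAlg (K.inv_mem hh.1) (hb'.le Z hZ)
    refine hb.mem_of_centralizes _ hm (hY _ hm ?_)
    have : ⁅Y, rAd h⁻¹ Z⁆ = rAd h⁻¹ ⁅rAd h Y, Z⁆ := by rw [rAd_lie, rAd_inv_rAd]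
    rw [this, hb'.abelian _ hXb' _ hZ, map_zero]

end Conjugacy

/-! ### The data of a triple -/

section Triple

attribute [local instance] LieRing.ofAssociativeRing

variable {n : ℕ} {G : Subgroup (GL (Fin n) ℂ)} {K : Subgroup (GL (Fin n) ℝ)}

theorem TripleDatum.isClosed_B (T : TripleDatum G K) : IsClosed (T.B : Set (GL (Fin n) ℝ)) :=
  T.isMaximalTorus.1.2.1.isClosed

/-- The Lie algebra of a maximal torus is a maximal abelian subalgebra of `k`. -/
theorem TripleDatum.isTorusAlgebra (T : TripleDatum G K)
    (hK : IsCompact (K : Set (GL (Fin n) ℝ))) :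
    IsTorusAlgebra (lieAlg K) (lieAlg T.B).toSubmodule where
  le _ hY := lieAlg_mono T.isClosed_B hK.isClosed
    (T.isMaximalTorus.1.1.trans (identityComponent_le K)) hY
  abelian _ hY _ hZ := lie_eq_zero_of_commutative T.isClosed_B T.isMaximalTorus.1.2.2.2 hY hZ
  mem_of_centralizes _ hY h := mem_lieAlg_of_isMaximalTorus hK T.isMaximalTorus hY h

/-- The complex-linear extension of a real weight, multiplied by `i`. -/
noncomputable def complexDual {b : Submodule ℝ (Matrix (Fin n) (Fin n) ℝ)}
    (c : Module.Dual ℝ b) : Module.Dual ℂ (complexify b) where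
  toFun X := Complex.I * (c ⟨reM X, (mem_complexify_iff.1 X.2).1⟩ +
    Complex.I * c ⟨imM X, (mem_complexify_iff.1 X.2).2⟩)
  map_add' X Y := by
    have h1 : (⟨reM ((X + Y : complexify b) : Matrix (Fin n) (Fin n) ℂ),
        (mem_complexify_iff.1 (X + Y).2).1⟩ : b) = ⟨reM X, (mem_complexify_iff.1 X.2).1⟩ +
        ⟨reM Y, (mem_complexify_iff.1 Y.2).1⟩ := Subtype.ext (map_add _ _ _)
    have h2 : (⟨imM ((X + Y : complexify b) : Matrix (Fin n) (Fin n) ℂ),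
        (mem_complexify_iff.1 (X + Y).2).2⟩ : b) = ⟨imM X, (mem_complexify_iff.1 X.2).2⟩ +
        ⟨imM Y, (mem_complexify_iff.1 Y.2).2⟩ := Subtype.ext (map_add _ _ _)
    rw [h1, h2, map_add, map_add]
    push_cast
    ring
  map_smul' a X := by
    have h1 : (⟨reM ((a • X : complexify b) : Matrix (Fin n) (Fin n) ℂ),
        (mem_complexify_iff.1 (a • X).2).1⟩ : b) = a.re • ⟨reM X, (mem_complexify_iff.1 X.2).1⟩ -
        a.im • ⟨imM X, (mem_complexify_iff.1 X.2).2⟩ := Subtype.ext (reM_smul _ _)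
    have h2 : (⟨imM ((a • X : complexify b) : Matrix (Fin n) (Fin n) ℂ),
        (mem_complexify_iff.1 (a • X).2).2⟩ : b) = a.re • ⟨imM X, (mem_complexify_iff.1 X.2).2⟩ +
        a.im • ⟨reM X, (mem_complexify_iff.1 X.2).1⟩ := Subtype.ext (imM_smul _ _)
    rw [h1, h2, map_add, map_sub, map_smul, map_smul, map_smul, map_smul]
    apply Complex.ext <;> simp <;> ring

/-- The element `x` of a triple is `i Y` for a generic element `Y` of the torus algebra, genericity
being expressed by the real weights `c` with eigenvalues `i c(Y)`. -/
theorem TripleDatum.exists_generic (T : TripleDatum G K) :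
    ∃ Y : (lieAlg T.B).toSubmodule, (T.x : Matrix (Fin n) (Fin n) ℂ) =
      Complex.I • toComplex (Y : Matrix (Fin n) (Fin n) ℝ) ∧
      IsGeneric (gReal G).toSubmodule (lieAlg T.B).toSubmodule Y := by
  obtain ⟨Y, hY, hx⟩ := T.x_mem
  refine ⟨⟨Y, hY⟩, hx, fun c ⟨X, hX, hX0, hc⟩ hc0 hcY => ?_⟩
  have hre : reM (T.x : Matrix (Fin n) (Fin n) ℂ) = 0 := by rw [hx, reM_smul]; simp
  have him : imM (T.x : Matrix (Fin n) (Fin n) ℂ) = Y := by rw [hx, imM_smul]; simp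
  refine T.generic (complexDual c) ⟨fun h0 => hc0 ?_, X, hX, hX0, fun Z => ?_⟩ ?_
  · ext Z
    have h1 := DFunLike.congr_fun h0 (⟨toComplex Z, toComplex_mem_complexify Z.2⟩ :
      complexify (lieAlg T.B).toSubmodule)
    have h2 : (⟨reM (toComplex (Z : Matrix (Fin n) (Fin n) ℝ)), by simp⟩ :
      (lieAlg T.B).toSubmodule) = Z := Subtype.ext (reM_toComplex _)
    have h3 : (⟨imM (toComplex (Z : Matrix (Fin n) (Fin n) ℝ)), by simp⟩ :
      (lieAlg T.B).toSubmodule) = 0 := Subtype.ext (imM_toComplex _)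
    simp only [complexDual, LinearMap.coe_mk, AddHom.coe_mk, h2, h3] at h1
    simpa using h1
  · conv_lhs => rw [← toComplex_re_add_im (Z : Matrix (Fin n) (Fin n) ℂ)]
    rw [add_lie, smul_lie_matrix, hc ⟨reM Z, (mem_complexify_iff.1 Z.2).1⟩,
      hc ⟨imM Z, (mem_complexify_iff.1 Z.2).2⟩, smul_smul, ← add_smul]
    congr 1
    simp only [complexDual, LinearMap.coe_mk, AddHom.coe_mk]
    ring
  · have h2 : (⟨reM (T.x : Matrix (Fin n) (Fin n) ℂ), (mem_complexify_iff.1 T.x.2).1⟩ :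
      (lieAlg T.B).toSubmodule) = 0 := Subtype.ext hre
    have h3 : (⟨imM (T.x : Matrix (Fin n) (Fin n) ℂ), (mem_complexify_iff.1 T.x.2).2⟩ :
      (lieAlg T.B).toSubmodule) = ⟨Y, hY⟩ := Subtype.ext him
    simp only [complexDual, LinearMap.coe_mk, AddHom.coe_mk, h2, h3, hcY]
    simp

theorem TripleDatum.q_eq (T : TripleDatum G K) :
    T.q = qOf (gReal G).toSubmodule (T.x : Matrix (Fin n) (Fin n) ℂ) := rfl

/-- The `-1` eigenspace of the Cartan involution on the centralizer of `b`. -/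
def aSub (C : CartanForm (gReal G) (lieAlg K)) (b : Submodule ℝ (Matrix (Fin n) (Fin n) ℝ)) :
    Set (Matrix (Fin n) (Fin n) ℝ) :=
  {X | X ∈ gReal G ∧ (∀ Y ∈ b, ⁅Y, X⁆ = 0) ∧ C.theta X = -X}

theorem TripleDatum.coe_aReal {θ : gReal G →ₗ⁅ℝ⁆ gReal G} (C : CartanForm (gReal G) (lieAlg K))
    (hC : ∀ X : gReal G, C.theta X = θ X) (T : TripleDatum G K) :
    (T.aReal θ : Set (Matrix (Fin n) (Fin n) ℝ)) = aSub C (lieAlg T.B).toSubmodule := by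
  ext X
  constructor
  · rintro ⟨X, ⟨h1, h2⟩, rfl⟩
    refine ⟨X.2, h1, ?_⟩
    have h3 := hC X
    rw [h2] at h3
    exact h3
  · rintro ⟨h1, h2, h3⟩
    refine ⟨⟨X, h1⟩, ⟨h2, Subtype.ext ?_⟩, rfl⟩
    rw [← hC]
    exact h3

end Triple

end RealReductive

namespace RealReductive

/-! ### Chambers of a finite set of linear forms stable under reflections -/

section Chambers

variable {E : Type*} [AddCommGroup E] [Module ℝ E]

/-- The reflection in the kernel of `α` along `h`; it is used when `α h ≠ 0`. -/
noncomputable def refl (α : Module.Dual ℝ E) (h : E) : E →ₗ[ℝ] E :=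
  LinearMap.id - (2 / α h) • α.smulRight h

theorem refl_apply (α : Module.Dual ℝ E) (h x : E) : refl α h x = x - (2 / α h * α x) • h := by
  simp [refl, smul_smul]

theorem apply_refl (α β : Module.Dual ℝ E) (h x : E) :
    β (refl α h x) = β x - 2 * β h / α h * α x := by
  rw [refl_apply, map_sub, map_smul, smul_eq_mul]; ring

theorem apply_refl_self {α : Module.Dual ℝ E} {h : E} (hh : α h ≠ 0) (x : E) :
    α (refl α h x) = -α x := by
  rw [apply_refl]; field_simp; ring

theorem refl_refl {α : Module.Dual ℝ E} {h : E} (hh : α h ≠ 0) (x : E) :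
    refl α h (refl α h x) = x := by
  rw [refl_apply α h (refl α h x), apply_refl_self hh, refl_apply]
  module

theorem comp_refl_comp_refl {α : Module.Dual ℝ E} {h : E} (hh : α h ≠ 0) (β : Module.Dual ℝ E) :
    (β ∘ₗ refl α h) ∘ₗ refl α h = β := by
  ext x
  simp [refl_refl hh]

/-- The number of forms separating two regular points drops under the reflection in a
separating form. -/
theorem ncard_separating_lt {Φ : Set (Module.Dual ℝ E)} (hfin : Φ.Finite) {α : Module.Dual ℝ E}
    {h : E} (hh : α h ≠ 0) (hΦ : ∀ β ∈ Φ, β ∘ₗ refl α h ∈ Φ) (hα : α ∈ Φ) {x y : E}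
    (hx : 0 < α x) (hy : α y < 0) :
    {β | β ∈ Φ ∧ 0 < β (refl α h x) ∧ β y < 0}.ncard <
      {β | β ∈ Φ ∧ 0 < β x ∧ β y < 0}.ncard := by
  classical
  have hS : {β | β ∈ Φ ∧ 0 < β x ∧ β y < 0}.Finite := hfin.subset fun β hβ => hβ.1
  refine lt_of_le_of_lt ?_ (Set.ncard_sdiff_singleton_lt_of_mem (a := α) ⟨hα, hx, hy⟩ hS)
  refine Set.ncard_le_ncard_of_injOn (fun β => if 0 < β x then β else β ∘ₗ refl α h) ?_ ?_
    hS.sdiff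
  · rintro β ⟨hβ, h1, h2⟩
    by_cases h3 : 0 < β x
    · simp only [h3, if_true]
      refine ⟨⟨hβ, h3, h2⟩, ?_⟩
      rintro rfl
      rw [apply_refl_self hh] at h1
      linarith
    · simp only [h3, if_false]
      refine ⟨⟨hΦ β hβ, h1, ?_⟩, fun h4 => ?_⟩
      · rw [apply_refl] at h1
        have hm : 2 * β h / α h < 0 := by
          by_contra! hm
          nlinarith [mul_nonneg hm hx.le]
        rw [LinearMap.comp_apply, apply_refl]
        nlinarith [mul_pos_of_neg_of_neg hm hy]
      · have h5 : β ∘ₗ refl α h = α := h4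
        have h6 : β y = -α y := by
          rw [← apply_refl_self hh, ← h5, LinearMap.comp_apply, h5, refl_refl hh]
        linarith
  · rintro β ⟨hβ, h1, h2⟩ β' ⟨hβ', h1', h2'⟩ he
    by_cases h3 : 0 < β x <;> by_cases h3' : 0 < β' x <;>
      simp only [h3, h3', if_true, if_false] at he
    · exact he
    · rw [he, LinearMap.comp_apply, refl_refl hh] at h1
      exact absurd h1 h3'
    · rw [← he, LinearMap.comp_apply, refl_refl hh] at h1'
      exact absurd h1' h3
    · rw [← comp_refl_comp_refl hh β, he, comp_refl_comp_refl hh]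

/-- A regular point can be moved by reflections into the chamber of any other. The relation `R`
records by which means a point may be moved. -/
theorem exists_mem_chamber {Φ : Set (Module.Dual ℝ E)} (hfin : Φ.Finite) (R : E → E → Prop)
    (hR : ∀ x, R x x) (hT : ∀ x y z, R x y → R y z → R x z)
    (hstep : ∀ α ∈ Φ, α ≠ 0 →
      ∃ h, α h ≠ 0 ∧ (∀ β ∈ Φ, β ∘ₗ refl α h ∈ Φ) ∧ ∀ x, R x (refl α h x))
    {x y : E} (hx : ∀ α ∈ Φ, α ≠ 0 → α x ≠ 0) (hy : ∀ α ∈ Φ, α ≠ 0 → α y ≠ 0) :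
    ∃ x', R x x' ∧ ∀ α ∈ Φ, α ≠ 0 → (α x' ≤ 0 ↔ α y ≤ 0) := by
  induction hN : {β | β ∈ Φ ∧ 0 < β x ∧ β y < 0}.ncard using Nat.strong_induction_on
    generalizing x with
  | _ N ih =>
  by_cases hsep : ∃ α ∈ Φ, 0 < α x ∧ α y < 0
  · obtain ⟨α, hα, h1, h2⟩ := hsep
    have hα0 : α ≠ 0 := by rintro rfl; simp at h1
    obtain ⟨h, hh, hΦ, hRs⟩ := hstep α hα hα0
    obtain ⟨x', hx', hs⟩ := ih _ (hN ▸ ncard_separating_lt hfin hh hΦ hα h1 h2)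
      (x := refl α h x) (fun β hβ hβ0 => hx _ (hΦ β hβ) fun h0 => hβ0 (by
        rw [← comp_refl_comp_refl hh β, h0, LinearMap.zero_comp])) rfl
    exact ⟨x', hT _ _ _ (hRs x) hx', hs⟩
  · push Not at hsep
    refine ⟨x, hR x, fun α hα hα0 => ?_⟩
    -- the opposite of a form in `Φ` is its own reflection
    have hneg : -α ∈ Φ := by
      obtain ⟨h, hh, hΦ, -⟩ := hstep α hα hα0
      have : α ∘ₗ refl α h = -α := by ext z; exact apply_refl_self hh z
      exact this ▸ hΦ α hα
    have h1 := hsep α hα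
    have h2 := hsep _ hneg
    simp only [LinearMap.neg_apply, Left.neg_pos_iff, Left.nonneg_neg_iff] at h2
    have h3 := hx α hα hα0
    have h4 := hy α hα hα0
    constructor
    · intro h5; exact h2 (lt_of_le_of_ne h5 h3)
    · intro h5
      by_contra! h6
      exact h4 (le_antisymm h5 (h1 h6))

end Chambers

/-! ### Reflections realized in the group -/

section Reflections

attribute [local instance] LieRing.ofAssociativeRing

variable {n : ℕ}

/-- `A` and `B` are the real and imaginary parts of a weight vector of weight `c` on which the
Cartan involution acts by the sign `ε`. -/
structure IsWeightPair {g k : LieSubalgebra ℝ (Matrix (Fin n) (Fin n) ℝ)} (C : CartanForm g k)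
    (b : Submodule ℝ (Matrix (Fin n) (Fin n) ℝ)) (c : Module.Dual ℝ b) (ε : ℝ)
    (A B : Matrix (Fin n) (Fin n) ℝ) : Prop where
  mem_left : A ∈ g
  mem_right : B ∈ g
  theta_left : C.theta A = ε • A
  theta_right : C.theta B = ε • B
  lie_left : ∀ Y : b, ⁅(Y : Matrix (Fin n) (Fin n) ℝ), A⁆ = -(c Y • B)
  lie_right : ∀ Y : b, ⁅(Y : Matrix (Fin n) (Fin n) ℝ), B⁆ = c Y • A

section Pair

variable {g k : LieSubalgebra ℝ (Matrix (Fin n) (Fin n) ℝ)} {C : CartanForm g k}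
  {b : Submodule ℝ (Matrix (Fin n) (Fin n) ℝ)} {c : Module.Dual ℝ b}

theorem smul_lie_real (c : ℝ) (X Y : Matrix (Fin n) (Fin n) ℝ) : ⁅c • X, Y⁆ = c • ⁅X, Y⁆ := by
  rw [Ring.lie_def, Ring.lie_def, smul_mul_assoc, mul_smul_comm, smul_sub]

theorem lie_smul_real (c : ℝ) (X Y : Matrix (Fin n) (Fin n) ℝ) : ⁅X, c • Y⁆ = c • ⁅X, Y⁆ := by
  rw [Ring.lie_def, Ring.lie_def, smul_mul_assoc, mul_smul_comm, smul_sub]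

theorem IsWeightPair.left_ne_zero {ε : ℝ} {A B : Matrix (Fin n) (Fin n) ℝ}
    (h : IsWeightPair C b c ε A B) (hc : c ≠ 0) (h0 : A ≠ 0 ∨ B ≠ 0) : A ≠ 0 := by
  rintro rfl
  refine hc (LinearMap.ext fun Y => ?_)
  have := h.lie_left Y
  rw [lie_zero, eq_comm, neg_eq_zero, smul_eq_zero] at this
  exact this.resolve_right (h0.resolve_left fun h => h rfl)

/-- The projections of a weight vector to the eigenspaces of the Cartan involution are weight vectors,
because the involution fixes the torus algebra. -/
theorem exists_isWeightPair_aux (hb : IsTorusAlgebra k b) {A B : Matrix (Fin n) (Fin n) ℝ}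
    (hA : A ∈ g) (hB : B ∈ g)
    (hl : ∀ Y : b, ⁅(Y : Matrix (Fin n) (Fin n) ℝ), A⁆ = -(c Y • B))
    (hr : ∀ Y : b, ⁅(Y : Matrix (Fin n) (Fin n) ℝ), B⁆ = c Y • A) {ε : ℝ} (hε : ε * ε = 1) :
    IsWeightPair C b c ε (A + ε • C.theta A) (B + ε • C.theta B) where
  mem_left := add_mem hA (g.smul_mem ε (C.theta_mem A hA))
  mem_right := add_mem hB (g.smul_mem ε (C.theta_mem B hB))
  theta_left := by
    rw [map_add, map_smul, C.theta_theta A hA, smul_add, smul_smul, hε, one_smul, add_comm]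
  theta_right := by
    rw [map_add, map_smul, C.theta_theta B hB, smul_add, smul_smul, hε, one_smul, add_comm]
  lie_left Y := by
    rw [lie_add, lie_smul_real, ← C.theta_lie_of_mem (hb.le _ Y.2) hA, hl, map_neg, map_smul]
    module
  lie_right Y := by
    rw [lie_add, lie_smul_real, ← C.theta_lie_of_mem (hb.le _ Y.2) hB, hr, map_smul]
    module

/-- Each weight has a weight vector in the complexification of one of the eigenspaces of the
Cartan involution. -/
theorem exists_isWeightPair (C : CartanForm g k) (hb : IsTorusAlgebra k b) (hc : c ≠ 0)
    (hw : IsWeight g.toSubmodule b c) :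
    ∃ ε : ℝ, (ε = 1 ∨ ε = -1) ∧ ∃ A B, A ≠ 0 ∧ IsWeightPair C b c ε A B := by
  obtain ⟨X, hX, hX0, h⟩ := hw
  rw [mem_complexify_iff] at hX
  have hl : ∀ Y : b, ⁅(Y : Matrix (Fin n) (Fin n) ℝ), reM X⁆ = -(c Y • imM X) := by
    intro Y
    rw [← reM_lie_toComplex, h, reM_smul]
    simp
  have hr : ∀ Y : b, ⁅(Y : Matrix (Fin n) (Fin n) ℝ), imM X⁆ = c Y • reM X := by
    intro Y
    rw [← imM_lie_toComplex, h, imM_smul]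
    simp
  have h0 : reM X ≠ 0 ∨ imM X ≠ 0 := by
    by_contra! h
    exact hX0 (matrix_ext_re_im (by rw [h.1, map_zero]) (by rw [h.2, map_zero]))
  have hp := exists_isWeightPair_aux (C := C) hb hX.1 hX.2 hl hr (ε := 1) (by norm_num)
  have hm := exists_isWeightPair_aux (C := C) hb hX.1 hX.2 hl hr (ε := -1) (by norm_num)
  by_cases hz : reM X + (1 : ℝ) • C.theta (reM X) = 0 ∧ imM X + (1 : ℝ) • C.theta (imM X) = 0
  · refine ⟨-1, Or.inr rfl, _, _, hm.left_ne_zero hc ?_, hm⟩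
    rcases h0 with h0 | h0
    · left
      intro h1
      have : (2 : ℝ) • reM X = 0 := by
        linear_combination (norm := module) hz.1 + h1
      exact h0 ((smul_eq_zero.1 this).resolve_left two_ne_zero)
    · right
      intro h1
      have : (2 : ℝ) • imM X = 0 := by
        linear_combination (norm := module) hz.2 + h1
      exact h0 ((smul_eq_zero.1 this).resolve_left two_ne_zero)
  · exact ⟨1, Or.inl rfl, _, _, hp.left_ne_zero hc (not_and_or.1 hz), hp⟩

theorem IsWeightPair.lie_mem (hb : IsTorusAlgebra k b) {ε : ℝ} (hε : ε = 1 ∨ ε = -1)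
    {A B : Matrix (Fin n) (Fin n) ℝ} (h : IsWeightPair C b c ε A B) : ⁅A, B⁆ ∈ b := by
  refine hb.mem_of_centralizes _ ?_ fun Y hY => ?_
  · rw [← C.fixed_iff _ (g.lie_mem h.mem_left h.mem_right),
      C.theta_lie _ h.mem_left _ h.mem_right, h.theta_left, h.theta_right, smul_lie_real,
      lie_smul_real, smul_smul]
    rcases hε with rfl | rfl <;> norm_num
  · rw [leibniz_lie, h.lie_left ⟨Y, hY⟩, h.lie_right ⟨Y, hY⟩, neg_lie, smul_lie_real, lie_self,
      lie_smul_real, lie_self]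
    simp

/-- The weight takes a value of definite sign on the bracket of a weight pair. -/
theorem IsWeightPair.mul_form_pos (hb : IsTorusAlgebra k b) {ε : ℝ} (hε : ε = 1 ∨ ε = -1)
    {A B : Matrix (Fin n) (Fin n) ℝ} (h : IsWeightPair C b c ε A B) (hA : A ≠ 0) (hc : c ≠ 0) :
    0 < -ε * c ⟨⁅A, B⁆, h.lie_mem hb hε⟩ := by
  have hform : ∀ Y : b, C.form ⁅A, B⁆ Y = -(c Y * C.form A A) := by
    intro Y
    rw [C.invariant _ h.mem_left _ h.mem_right _ (C.le (hb.le _ Y.2)), ← lie_skew, h.lie_right,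
      map_neg, map_smul, smul_eq_mul]
  have hAA : C.form A A ≠ 0 ∧ 0 < -ε * C.form A A := by
    have h1 := C.neg A h.mem_left hA
    rw [h.theta_left, map_smul, smul_eq_mul] at h1
    exact ⟨fun h0 => by rw [h0] at h1; simp at h1, by linarith⟩
  have hH0 : ⁅A, B⁆ ≠ 0 := by
    intro h0
    refine hc (LinearMap.ext fun Y => ?_)
    have := hform Y
    rw [h0, map_zero, LinearMap.zero_apply, eq_comm, neg_eq_zero, mul_eq_zero] at this
    exact this.resolve_right hAA.1
  have h1 := C.form_neg (hb.le _ (h.lie_mem hb hε)) hH0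
  have h2 := hform ⟨_, h.lie_mem hb hε⟩
  simp only at h2
  rw [h2] at h1
  have h3 : 0 < c ⟨⁅A, B⁆, h.lie_mem hb hε⟩ * C.form A A := by linarith
  rcases hε with rfl | rfl
  · nlinarith [hAA.2]
  · nlinarith [hAA.2]

/-- The exponential of a suitable multiple of an element of a weight pair acts as a reflection:
`⁅A, B⁆ ± lB` is an eigenvector of `ad (tA)` with eigenvalue `± i π`. -/
theorem IsWeightPair.Ad_expGL_eq_refl (hb : IsTorusAlgebra k b) {ε : ℝ} (hε : ε = 1 ∨ ε = -1)
    {A B : Matrix (Fin n) (Fin n) ℝ} (h : IsWeightPair C b c ε A B)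
    (hcH : c ⟨⁅A, B⁆, h.lie_mem hb hε⟩ ≠ 0) {t : ℂ}
    (ht : t ^ 2 * c ⟨⁅A, B⁆, h.lie_mem hb hε⟩ = -(Real.pi : ℂ) ^ 2) (Z : b) :
    Ad (expGL (t • toComplex A)) (toComplex (Z : Matrix (Fin n) (Fin n) ℝ)) =
      toComplex (refl c ⟨⁅A, B⁆, h.lie_mem hb hε⟩ Z : b) := by
  set H : b := ⟨⁅A, B⁆, h.lie_mem hb hε⟩ with hH
  have hHv : (H : Matrix (Fin n) (Fin n) ℝ) = ⁅A, B⁆ := rfl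
  have hpi : (Real.pi : ℂ) ≠ 0 := by exact_mod_cast Real.pi_ne_zero
  have ht0 : t ≠ 0 := by
    rintro rfl
    simp at ht
  have hAH : ⁅A, (H : Matrix (Fin n) (Fin n) ℝ)⁆ = c H • B := by
    rw [← lie_skew, h.lie_left, neg_neg]
  have hev : ∀ s : ℂ, s ^ 2 = -(Real.pi : ℂ) ^ 2 →
      ⁅t • toComplex A, toComplex (H : Matrix (Fin n) (Fin n) ℝ) + (s / t) • toComplex B⁆ =
        s • (toComplex (H : Matrix (Fin n) (Fin n) ℝ) + (s / t) • toComplex B) := by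
    intro s hs
    rw [smul_lie_matrix, lie_add, lie_smul_matrix, ← toComplex_lie, ← toComplex_lie, hAH, ← hHv,
      toComplex_smul, smul_add, smul_add, smul_smul, smul_smul, smul_smul]
    have h1 : t * (c H : ℂ) = s * (s / t) := by
      field_simp
      rw [hs, ht]
    have h2 : t * (s / t) = s := by field_simp
    rw [h1, h2, add_comm]
  have hexp : ∀ s : ℂ, s = Real.pi * Complex.I ∨ s = -(Real.pi * Complex.I) → Complex.exp s = -1 := by
    rintro s (rfl | rfl)
    · exact Complex.exp_pi_mul_I
    · rw [Complex.exp_neg, Complex.exp_pi_mul_I]; norm_num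
  have hsq : (Real.pi * Complex.I : ℂ) ^ 2 = -(Real.pi : ℂ) ^ 2 := by
    rw [mul_pow, Complex.I_sq]; ring
  have e1 := Ad_expGL_of_lie_eq_smul (hev (Real.pi * Complex.I) hsq)
  have e2 := Ad_expGL_of_lie_eq_smul (hev (-(Real.pi * Complex.I)) (by rw [neg_sq, hsq]))
  rw [hexp _ (Or.inl rfl)] at e1
  rw [hexp _ (Or.inr rfl)] at e2
  have eH : Ad (expGL (t • toComplex A)) (toComplex (H : Matrix (Fin n) (Fin n) ℝ)) =
      -toComplex (H : Matrix (Fin n) (Fin n) ℝ) := by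
    have e3 := congrArg₂ (· + ·) e1 e2
    simp only [← map_add] at e3
    have h3 : toComplex (H : Matrix (Fin n) (Fin n) ℝ) +
        (Real.pi * Complex.I / t) • toComplex B + (toComplex (H : Matrix (Fin n) (Fin n) ℝ) +
        (-(Real.pi * Complex.I) / t) • toComplex B) =
        (2 : ℂ) • toComplex (H : Matrix (Fin n) (Fin n) ℝ) := by
      module
    rw [← smul_add, h3, map_smul, smul_comm] at e3
    have := smul_right_injective _ (two_ne_zero (α := ℂ)) e3
    rw [this]; simp
  have eK : ∀ W : b, c W = 0 → Ad (expGL (t • toComplex A))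
      (toComplex (W : Matrix (Fin n) (Fin n) ℝ)) = toComplex (W : Matrix (Fin n) (Fin n) ℝ) := by
    intro W hW
    have h4 : ⁅t • toComplex A, toComplex (W : Matrix (Fin n) (Fin n) ℝ)⁆ =
        (0 : ℂ) • toComplex (W : Matrix (Fin n) (Fin n) ℝ) := by
      rw [smul_lie_matrix, ← toComplex_lie, ← lie_skew, h.lie_left, hW]
      simp [toComplex_zero]
    rw [Ad_expGL_of_lie_eq_smul h4]; simp
  have hdec : Z = (Z - (c Z / c H) • H) + (c Z / c H) • H := by abel
  have hk0 : c (Z - (c Z / c H) • H) = 0 := by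
    rw [map_sub, map_smul, smul_eq_mul]; field_simp; ring
  have hrefl : refl c H Z = (Z - (c Z / c H) • H) - (c Z / c H) • H := by
    rw [refl_apply]; module
  have hsub : ((Z - (c Z / c H) • H - (c Z / c H) • H : b) : Matrix (Fin n) (Fin n) ℝ) =
      (Z - (c Z / c H) • H : b) - (c Z / c H) • (H : Matrix (Fin n) (Fin n) ℝ) := rfl
  rw [hrefl, hsub]
  conv_lhs => rw [hdec]
  rw [Submodule.coe_add, toComplex_add, map_add, eK _ hk0, toComplex_sub, Submodule.coe_smul,
    toComplex_smul, map_smul, eH]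
  module

end Pair

end Reflections

end RealReductive

namespace RealReductive

/-! ### Existence of a conjugating element -/

section Existence

attribute [local instance] LieRing.ofAssociativeRing

variable {n : ℕ}

/-- `Ad a` carries the set `V` of real matrices onto the set `V'` of real matrices. -/
def MapsReal (a : GL (Fin n) ℂ) (V V' : Set (Matrix (Fin n) (Fin n) ℝ)) : Prop :=
  Ad a '' (toComplex '' V) = toComplex '' V'

theorem MapsReal.trans {a a' : GL (Fin n) ℂ} {V V' V'' : Set (Matrix (Fin n) (Fin n) ℝ)}
    (h : MapsReal a V V') (h' : MapsReal a' V' V'') : MapsReal (a' * a) V V'' := by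
  rw [MapsReal, ← h', ← h, Set.image_image (Ad a') (Ad a)]
  exact Set.image_congr fun X _ => Ad_mul a' a X

theorem mapsReal_one (V : Set (Matrix (Fin n) (Fin n) ℝ)) : MapsReal 1 V V := by
  rw [MapsReal, Set.image_congr (g := id) fun X _ => Ad_one X, Set.image_id]

theorem mapsReal_of_eq {a : GL (Fin n) ℂ} {V V' : Set (Matrix (Fin n) (Fin n) ℝ)}
    {f f' : Matrix (Fin n) (Fin n) ℝ → Matrix (Fin n) (Fin n) ℝ}
    (h : ∀ X ∈ V, f X ∈ V' ∧ Ad a (toComplex X) = toComplex (f X))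
    (h' : ∀ X ∈ V', f' X ∈ V ∧ Ad a (toComplex (f' X)) = toComplex X) : MapsReal a V V' := by
  refine Set.Subset.antisymm ?_ ?_
  · rintro _ ⟨_, ⟨X, hX, rfl⟩, rfl⟩
    exact ⟨f X, (h X hX).1, (h X hX).2.symm⟩
  · rintro _ ⟨X, hX, rfl⟩
    exact ⟨_, ⟨f' X, (h' X hX).1, rfl⟩, (h' X hX).2⟩

theorem mapsReal_map {h : GL (Fin n) ℝ} {V V' : Set (Matrix (Fin n) (Fin n) ℝ)}
    (h1 : ∀ X ∈ V, rAd h X ∈ V') (h2 : ∀ X ∈ V', rAd h⁻¹ X ∈ V) :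
    MapsReal (Matrix.GeneralLinearGroup.map (algebraMap ℝ ℂ) h) V V' :=
  mapsReal_of_eq (fun X hX => ⟨h1 X hX, (toComplex_rAd h X).symm⟩)
    fun X hX => ⟨h2 X hX, by rw [← toComplex_rAd, rAd_rAd_inv]⟩

theorem MapsReal.map_complexify {a : GL (Fin n) ℂ}
    {V V' : Submodule ℝ (Matrix (Fin n) (Fin n) ℝ)}
    (h : MapsReal a (V : Set (Matrix (Fin n) (Fin n) ℝ)) V') :
    (complexify V).map (Ad a) = complexify V' := by
  rw [complexify, Submodule.map_span, h, complexify]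

/-- Weights are transported by the adjoint action. -/
theorem IsWeight.comp_of_Ad {g b b' : Submodule ℝ (Matrix (Fin n) (Fin n) ℝ)}
    {a : GL (Fin n) ℂ} (ha : ∀ X ∈ complexify g, Ad a⁻¹ X ∈ complexify g) {f : b →ₗ[ℝ] b'}
    (hf : ∀ Z : b, Ad a (toComplex (Z : Matrix (Fin n) (Fin n) ℝ)) = toComplex (f Z : b'))
    {c : Module.Dual ℝ b'} (hc : IsWeight g b' c) : IsWeight g b (c ∘ₗ f) := by
  obtain ⟨X, hX, hX0, h⟩ := hc
  refine ⟨Ad a⁻¹ X, ha X hX, fun h0 => hX0 ?_, fun Y => ?_⟩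
  · rw [← Ad_Ad_inv a X, h0, map_zero]
  · apply Ad_injective a
    rw [Ad_lie, hf, Ad_Ad_inv, h, map_smul, Ad_Ad_inv, LinearMap.comp_apply]

variable {G : Subgroup (GL (Fin n) ℂ)} {K : Subgroup (GL (Fin n) ℝ)}
  {C : CartanForm (gReal G) (lieAlg K)}

theorem rAd_mem_aSub {hKG : K ≤ realPoints G} {b b' : Submodule ℝ (Matrix (Fin n) (Fin n) ℝ)}
    {h : GL (Fin n) ℝ} (hh : h ∈ thetaStab C hKG) (hb : ∀ Z ∈ b', rAd h⁻¹ Z ∈ b)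
    {X : Matrix (Fin n) (Fin n) ℝ} (hX : X ∈ aSub C b) : rAd h X ∈ aSub C b' := by
  refine ⟨rAd_mem_lieAlg (hKG hh.1) hX.1, fun Z hZ => ?_, ?_⟩
  · rw [← rAd_rAd_inv h Z, ← rAd_lie, hX.2.1 _ (hb Z hZ), map_zero]
  · rw [hh.2 X hX.1, hX.2.2, map_neg]

theorem mapsReal_aSub {hKG : K ≤ realPoints G} {b b' : Submodule ℝ (Matrix (Fin n) (Fin n) ℝ)}
    {h : GL (Fin n) ℝ} (hh : h ∈ thetaStab C hKG) (h1 : ∀ Z ∈ b, rAd h Z ∈ b')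
    (h2 : ∀ Z ∈ b', rAd h⁻¹ Z ∈ b) :
    MapsReal (Matrix.GeneralLinearGroup.map (algebraMap ℝ ℂ) h) (aSub C b) (aSub C b') :=
  mapsReal_map (fun X hX => rAd_mem_aSub hh h2 hX) fun X hX =>
    rAd_mem_aSub (inv_mem hh) (by simpa only [inv_inv] using h1) hX

/-- The reflection attached to a nonzero weight is realized by an element of `G` that preserves
the `-1` eigenspace of the Cartan involution on the centralizer of the torus. If there is a
weight vector in the complexification of `k`, a rotation in `K` does it. Otherwise, weight vectors
commute with this eigenspace, since the bracket would give weight vectors in the complexification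
of `k`. -/
theorem exists_mem_Ad_eq_refl (hG : IsZariskiClosedOverReal G) (hKG : K ≤ realPoints G)
    (hK : IsCompact (K : Set (GL (Fin n) ℝ))) {b : Submodule ℝ (Matrix (Fin n) (Fin n) ℝ)}
    (hb : IsTorusAlgebra (lieAlg K) b) {c : Module.Dual ℝ b} (hc : c ≠ 0)
    (hw : IsWeight (gReal G).toSubmodule b c) :
    ∃ H : b, c H ≠ 0 ∧ ∃ a ∈ G, (∀ Z : b, Ad a (toComplex (Z : Matrix (Fin n) (Fin n) ℝ)) =
      toComplex (refl c H Z : b)) ∧ MapsReal a (aSub C b) (aSub C b) := by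
  by_cases hcpt : ∃ A B, A ≠ 0 ∧ IsWeightPair C b c 1 A B
  · obtain ⟨A, B, hA, h⟩ := hcpt
    have hpos := h.mul_form_pos hb (Or.inl rfl) hA hc
    set H : b := ⟨⁅A, B⁆, h.lie_mem hb (Or.inl rfl)⟩ with hH
    have hcH : c H ≠ 0 := by rintro h0; rw [h0] at hpos; simp at hpos
    have hAk : A ∈ lieAlg K := (C.fixed_iff A h.mem_left).1 (by rw [h.theta_left, one_smul])
    set t : ℝ := Real.pi / √(-c H) with ht
    have ht2 : (t : ℂ) ^ 2 * c H = -(Real.pi : ℂ) ^ 2 := by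
      have : t ^ 2 * c H = -Real.pi ^ 2 := by
        rw [ht, div_pow, Real.sq_sqrt (by linarith)]
        field_simp
      exact_mod_cast this
    have hθ := expGL_mem_thetaStab C hKG hK.isClosed hAk t
    have hAd := h.Ad_expGL_eq_refl hb (Or.inl rfl) hcH ht2
    have hmap : expGL ((t : ℂ) • toComplex A) =
        Matrix.GeneralLinearGroup.map (algebraMap ℝ ℂ) (expGL (t • A)) := by
      rw [map_expGL, toComplex_smul]
    rw [hmap] at hAd
    have hr : ∀ Z : b, rAd (expGL (t • A)) Z = (refl c H Z : b) := fun Z =>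
      toComplex_injective (by rw [toComplex_rAd, hAd])
    refine ⟨H, hcH, _, hKG hθ.1, hAd, mapsReal_aSub hθ (fun Z hZ => ?_) fun Z hZ => ?_⟩
    · rw [hr ⟨Z, hZ⟩]; exact (refl c H ⟨Z, hZ⟩).2
    · have : Z = rAd (expGL (t • A)) (refl c H ⟨Z, hZ⟩ : b) := by rw [hr, refl_refl hcH]
      rw [this, rAd_inv_rAd]
      exact (refl c H ⟨Z, hZ⟩).2
  · obtain ⟨ε, hε, A, B, hA, h⟩ := exists_isWeightPair C hb hc hw
    obtain rfl : ε = -1 := hε.resolve_left fun h1 => hcpt ⟨A, B, hA, h1 ▸ h⟩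
    have hpos := h.mul_form_pos hb hε hA hc
    set H : b := ⟨⁅A, B⁆, h.lie_mem hb hε⟩ with hH
    have hcH : c H ≠ 0 := by rintro h0; rw [h0] at hpos; simp at hpos
    set t : ℝ := Real.pi / √(c H) with ht
    have ht2 : (t * Complex.I : ℂ) ^ 2 * c H = -(Real.pi : ℂ) ^ 2 := by
      have : t ^ 2 * c H = Real.pi ^ 2 := by
        rw [ht, div_pow, Real.sq_sqrt (by linarith)]
        field_simp
      rw [mul_pow, Complex.I_sq, mul_neg_one, neg_mul]
      exact_mod_cast congrArg Neg.neg this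
    have hAd := h.Ad_expGL_eq_refl hb hε hcH ht2
    have hcomm : ∀ X ∈ aSub C b, ⁅X, A⁆ = 0 := by
      rintro X ⟨hX, hXb, hXθ⟩
      by_contra hne
      have hl : ∀ Y : b, ∀ Z : Matrix (Fin n) (Fin n) ℝ, ⁅(Y : Matrix (Fin n) (Fin n) ℝ), ⁅X, Z⁆⁆ =
          ⁅X, ⁅(Y : Matrix (Fin n) (Fin n) ℝ), Z⁆⁆ := fun Y Z => by
        rw [leibniz_lie, hXb Y Y.2, zero_lie, zero_add]
      refine hcpt ⟨⁅X, A⁆, ⁅X, B⁆, hne, (gReal G).lie_mem hX h.mem_left,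
        (gReal G).lie_mem hX h.mem_right, ?_, ?_, fun Y => ?_, fun Y => ?_⟩
      · rw [C.theta_lie X hX A h.mem_left, hXθ, h.theta_left, neg_smul, neg_lie, lie_neg, neg_neg,
          one_smul, one_smul]
      · rw [C.theta_lie X hX B h.mem_right, hXθ, h.theta_right, neg_smul, neg_lie, lie_neg,
          neg_neg, one_smul, one_smul]
      · rw [hl, h.lie_left, lie_neg, lie_smul_real]
      · rw [hl, h.lie_right, lie_smul_real]
    have hfix : ∀ X ∈ aSub C b, Ad (expGL ((t * Complex.I : ℂ) • toComplex A)) (toComplex X) =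
        toComplex X := by
      intro X hX
      have h4 : ⁅(t * Complex.I : ℂ) • toComplex A, toComplex X⁆ = (0 : ℂ) • toComplex X := by
        rw [smul_lie_matrix, ← toComplex_lie, ← lie_skew, hcomm X hX]
        simp [toComplex_zero]
      rw [Ad_expGL_of_lie_eq_smul h4]; simp
    exact ⟨H, hcH, _, expGL_mem hG (Submodule.smul_mem _ _ (toComplex_mem_complexify h.mem_left)),
      hAd, mapsReal_of_eq (f := id) (f' := id) (fun X hX => ⟨hX, hfix X hX⟩)
        fun X hX => ⟨hX, hfix X hX⟩⟩

/-- The parabolic subalgebras attached to two generic elements of the same torus are conjugate. -/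
theorem exists_mem_map_qOf_eq (hG : IsZariskiClosedOverReal G) (hKG : K ≤ realPoints G)
    (hK : IsCompact (K : Set (GL (Fin n) ℝ))) {b : Submodule ℝ (Matrix (Fin n) (Fin n) ℝ)}
    (hb : IsTorusAlgebra (lieAlg K) b) {Y Y' : b} (hY : IsGeneric (gReal G).toSubmodule b Y)
    (hY' : IsGeneric (gReal G).toSubmodule b Y') :
    ∃ a ∈ G, MapsReal a (b : Set (Matrix (Fin n) (Fin n) ℝ)) b ∧
      MapsReal a (aSub C b) (aSub C b) ∧
      (qOf (gReal G).toSubmodule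
        (Complex.I • toComplex (Y : Matrix (Fin n) (Fin n) ℝ))).map (Ad a) =
      qOf (gReal G).toSubmodule (Complex.I • toComplex (Y' : Matrix (Fin n) (Fin n) ℝ)) := by
  obtain ⟨Y₁, ⟨a, ha, h1, h2, h3⟩, hs⟩ := exists_mem_chamber
    (finite_weights C hb.le hb.abelian)
    (fun Z Z' : b => ∃ a ∈ G, MapsReal a (b : Set (Matrix (Fin n) (Fin n) ℝ)) b ∧
      MapsReal a (aSub C b) (aSub C b) ∧
      Ad a (toComplex (Z : Matrix (Fin n) (Fin n) ℝ)) = toComplex (Z' : Matrix (Fin n) (Fin n) ℝ))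
    (fun Z => ⟨1, one_mem _, mapsReal_one _, mapsReal_one _, Ad_one _⟩)
    (by
      rintro Z Z' Z'' ⟨a, ha, h1, h2, h3⟩ ⟨a', ha', h1', h2', h3'⟩
      exact ⟨a' * a, mul_mem ha' ha, h1.trans h1', h2.trans h2', by rw [Ad_mul, h3, h3']⟩)
    (by
      intro c hw hc
      obtain ⟨H, hcH, a, ha, h1, h2⟩ := exists_mem_Ad_eq_refl (C := C) hG hKG hK hb hc hw
      refine ⟨H, hcH, fun β hβ => hβ.comp_of_Ad
        (fun X hX => Ad_mem_gComplex hG (inv_mem ha) hX) h1, fun Z => ⟨a, ha, ?_, h2, h1 Z⟩⟩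
      refine Set.Subset.antisymm ?_ ?_
      · rintro _ ⟨_, ⟨Z, hZ, rfl⟩, rfl⟩
        exact ⟨_, (refl c H ⟨Z, hZ⟩).2, (h1 ⟨Z, hZ⟩).symm⟩
      · rintro _ ⟨Z, hZ, rfl⟩
        exact ⟨_, ⟨_, (refl c H ⟨Z, hZ⟩).2, rfl⟩, by rw [h1, refl_refl hcH]⟩)
    (x := Y) (y := Y') hY hY'
  refine ⟨a, ha, h1, h2, ?_⟩
  rw [map_Ad_qOf (fun X hX => Ad_mem_gComplex hG ha hX)
    (fun X hX => Ad_mem_gComplex hG (inv_mem ha) hX), map_smul, h3]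
  exact qOf_eq_qOf C hb hs

/-- Any two triples are conjugate. -/
theorem TripleDatum.exists_carries (hG : IsZariskiClosedOverReal G) (hKG : K ≤ realPoints G)
    (hK : IsCompact (K : Set (GL (Fin n) ℝ))) {θ : gReal G →ₗ⁅ℝ⁆ gReal G}
    (hC : ∀ X : gReal G, C.theta X = θ X) (T T' : TripleDatum G K) :
    ∃ a ∈ G, TripleDatum.Carries θ a T T' := by
  have hb := T.isTorusAlgebra hK
  have hb' := T'.isTorusAlgebra hK
  obtain ⟨Y, hx, hY⟩ := T.exists_generic
  obtain ⟨Y', hx', hY'⟩ := T'.exists_generic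
  have hreal : ∀ {b : Submodule ℝ (Matrix (Fin n) (Fin n) ℝ)} {Y : b},
      IsTorusAlgebra (lieAlg K) b → IsGeneric (gReal G).toSubmodule b Y →
      ∀ X ∈ lieAlg K, ⁅(Y : Matrix (Fin n) (Fin n) ℝ), X⁆ = 0 → ∀ Z ∈ b, ⁅Z, X⁆ = 0 := by
    intro b Y hb hY X hX h Z hZ
    apply toComplex_injective
    rw [toComplex_lie, toComplex_zero]
    refine hY.lie_eq_zero C hb (toComplex_mem_complexify (C.le hX)) ?_ ⟨Z, hZ⟩
    rw [← toComplex_lie, h, toComplex_zero]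
  obtain ⟨h, hh, h1, h2⟩ := exists_conj_torus C hKG hK hb hb' Y.2 Y'.2 (hreal hb hY) (hreal hb' hY')
  have hhG := hKG hh.1
  -- the conjugate of the first generic element is generic
  let f : (lieAlg T.B).toSubmodule →ₗ[ℝ] (lieAlg T'.B).toSubmodule := (rAd h).restrict h1
  have hf : ∀ Z : (lieAlg T.B).toSubmodule,
      Ad (Matrix.GeneralLinearGroup.map (algebraMap ℝ ℂ) h)
        (toComplex (Z : Matrix (Fin n) (Fin n) ℝ)) = toComplex (f Z : (lieAlg T'.B).toSubmodule) :=
    fun Z => (toComplex_rAd h Z).symm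
  have hfY : IsGeneric (gReal G).toSubmodule (lieAlg T'.B).toSubmodule (f Y) := by
    intro c hc hc0
    refine hY _ (hc.comp_of_Ad (fun X hX => Ad_mem_gComplex hG (inv_mem hhG) hX) hf)
      fun h0 => hc0 ?_
    ext Z
    have h3 : f ⟨_, h2 Z Z.2⟩ = Z := Subtype.ext (rAd_rAd_inv h Z)
    rw [← h3]
    exact DFunLike.congr_fun h0 _
  obtain ⟨a, ha, h3, h4, h5⟩ := exists_mem_map_qOf_eq (C := C) hG hKG hK hb' hfY hY'
  have hA := (mapsReal_aSub hh h1 h2).trans h4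
  rw [← T.coe_aReal C hC, ← T'.coe_aReal C hC] at hA
  refine ⟨a * _, mul_mem ha hhG, hA.map_complexify, ((mapsReal_map h1 h2).trans h3).map_complexify,
    ?_, hA⟩
  have hmul : Ad (a * Matrix.GeneralLinearGroup.map (algebraMap ℝ ℂ) h) =
      Ad a ∘ₗ Ad (Matrix.GeneralLinearGroup.map (algebraMap ℝ ℂ) h) :=
    LinearMap.ext fun X => Ad_mul _ _ X
  rw [T.q_eq, T'.q_eq, hx, hx', hmul, Submodule.map_comp,
    map_Ad_qOf (fun X hX => Ad_mem_gComplex hG hhG hX)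
    (fun X hX => Ad_mem_gComplex hG (inv_mem hhG) hX), map_smul, hf, h5]

end Existence

end RealReductive

namespace RealReductive

/-! ### Regular functions on the general linear group -/

section Regular

open Filter Topology

attribute [local instance] LieRing.ofAssociativeRing

variable {n : ℕ}

/-- The algebra of functions on `GL(n, ℂ)` generated by the entries of a matrix and of its
inverse. -/
def regularFun (n : ℕ) : Subalgebra ℂ (GL (Fin n) ℂ → ℂ) :=
  Algebra.adjoin ℂ (Set.range (fun (ij : Fin n × Fin n) (g : GL (Fin n) ℂ) => g.val ij.1 ij.2) ∪
    Set.range (fun (ij : Fin n × Fin n) (g : GL (Fin n) ℂ) => g⁻¹.val ij.1 ij.2))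

theorem val_mem_regularFun (i j : Fin n) :
    (fun g : GL (Fin n) ℂ => g.val i j) ∈ regularFun n :=
  Algebra.subset_adjoin (Or.inl ⟨(i, j), rfl⟩)

theorem inv_val_mem_regularFun (i j : Fin n) :
    (fun g : GL (Fin n) ℂ => g⁻¹.val i j) ∈ regularFun n :=
  Algebra.subset_adjoin (Or.inr ⟨(i, j), rfl⟩)

theorem const_mem_regularFun (c : ℂ) : (fun _ : GL (Fin n) ℂ => c) ∈ regularFun n :=
  (regularFun n).algebraMap_mem c

theorem sum_mem_regularFun {ι : Type*} (s : Finset ι) {F : ι → GL (Fin n) ℂ → ℂ}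
    (h : ∀ i ∈ s, F i ∈ regularFun n) : (fun g => ∑ i ∈ s, F i g) ∈ regularFun n := by
  have := (regularFun n).sum_mem h
  rwa [Finset.sum_fn] at this

theorem mul_mem_regularFun {F F' : GL (Fin n) ℂ → ℂ} (h : F ∈ regularFun n)
    (h' : F' ∈ regularFun n) : (fun g => F g * F' g) ∈ regularFun n :=
  (regularFun n).mul_mem h h'

theorem Ad_apply_mem_regularFun (X : Matrix (Fin n) (Fin n) ℂ) (i j : Fin n) :
    (fun g : GL (Fin n) ℂ => Ad g X i j) ∈ regularFun n := by
  simp only [Ad_apply, Matrix.mul_apply]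
  exact sum_mem_regularFun _ fun k _ => mul_mem_regularFun (sum_mem_regularFun _ fun l _ =>
    mul_mem_regularFun (val_mem_regularFun _ _) (const_mem_regularFun _))
    (inv_val_mem_regularFun _ _)

theorem linearMap_Ad_mem_regularFun (φ : Matrix (Fin n) (Fin n) ℂ →ₗ[ℂ] ℂ)
    (X : Matrix (Fin n) (Fin n) ℂ) : (fun g : GL (Fin n) ℂ => φ (Ad g X)) ∈ regularFun n := by
  have h : ∀ g : GL (Fin n) ℂ, φ (Ad g X) =
      ∑ i, ∑ j, Ad g X i j * φ (Matrix.single i j 1) := by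
    intro g
    conv_lhs => rw [Matrix.matrix_eq_sum_single (Ad g X)]
    simp only [map_sum]
    refine Finset.sum_congr rfl fun i _ => Finset.sum_congr rfl fun j _ => ?_
    rw [← smul_eq_mul, ← map_smul, Matrix.smul_single, smul_eq_mul, mul_one]
  simp only [h]
  exact sum_mem_regularFun _ fun i _ => sum_mem_regularFun _ fun j _ =>
    mul_mem_regularFun (Ad_apply_mem_regularFun X i j) (const_mem_regularFun _)

/-- A regular function is a polynomial divided by a power of the determinant. -/
theorem exists_evS_eq_det_pow_mul {F : GL (Fin n) ℂ → ℂ} (hF : F ∈ regularFun n) :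
    ∃ (f : MvPolynomial (Fin n × Fin n) ℂ) (m : ℕ), ∀ g : GL (Fin n) ℂ,
      evS g.val f = g.val.det ^ m * F g := by
  have hdet : ∀ g : GL (Fin n) ℂ, evS g.val (genM n).det = g.val.det := fun g => by
    rw [AlgHom.map_det, AlgHom.mapMatrix_apply, map_genM]
  induction hF using Algebra.adjoin_induction with
  | mem F hF =>
    rcases hF with ⟨ij, rfl⟩ | ⟨ij, rfl⟩
    · exact ⟨genM n ij.1 ij.2, 0, fun g => by simp⟩
    · refine ⟨(genM n).adjugate ij.1 ij.2, 1, fun g => ?_⟩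
      have h1 : evS g.val ((genM n).adjugate ij.1 ij.2) = g.val.adjugate ij.1 ij.2 := by
        have := AlgHom.map_adjugate (evS g.val) (genM n)
        rw [AlgHom.mapMatrix_apply, AlgHom.mapMatrix_apply, map_genM] at this
        exact congrFun (congrFun this _) _
      have h2 : g.val.det ≠ 0 := ((Matrix.isUnit_iff_isUnit_det _).1 g.isUnit).ne_zero
      rw [h1]
      change _ = _ * (g⁻¹).val ij.1 ij.2
      rw [Matrix.coe_units_inv, Matrix.inv_def, pow_one, Matrix.smul_apply, smul_eq_mul,
        Ring.inverse_eq_inv', ← mul_assoc, mul_inv_cancel₀ h2, one_mul]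
  | algebraMap c => exact ⟨MvPolynomial.C c, 0, fun g => by simp [evS]⟩
  | add F F' _ _ h h' =>
    obtain ⟨f, m, h⟩ := h
    obtain ⟨f', m', h'⟩ := h'
    refine ⟨(genM n).det ^ m' * f + (genM n).det ^ m * f', m + m', fun g => ?_⟩
    rw [map_add, map_mul, map_mul, map_pow, map_pow, hdet, h, h', Pi.add_apply]
    ring
  | mul F F' _ _ h h' =>
    obtain ⟨f, m, h⟩ := h
    obtain ⟨f', m', h'⟩ := h'
    refine ⟨f * f', m + m', fun g => ?_⟩
    rw [map_mul, h, h', Pi.mul_apply]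
    ring

theorem differentiable_exp_add_smul_apply (X Z : Matrix (Fin n) (Fin n) ℂ) (i j : Fin n) :
    Differentiable ℂ fun s : ℂ => NormedSpace.exp (X + s • Z) i j := by
  let _ : NormedRing (Matrix (Fin n) (Fin n) ℂ) := Matrix.linftyOpNormedRing
  let _ : NormedAlgebra ℂ (Matrix (Fin n) (Fin n) ℂ) := Matrix.linftyOpNormedAlgebra
  intro s
  have h1 : DifferentiableAt ℂ (NormedSpace.exp : Matrix (Fin n) (Fin n) ℂ → _) (X + s • Z) :=
    (NormedSpace.exp_analytic (𝕂 := ℂ) (X + s • Z)).differentiableAt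
  have h2 : DifferentiableAt ℂ (fun s : ℂ => X + s • Z) s :=
    (differentiableAt_const X).add (differentiableAt_id.smul_const Z)
  have h3 : DifferentiableAt ℂ (fun s : ℂ => NormedSpace.exp (X + s • Z)) s := h1.comp s h2
  exact (LinearMap.toContinuousLinearMap
    (Matrix.entryLinearMap ℂ ℂ i j)).differentiableAt.comp s h3

/-- A regular function on a connected group that vanishes on the exponentials of an open subset
of the Lie algebra vanishes identically. -/
theorem eq_zero_of_eventually_expGL_eq_zero {G : Subgroup (GL (Fin n) ℂ)}
    (hG : IsZariskiClosedOverReal G) (hc : IsZariskiConnected G) {F : GL (Fin n) ℂ → ℂ}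
    (hF : F ∈ regularFun n) {x : Matrix (Fin n) (Fin n) ℂ} (hx : x ∈ gComplex G)
    (h : ∀ Z ∈ gComplex G, ∀ᶠ s : ℂ in 𝓝 0, F (expGL (x + s • Z)) = 0) {g : GL (Fin n) ℂ}
    (hg : g ∈ G) : F g = 0 := by
  obtain ⟨f, m, hf⟩ := exists_evS_eq_det_pow_mul hF
  have h2 : g.val.det ≠ 0 := ((Matrix.isUnit_iff_isUnit_det _).1 g.isUnit).ne_zero
  refine (mul_eq_zero.1 ((hf g).symm.trans ?_)).resolve_left (pow_ne_zero m h2)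
  refine evS_eq_zero_of_evS_exp_eq_zero hG hc (fun A hA => ?_) hg
  have hd : Differentiable ℂ fun s : ℂ => evS (NormedSpace.exp (x + s • (A - x))) f :=
    differentiable_evS (fun i j => differentiable_exp_add_smul_apply x (A - x) i j) f
  have h3 : (fun s : ℂ => evS (NormedSpace.exp (x + s • (A - x))) f) = fun _ => 0 := by
    refine AnalyticOnNhd.eq_of_eventuallyEq (z₀ := 0)
      (fun s _ => hd.analyticAt s) (fun s _ => analyticAt_const) ?_
    filter_upwards [h (A - x) (sub_mem hA hx)] with s hs
    have := hf (expGL (x + s • (A - x)))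
    rwa [hs, mul_zero, expGL_val] at this
  have h4 := congrFun h3 1
  rwa [one_smul, add_sub_cancel] at h4

end Regular

end RealReductive

namespace RealReductive

/-! ### The multiplicity of the eigenvalue one of the adjoint action -/

section LocalSurjectivity

open Filter Topology

/-- If `V = [V, x] + h`, then the conjugates of the elements of `h` under exponentials of elements
of `V` fill a neighbourhood of `x` in `V`. -/
theorem eventually_exists_exp_mul_mul_exp_neg {A : Type*} [NormedRing A] [NormedAlgebra ℂ A]
    [FiniteDimensional ℂ A] {V h : Submodule ℂ A} {x : A} (hx : x ∈ h) (hhV : h ≤ V)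
    (hexp : ∀ W ∈ V, ∀ H ∈ V, NormedSpace.exp W * H * NormedSpace.exp (-W) ∈ V)
    (hsurj : ∀ Z ∈ V, ∃ W ∈ V, ∃ H ∈ h, W * x - x * W + H = Z) {Z : A} (hZ : Z ∈ V) :
    ∀ᶠ s : ℂ in 𝓝 0, ∃ W ∈ V, ∃ H ∈ h,
      x + s • Z = NormedSpace.exp W * H * NormedSpace.exp (-W) := by
  have : CompleteSpace A := FiniteDimensional.complete ℂ A
  let _ : NormedAlgebra ℚ A := NormedAlgebra.restrictScalars ℚ ℂ A
  obtain ⟨P, hP⟩ := LinearMap.exists_leftInverse_of_injective V.subtype (Submodule.ker_subtype _)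
  have hP' : ∀ (X : A) (hX : X ∈ V), P X = ⟨X, hX⟩ := fun X hX => DFunLike.congr_fun hP ⟨X, hX⟩
  let fstL : V × h →L[ℂ] A := V.subtypeL.comp (ContinuousLinearMap.fst ℂ V h)
  let sndL : V × h →L[ℂ] A := h.subtypeL.comp (ContinuousLinearMap.snd ℂ V h)
  let a : V × h := (0, ⟨x, hx⟩)
  have h1 : HasStrictFDerivAt (fun p : V × h => NormedSpace.exp (fstL p)) fstL a := by
    have h0 : HasStrictFDerivAt (NormedSpace.exp : A → A) (1 : A →L[ℂ] A) (fstL a) := by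
      have : fstL a = 0 := rfl
      rw [this]
      exact hasStrictFDerivAt_exp_zero
    exact h0.comp a fstL.hasStrictFDerivAt
  have h2 : HasStrictFDerivAt (fun p : V × h => NormedSpace.exp (-fstL p)) (-fstL) a := by
    have h0 : HasStrictFDerivAt (NormedSpace.exp : A → A) (1 : A →L[ℂ] A) ((-fstL) a) := by
      have : (-fstL) a = 0 := neg_zero
      rw [this]
      exact hasStrictFDerivAt_exp_zero
    exact h0.comp a (-fstL).hasStrictFDerivAt
  have h3 := (h1.mul' sndL.hasStrictFDerivAt).mul' h2
  have h4 := (LinearMap.toContinuousLinearMap P).hasStrictFDerivAt.comp a h3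
  have h5 := h4.map_nhds_eq_of_surj (by
    rw [eq_top_iff]
    rintro Z -
    obtain ⟨W, hW, H, hH, e⟩ := hsurj Z Z.2
    refine ⟨(⟨W, hW⟩, ⟨H, hH⟩), ?_⟩
    rw [← Subtype.coe_eta Z Z.2, ← hP' Z Z.2, ← e]
    simp [a, fstL, sndL]
    abel)
  set F : V × h → V := fun p => LinearMap.toContinuousLinearMap P
    (((fun p => NormedSpace.exp (fstL p)) * ⇑sndL * fun p => NormedSpace.exp (-fstL p)) p) with hF
  have hFval : ∀ p : V × h, (F p : A) =
      NormedSpace.exp (p.1 : A) * (p.2 : A) * NormedSpace.exp (-(p.1 : A)) := fun p =>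
    congrArg Subtype.val (hP' _ (hexp _ p.1.2 _ (hhV p.2.2)))
  have hFa : F a = ⟨x, hhV hx⟩ := Subtype.ext ((hFval a).trans (by simp [a]))
  have h6 : ∀ᶠ v : V in 𝓝 (F a), ∃ W ∈ V, ∃ H ∈ h,
      (v : A) = NormedSpace.exp W * H * NormedSpace.exp (-W) :=
    h5 ▸ Filter.eventually_map.2 (Eventually.of_forall fun p =>
      ⟨p.1, p.1.2, p.2, p.2.2, hFval p⟩)
  have h7 : Continuous fun s : ℂ => (⟨x, hhV hx⟩ : V) + s • (⟨Z, hZ⟩ : V) := by fun_prop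
  have h8 := h7.tendsto 0
  rw [zero_smul, add_zero] at h8
  rw [hFa] at h6
  exact h8.eventually h6

end LocalSurjectivity

section Multiplicity

open Filter Topology Polynomial

attribute [local instance] LieRing.ofAssociativeRing

variable {n : ℕ}

/-- The conjugates of `h` under `G` contain all points near `x` on each line through `x` in the
complexified Lie algebra. -/
theorem eventually_exists_Ad_expGL {G : Subgroup (GL (Fin n) ℂ)} (hG : IsZariskiClosedOverReal G)
    {h : Submodule ℂ (Matrix (Fin n) (Fin n) ℂ)} {x : Matrix (Fin n) (Fin n) ℂ} (hx : x ∈ h)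
    (hh : h ≤ gComplex G) (hsurj : ∀ Z ∈ gComplex G, ∃ W ∈ gComplex G, ∃ H ∈ h, ⁅W, x⁆ + H = Z)
    {Z : Matrix (Fin n) (Fin n) ℂ} (hZ : Z ∈ gComplex G) :
    ∀ᶠ s : ℂ in 𝓝 0, ∃ y ∈ G, ∃ H ∈ h, x + s • Z = Ad y H := by
  let _ : NormedRing (Matrix (Fin n) (Fin n) ℂ) := Matrix.linftyOpNormedRing
  let _ : NormedAlgebra ℂ (Matrix (Fin n) (Fin n) ℂ) := Matrix.linftyOpNormedAlgebra
  have h1 := eventually_exists_exp_mul_mul_exp_neg (A := Matrix (Fin n) (Fin n) ℂ) hx hh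
    (fun W hW H hH => by
      have := Ad_mem_gComplex hG (expGL_mem hG hW) hH
      rwa [Ad_expGL] at this) hsurj hZ
  filter_upwards [h1] with s ⟨W, hW, H, hH, e⟩
  exact ⟨expGL W, expGL_mem hG hW, H, hH, e.trans (Ad_expGL W H).symm⟩

/-- The adjoint action of an element of `G` on the complexified Lie algebra. -/
noncomputable def adEnd {G : Subgroup (GL (Fin n) ℂ)} (hG : IsZariskiClosedOverReal G)
    {g : GL (Fin n) ℂ} (hg : g ∈ G) : Module.End ℂ (gComplex G) :=
  (Ad g).restrict fun _ hX => Ad_mem_gComplex hG hg hX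

theorem adEnd_apply {G : Subgroup (GL (Fin n) ℂ)} (hG : IsZariskiClosedOverReal G)
    {g : GL (Fin n) ℂ} (hg : g ∈ G) (X : gComplex G) :
    (adEnd hG hg X : Matrix (Fin n) (Fin n) ℂ) = Ad g X := rfl

/-- The multiplicity of the eigenvalue zero is read off from the characteristic polynomial. -/
theorem coeff_charpoly_eq_zero_iff {V : Type*} [AddCommGroup V] [Module ℂ V]
    [FiniteDimensional ℂ V] (T : Module.End ℂ V) (r : ℕ) :
    (∀ i < r, T.charpoly.coeff i = 0) ↔ r ≤ Module.finrank ℂ (T.maxGenEigenspace 0) := by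
  rw [LinearMap.finrank_maxGenEigenspace_zero_eq]
  constructor
  · exact fun h => le_natTrailingDegree T.charpoly_monic.ne_zero h
  · exact fun h i hi => coeff_eq_zero_of_lt_natTrailingDegree (hi.trans_le h)

/-- Each coefficient of the characteristic polynomial of `Ad g - 1` on the Lie algebra is the
restriction of a regular function. -/
theorem exists_regularFun_charpoly {G : Subgroup (GL (Fin n) ℂ)} (hG : IsZariskiClosedOverReal G)
    (i : ℕ) : ∃ F ∈ regularFun n, ∀ (g : GL (Fin n) ℂ) (hg : g ∈ G), F g =
      (adEnd hG hg - 1).charpoly.coeff i := by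
  let bas := Module.finBasis ℂ (gComplex G)
  obtain ⟨P, hP⟩ := LinearMap.exists_leftInverse_of_injective (gComplex G).subtype
    (Submodule.ker_subtype _)
  have hP' : ∀ X (hX : X ∈ gComplex G), P X = ⟨X, hX⟩ := fun X hX => DFunLike.congr_fun hP ⟨X, hX⟩
  let M₀ : Matrix (Fin (Module.finrank ℂ (gComplex G))) (Fin (Module.finrank ℂ (gComplex G)))
      (regularFun n) := Matrix.of (fun k l => ⟨fun g => bas.coord k (P (Ad g (bas l))),
        linearMap_Ad_mem_regularFun (bas.coord k ∘ₗ P) _⟩)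
  let ev : GL (Fin n) ℂ → regularFun n →+* ℂ := fun g =>
    (Pi.evalRingHom (fun _ => ℂ) g).comp (regularFun n).val.toRingHom
  refine ⟨((M₀ - 1).charpoly.coeff i : regularFun n), ((M₀ - 1).charpoly.coeff i).2, fun g hg => ?_⟩
  have h1 : (((M₀ - 1).charpoly.coeff i : regularFun n) : GL (Fin n) ℂ → ℂ) g =
    ev g ((M₀ - 1).charpoly.coeff i) := rfl
  rw [h1, ← coeff_map, ← Matrix.charpoly_map, ← LinearMap.charpoly_toMatrix _ bas]
  have h2 : LinearMap.toMatrix bas bas (adEnd hG hg - 1) =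
      LinearMap.toMatrix bas bas (adEnd hG hg) - 1 :=
    (map_sub (LinearMap.toMatrix bas bas) (adEnd hG hg) 1).trans
      (congrArg _ (LinearMap.toMatrix_one bas))
  have h3 : (M₀ - 1).map (ev g) = M₀.map (ev g) - 1 := by
    rw [← RingHom.mapMatrix_apply, map_sub, map_one, RingHom.mapMatrix_apply]
  rw [h3]
  refine Eq.trans ?_ (congrArg (fun N => (Matrix.charpoly N).coeff i) h2.symm)
  congr 3
  ext k l
  rw [LinearMap.toMatrix_apply]
  change bas.coord k (P (Ad g (bas l))) = _
  rw [hP' _ (Ad_mem_gComplex hG hg (bas l).2)]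
  rfl

/-- On a connected group, the multiplicity of the eigenvalue `1` of the adjoint action of any
element is at least the dimension of an abelian subalgebra `h` whose conjugates contain an open
set: the exponential of a conjugate of an element of `h` fixes a conjugate of `h`, and the
multiplicity is governed by the vanishing of regular functions. -/
theorem finrank_le_finrank_maxGenEigenspace {G : Subgroup (GL (Fin n) ℂ)}
    (hG : IsZariskiClosedOverReal G) (hc : IsZariskiConnected G)
    {h : Submodule ℂ (Matrix (Fin n) (Fin n) ℂ)} {x : Matrix (Fin n) (Fin n) ℂ} (hx : x ∈ h)
    (hh : h ≤ gComplex G) (habel : ∀ H ∈ h, ∀ H' ∈ h, ⁅H, H'⁆ = 0)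
    (hsurj : ∀ Z ∈ gComplex G, ∃ W ∈ gComplex G, ∃ H ∈ h, ⁅W, x⁆ + H = Z)
    {g : GL (Fin n) ℂ} (hg : g ∈ G) :
    Module.finrank ℂ h ≤ Module.finrank ℂ ((adEnd hG hg - 1).maxGenEigenspace 0) := by
  rw [← coeff_charpoly_eq_zero_iff]
  intro i hi
  obtain ⟨F, hF, hFg⟩ := exists_regularFun_charpoly hG i
  rw [← hFg g hg]
  refine eq_zero_of_eventually_expGL_eq_zero hG hc hF (hh hx) (fun Z hZ => ?_) hg
  filter_upwards [eventually_exists_Ad_expGL hG hx hh hsurj hZ] with s ⟨y, hy, H, hH, e⟩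
  rw [e]
  have hm : expGL (Ad y H) ∈ G := expGL_mem hG (Ad_mem_gComplex hG hy (hh hH))
  rw [hFg _ hm]
  refine (coeff_charpoly_eq_zero_iff _ _).2 ?_ i hi
  let f : h →ₗ[ℂ] gComplex G := (Ad y).restrict fun X hX => Ad_mem_gComplex hG hy (hh hX)
  have hf : Function.Injective f := fun X X' e => Subtype.ext
    (Ad_injective y (congrArg Subtype.val e))
  rw [← LinearMap.finrank_range_of_inj hf]
  refine Submodule.finrank_mono ?_
  rintro _ ⟨X, rfl⟩
  rw [Module.End.mem_maxGenEigenspace]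
  refine ⟨1, Subtype.ext ?_⟩
  have h1 : Ad (expGL (Ad y H)) (Ad y X) = Ad y X := by
    have h2 : ⁅Ad y H, Ad y X⁆ = (0 : ℂ) • Ad y X := by
      rw [← Ad_lie, habel H hH X X.2, map_zero, zero_smul]
    rw [Ad_expGL_of_lie_eq_smul h2, Complex.exp_zero, one_smul]
  rw [zero_smul, pow_one]
  change Ad (expGL (Ad y H)) (Ad y X) - Ad y X - 0 = 0
  rw [h1, sub_self, sub_zero]

end Multiplicity

end RealReductive

namespace RealReductive

/-! ### Unipotence from multiplicities -/

section Unipotence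

open Filter Topology

variable {V : Type*} [AddCommGroup V] [Module ℂ V] [FiniteDimensional ℂ V]

/-- If `E s` tends to zero, then `1` is eventually not an eigenvalue of `D ∘ E s`. -/
theorem eventually_eq_zero_of_contraction (D : Module.End ℂ V) (E : ℝ → Module.End ℂ V)
    (hE : Submodule.span ℂ {v | ∃ c : ℝ, c < 0 ∧ ∀ s : ℝ, E s v = (Real.exp (s * c) : ℂ) • v} = ⊤) :
    ∀ᶠ s in atTop, ∀ v, D (E s v) = v → v = 0 := by
  classical
  let b := Module.finBasis ℂ V
  have h1 : ∀ (i : Fin (Module.finrank ℂ V)) (v : V),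
      Tendsto (fun s : ℝ => b.repr (E s v) i) atTop (𝓝 0) := by
    intro i v
    have hv : v ∈ Submodule.span ℂ
        {v | ∃ c : ℝ, c < 0 ∧ ∀ s : ℝ, E s v = (Real.exp (s * c) : ℂ) • v} := hE ▸ trivial
    induction hv using Submodule.span_induction with
    | mem v hv =>
      obtain ⟨c, hc, hv⟩ := hv
      have h2 : Tendsto (fun s : ℝ => Real.exp (s * c)) atTop (𝓝 0) :=
        Real.tendsto_exp_atBot.comp (tendsto_id.atTop_mul_const_of_neg hc)
      have h3 : Tendsto (fun s : ℝ => (Real.exp (s * c) : ℂ)) atTop (𝓝 0) := by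
        exact_mod_cast (Complex.continuous_ofReal.tendsto 0).comp h2
      have h4 := h3.mul_const (b.repr v i)
      rw [zero_mul] at h4
      refine h4.congr fun s => ?_
      rw [hv, map_smul, Finsupp.smul_apply, smul_eq_mul]
    | zero => simp
    | add v w _ _ hv hw =>
      have := hv.add hw
      rw [add_zero] at this
      exact this.congr fun s => by rw [map_add, map_add, Finsupp.add_apply]
    | smul a v _ hv =>
      have := hv.const_mul a
      rw [mul_zero] at this
      exact this.congr fun s => by rw [map_smul, map_smul, Finsupp.smul_apply, smul_eq_mul]
  have h2 : Tendsto (fun s => LinearMap.toMatrix b b (E s)) atTop (𝓝 0) := by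
    refine tendsto_pi_nhds.2 fun i => tendsto_pi_nhds.2 fun j => ?_
    simp only [LinearMap.toMatrix_apply]
    exact h1 i (b j)
  have h3 : Tendsto (fun s => (1 - LinearMap.toMatrix b b D * LinearMap.toMatrix b b (E s)).det)
      atTop (𝓝 1) := by
    have hc : Continuous fun M : Matrix (Fin (Module.finrank ℂ V)) (Fin (Module.finrank ℂ V)) ℂ =>
      (1 - LinearMap.toMatrix b b D * M).det :=
      (continuous_const.sub (continuous_const.matrix_mul continuous_id)).matrix_det
    have := (hc.tendsto 0).comp h2
    rw [mul_zero, sub_zero, Matrix.det_one] at this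
    exact this
  filter_upwards [h3.eventually_ne one_ne_zero] with s hs v hv
  have h4 := Matrix.eq_zero_of_mulVec_eq_zero hs (v := b.repr v) (by
    rw [Matrix.sub_mulVec, Matrix.one_mulVec, ← Matrix.mulVec_mulVec,
      LinearMap.toMatrix_mulVec_repr, LinearMap.toMatrix_mulVec_repr, hv, sub_self])
  exact b.repr.map_eq_zero_iff.1 (Finsupp.ext (congrFun h4))

/-- Let `D` be an automorphism that preserves a filtration `n ≤ q ≤ V`, where `q = h ⊕ n`, and let
`E s` be a one-parameter group that expands `n`, contracts `V ⧸ q` and is trivial on `h`. If `1`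
is an eigenvalue of each `D ∘ E s` of multiplicity at least `dim h`, then `D` is unipotent on
`h`: for large `s`, the generalized eigenspace projects isomorphically to `q ⧸ n`. -/
theorem exists_pow_sub_one_apply_eq_zero {D D' : Module.End ℂ V} (hD : ∀ v, D' (D v) = v)
    {E : ℝ → Module.End ℂ V} (hE : ∀ s v, E (-s) (E s v) = v) {h n q : Submodule ℂ V}
    (hq : q ≤ h ⊔ n) (hhq : h ≤ q) (hnq : n ≤ q) (hhn : Disjoint h n)
    (hDh : ∀ v ∈ h, D v ∈ h) (hDn : ∀ v ∈ n, D v ∈ n) (hDq : ∀ v ∈ q, D v ∈ q)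
    (hDn' : ∀ v ∈ n, D' v ∈ n) (hEh : ∀ s, ∀ v ∈ h, E s v = v)
    {S : Set V} (hS : ∀ v ∈ S, ∃ c : ℝ, 0 < c ∧ ∀ s : ℝ, E s v = (Real.exp (s * c) : ℂ) • v)
    (hn : n = Submodule.span ℂ S)
    (hV : q ⊔ Submodule.span ℂ
      {v | ∃ c : ℝ, c < 0 ∧ ∀ s : ℝ, E s v = (Real.exp (s * c) : ℂ) • v} = ⊤)
    (hmult : ∀ s, Module.finrank ℂ h ≤ Module.finrank ℂ ((D * E s - 1).maxGenEigenspace 0))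
    {H : V} (hH : H ∈ h) : ∃ k : ℕ, ((D - 1) ^ k) H = 0 := by
  have hEn : ∀ s, ∀ v ∈ n, E s v ∈ n := by
    intro s v hv
    have : n ≤ n.comap (E s) := by
      conv_lhs => rw [hn]
      refine Submodule.span_le.2 ?_
      intro v hvS
      obtain ⟨c, hc, hv⟩ := hS v hvS
      rw [SetLike.mem_coe, Submodule.mem_comap, hv]
      exact Submodule.smul_mem _ _ (hn ▸ Submodule.subset_span hvS)
    exact this hv
  have hEq : ∀ s, ∀ v ∈ q, E s v ∈ q := by
    intro s v hv
    obtain ⟨a, ha, b, hb, rfl⟩ := Submodule.mem_sup.1 (hq hv)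
    rw [map_add, hEh s a ha]
    exact add_mem (hhq ha) (hnq (hEn s b hb))
  -- no eigenvalue one on `n`
  have hA : ∀ᶠ s in atTop, ∀ v ∈ n, D (E s v) = v → v = 0 := by
    have h1 := eventually_eq_zero_of_contraction (V := n) (D'.restrict hDn')
      (fun s => (E (-s)).restrict (hEn (-s))) (by
        rw [eq_top_iff]
        have h2 : Submodule.span ℂ ((↑) ⁻¹' S : Set n) = ⊤ := by
          subst hn
          exact Submodule.span_span_coe_preimage
        rw [← h2]
        refine Submodule.span_mono ?_
        intro v hvS
        obtain ⟨c, hc, hv⟩ := hS v hvS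
        refine ⟨-c, by linarith, fun s => Subtype.ext ?_⟩
        change E (-s) v = _
        rw [hv]
        simp)
    filter_upwards [h1] with s hs v hv hvT
    have h3 : E s v = D' v := by rw [← hD (E s v), hvT]
    have h4 := hs ⟨E s v, hEn s v hv⟩ (Subtype.ext (by
      change D' (E (-s) (E s v)) = E s v
      rw [hE, h3]))
    have h5 : E s v = 0 := congrArg Subtype.val h4
    rw [← hE s v, h5, map_zero]
  -- no eigenvalue one on `V ⧸ q`
  have hB : ∀ᶠ s in atTop, ∀ v, D (E s v) - v ∈ q → v ∈ q := by
    have h1 := eventually_eq_zero_of_contraction (V := V ⧸ q) (q.mapQ q D hDq)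
      (fun s => q.mapQ q (E s) (hEq s)) (by
        rw [eq_top_iff, ← q.range_mkQ, LinearMap.range_eq_map, ← hV, Submodule.map_sup,
          Submodule.map_span, q.mkQ_map_self, bot_sup_eq]
        refine Submodule.span_mono ?_
        rintro _ ⟨v, ⟨c, hc, hv⟩, rfl⟩
        refine ⟨c, hc, fun s => ?_⟩
        rw [Submodule.mkQ_apply, Submodule.mapQ_apply, hv]
        rfl)
    filter_upwards [h1] with s hs v hv
    rw [← Submodule.Quotient.mk_eq_zero]
    refine hs _ ?_
    rw [Submodule.mapQ_apply, Submodule.mapQ_apply]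
    exact (Submodule.Quotient.eq q).2 hv
  obtain ⟨s, hA, hB⟩ := (hA.and hB).exists
  set N : Module.End ℂ V := D * E s - 1 with hN
  have hNv : ∀ v, N v = D (E s v) - v := fun v => rfl
  have hmem : ∀ v, v ∈ N.maxGenEigenspace 0 ↔ ∃ k : ℕ, (N ^ k) v = 0 := fun v => by
    rw [Module.End.mem_maxGenEigenspace, zero_smul, sub_zero]
  have hWq : N.maxGenEigenspace 0 ≤ q := by
    intro v hv
    obtain ⟨k, hk⟩ := (hmem v).1 hv
    have : ∀ k : ℕ, ∀ v, (N ^ k) v ∈ q → v ∈ q := by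
      intro k
      induction k with
      | zero => intro v hv; simpa using hv
      | succ k ih =>
        intro v hv
        rw [pow_succ, Module.End.mul_apply] at hv
        exact hB v (hNv v ▸ ih _ hv)
    exact this k v (hk ▸ q.zero_mem)
  have hNn : ∀ v ∈ n, N v ∈ n := fun v hv => sub_mem (hDn _ (hEn s v hv)) hv
  have hWn : Disjoint (N.maxGenEigenspace 0) n := by
    rw [Submodule.disjoint_def]
    intro v hv
    obtain ⟨k, hk⟩ := (hmem v).1 hv
    clear hv
    induction k generalizing v with
    | zero => intro _; simpa using hk
    | succ k ih =>
      intro hvn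
      rw [pow_succ, Module.End.mul_apply] at hk
      exact hA v hvn (sub_eq_zero.1 (ih _ hk (hNn v hvn)))
  have hsup : N.maxGenEigenspace 0 ⊔ n = q := by
    refine Submodule.eq_of_le_of_finrank_le (sup_le hWq hnq) ?_
    have e1 := Submodule.finrank_sup_add_finrank_inf_eq (N.maxGenEigenspace 0) n
    rw [hWn.eq_bot, finrank_bot, add_zero] at e1
    have e2 := Submodule.finrank_add_le_finrank_add_finrank h n
    have e3 := Submodule.finrank_mono hq
    have e4 : _ ≤ Module.finrank ℂ (N.maxGenEigenspace 0) := hmult s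
    omega
  obtain ⟨w, hw, v, hv, e⟩ := Submodule.mem_sup.1 (hsup ▸ hhq hH)
  obtain ⟨k, hk⟩ := (hmem w).1 hw
  refine ⟨k, ?_⟩
  have h1 : (N ^ k) H ∈ n := by
    rw [← e, map_add, hk, zero_add]
    clear hk
    induction k with
    | zero => simpa using hv
    | succ k ih => rw [pow_succ', Module.End.mul_apply]; exact hNn _ ih
  have h2 : ∀ k : ℕ, (N ^ k) H = ((D - 1) ^ k) H ∧ (N ^ k) H ∈ h := by
    intro k
    induction k with
    | zero => exact ⟨rfl, by simpa using hH⟩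
    | succ k ih =>
      rw [pow_succ', pow_succ', Module.End.mul_apply, Module.End.mul_apply, ← ih.1, hNv,
        hEh s _ ih.2]
      exact ⟨rfl, sub_mem (hDh _ ih.2) ih.2⟩
  rw [← (h2 k).1]
  exact (Submodule.disjoint_def.1 hhn) _ (h2 k).2 h1

end Unipotence

end RealReductive

namespace RealReductive

/-! ### The invariant form on the complexification -/

section ComplexForm

open Filter Topology

attribute [local instance] LieRing.ofAssociativeRing

variable {n : ℕ}

/-- The complex-bilinear extension of a real bilinear form on matrices. -/
noncomputable def complexForm (B : LinearMap.BilinForm ℝ (Matrix (Fin n) (Fin n) ℝ)) :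
    LinearMap.BilinForm ℂ (Matrix (Fin n) (Fin n) ℂ) :=
  ∑ i, ∑ j, ∑ k, ∑ l, (B (Matrix.single i j 1) (Matrix.single k l 1) : ℂ) •
    (Matrix.entryLinearMap ℂ ℂ i j).smulRight (Matrix.entryLinearMap ℂ ℂ k l)

theorem complexForm_apply (B : LinearMap.BilinForm ℝ (Matrix (Fin n) (Fin n) ℝ))
    (X Z : Matrix (Fin n) (Fin n) ℂ) : complexForm B X Z =
      ∑ i, ∑ j, ∑ k, ∑ l, (B (Matrix.single i j 1) (Matrix.single k l 1) : ℂ) *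
        (X i j * Z k l) := by
  simp [complexForm, LinearMap.sum_apply]

theorem complexForm_toComplex (B : LinearMap.BilinForm ℝ (Matrix (Fin n) (Fin n) ℝ))
    (X Z : Matrix (Fin n) (Fin n) ℝ) : complexForm B (toComplex X) (toComplex Z) = B X Z := by
  have hs : ∀ {F : Type} [AddCommGroup F] [Module ℝ F] (φ : Matrix (Fin n) (Fin n) ℝ →ₗ[ℝ] F)
      (W : Matrix (Fin n) (Fin n) ℝ), φ W = ∑ i, ∑ j, W i j • φ (Matrix.single i j 1) := by
    intro F _ _ φ W
    conv_lhs => rw [Matrix.matrix_eq_sum_single W]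
    simp only [map_sum]
    refine Finset.sum_congr rfl fun i _ => Finset.sum_congr rfl fun j _ => ?_
    rw [← map_smul, Matrix.smul_single, smul_eq_mul, mul_one]
  have h1 : B X Z = ∑ i, ∑ j, ∑ k, ∑ l, B (Matrix.single i j 1) (Matrix.single k l 1) *
      (X i j * Z k l) := by
    rw [hs B X, LinearMap.sum_apply]
    refine Finset.sum_congr rfl fun i _ => ?_
    rw [LinearMap.sum_apply]
    refine Finset.sum_congr rfl fun j _ => ?_
    rw [LinearMap.smul_apply, hs (B _) Z, smul_eq_mul, Finset.mul_sum]
    refine Finset.sum_congr rfl fun k _ => ?_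
    rw [Finset.mul_sum]
    refine Finset.sum_congr rfl fun l _ => ?_
    rw [smul_eq_mul]
    ring
  rw [h1, complexForm_apply]
  push_cast
  rfl

variable {G : Subgroup (GL (Fin n) ℂ)} {k : LieSubalgebra ℝ (Matrix (Fin n) (Fin n) ℝ)}

/-- The complex-bilinear extension of the form is invariant under the complexified Lie algebra. -/
theorem complexForm_lie (C : CartanForm (gReal G) k) {A X Z : Matrix (Fin n) (Fin n) ℂ}
    (hA : A ∈ gComplex G) (hX : X ∈ gComplex G) (hZ : Z ∈ gComplex G) :
    complexForm C.form ⁅A, X⁆ Z + complexForm C.form X ⁅A, Z⁆ = 0 := by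
  have hreal : ∀ A ∈ gReal G, ∀ X ∈ gReal G, ∀ Z ∈ gReal G,
      complexForm C.form (toComplex ⁅A, X⁆) (toComplex Z) =
        -complexForm C.form (toComplex X) (toComplex ⁅A, Z⁆) := by
    intro A hA X hX Z hZ
    rw [complexForm_toComplex, complexForm_toComplex, ← lie_skew, map_neg, LinearMap.neg_apply,
      C.invariant X hX A hA Z hZ]
    push_cast
    rfl
  obtain ⟨hA1, hA2⟩ := mem_complexify_iff.1 hA
  obtain ⟨hX1, hX2⟩ := mem_complexify_iff.1 hX
  obtain ⟨hZ1, hZ2⟩ := mem_complexify_iff.1 hZ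
  rw [← toComplex_re_add_im A, ← toComplex_re_add_im X, ← toComplex_re_add_im Z]
  simp only [add_lie, lie_add, smul_lie_matrix, lie_smul_matrix, map_add, map_smul,
    LinearMap.add_apply, LinearMap.smul_apply, ← toComplex_lie, smul_eq_mul]
  rw [hreal _ hA1 _ hX1 _ hZ1, hreal _ hA1 _ hX1 _ hZ2, hreal _ hA1 _ hX2 _ hZ1,
    hreal _ hA1 _ hX2 _ hZ2, hreal _ hA2 _ hX1 _ hZ1, hreal _ hA2 _ hX1 _ hZ2,
    hreal _ hA2 _ hX2 _ hZ1, hreal _ hA2 _ hX2 _ hZ2]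
  ring

theorem complexForm_Ad_expGL (hG : IsZariskiClosedOverReal G) (C : CartanForm (gReal G) k)
    {A X Z : Matrix (Fin n) (Fin n) ℂ} (hA : A ∈ gComplex G) (hX : X ∈ gComplex G)
    (hZ : Z ∈ gComplex G) :
    complexForm C.form (Ad (expGL A) X) (Ad (expGL A) Z) = complexForm C.form X Z := by
  have hd : ∀ t : ℂ, HasDerivAt (fun t : ℂ =>
      complexForm C.form (Ad (expGL (t • A)) X) (Ad (expGL (t • A)) Z)) 0 t := by
    intro t
    have hX' := hasDerivAt_Ad_expGL A X t
    have hZ' := hasDerivAt_Ad_expGL A Z t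
    have ht : expGL (t • A) ∈ G := expGL_mem hG (Submodule.smul_mem _ _ hA)
    rw [← complexForm_lie C hA (Ad_mem_gComplex hG ht hX) (Ad_mem_gComplex hG ht hZ)]
    simp only [complexForm_apply]
    simp only [← Finset.sum_add_distrib]
    refine HasDerivAt.fun_sum fun i _ => HasDerivAt.fun_sum fun j _ => HasDerivAt.fun_sum fun k _ =>
      HasDerivAt.fun_sum fun l _ => ?_
    rw [← mul_add]
    exact ((hX'.linearMap_matrix (Matrix.entryLinearMap ℂ ℂ i j)).mul
      (hZ'.linearMap_matrix (Matrix.entryLinearMap ℂ ℂ k l))).const_mul _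
  have h1 := is_const_of_deriv_eq_zero (fun t => (hd t).differentiableAt)
    (fun t => (hd t).deriv) 1 0
  simpa only [one_smul, zero_smul, expGL_zero, Ad_one] using h1

/-- The extended form is invariant under the connected group `G`. -/
theorem complexForm_Ad (hG : IsZariskiClosedOverReal G) (hc : IsZariskiConnected G)
    (C : CartanForm (gReal G) k) {g : GL (Fin n) ℂ} (hg : g ∈ G)
    {X Z : Matrix (Fin n) (Fin n) ℂ} (hX : X ∈ gComplex G) (hZ : Z ∈ gComplex G) :
    complexForm C.form (Ad g X) (Ad g Z) = complexForm C.form X Z := by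
  have hF : (fun g : GL (Fin n) ℂ => complexForm C.form (Ad g X) (Ad g Z) -
      complexForm C.form X Z) ∈ regularFun n := by
    refine (regularFun n).sub_mem ?_ (const_mem_regularFun _)
    simp only [complexForm_apply]
    exact sum_mem_regularFun _ fun i _ => sum_mem_regularFun _ fun j _ =>
      sum_mem_regularFun _ fun k _ => sum_mem_regularFun _ fun l _ =>
        mul_mem_regularFun (const_mem_regularFun _) (mul_mem_regularFun
          (Ad_apply_mem_regularFun X i j) (Ad_apply_mem_regularFun Z k l))
  have h := eq_zero_of_eventually_expGL_eq_zero hG hc hF (Submodule.zero_mem _)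
    (fun W hW => Eventually.of_forall fun s => sub_eq_zero.2 (complexForm_Ad_expGL hG C
      (add_mem (Submodule.zero_mem _) (Submodule.smul_mem _ _ hW)) hX hZ)) hg
  exact sub_eq_zero.1 h

end ComplexForm

/-! ### The centralizer of the torus -/

section Centralizer

attribute [local instance] LieRing.ofAssociativeRing

variable {n : ℕ} {g k : LieSubalgebra ℝ (Matrix (Fin n) (Fin n) ℝ)}
  {b : Submodule ℝ (Matrix (Fin n) (Fin n) ℝ)}

/-- The elements of the complexification of `g` that commute with `x`. -/
noncomputable def centralizerOf (g : Submodule ℝ (Matrix (Fin n) (Fin n) ℝ))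
    (x : Matrix (Fin n) (Fin n) ℂ) : Submodule ℂ (Matrix (Fin n) (Fin n) ℂ) :=
  Module.End.eigenspace (LieAlgebra.ad ℂ (Matrix (Fin n) (Fin n) ℂ) x) 0 ⊓ complexify g

theorem mem_centralizerOf {g : Submodule ℝ (Matrix (Fin n) (Fin n) ℝ)}
    {x X : Matrix (Fin n) (Fin n) ℂ} :
    X ∈ centralizerOf g x ↔ ⁅x, X⁆ = 0 ∧ X ∈ complexify g := by
  rw [centralizerOf, Submodule.mem_inf, mem_eigenspace_ad, zero_smul]

/-- The sum of an element centralizing the torus and its image under the Cartan involution lies in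
the torus. -/
theorem add_theta_mem_of_centralizes (C : CartanForm g k) (hb : IsTorusAlgebra k b)
    {Z : Matrix (Fin n) (Fin n) ℝ} (hZ : Z ∈ g) (h : ∀ Y ∈ b, ⁅Y, Z⁆ = 0) :
    Z + C.theta Z ∈ b := by
  refine hb.mem_of_centralizes _ (C.half_add_theta_mem hZ) fun Y hY => ?_
  rw [lie_add, h Y hY, ← C.theta_lie_of_mem (hb.le Y hY) hZ, h Y hY, map_zero, add_zero]

/-- The centralizer of the torus is abelian: the bracket of two elements lies in the torus and is
orthogonal to it. -/
theorem lie_eq_zero_of_centralizes (C : CartanForm g k) (hb : IsTorusAlgebra k b)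
    {Z Z' : Matrix (Fin n) (Fin n) ℝ} (hZ : Z ∈ g) (h : ∀ Y ∈ b, ⁅Y, Z⁆ = 0) (hZ' : Z' ∈ g)
    (h' : ∀ Y ∈ b, ⁅Y, Z'⁆ = 0) : ⁅Z, Z'⁆ = 0 := by
  -- the bracket equals that of the components in the `-1` eigenspace, up to sign
  have h1 : ⁅C.theta Z, Z'⁆ = -⁅Z, Z'⁆ := by
    have := h' _ (add_theta_mem_of_centralizes C hb hZ h)
    rw [add_lie] at this
    exact (neg_eq_of_add_eq_zero_right this).symm
  have h2 : ∀ Y ∈ b, ⁅Y, C.theta Z⁆ = 0 := fun Y hY => by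
    rw [← C.theta_lie_of_mem (hb.le Y hY) hZ, h Y hY, map_zero]
  have h3 : ⁅C.theta Z, C.theta Z'⁆ = ⁅Z, Z'⁆ := by
    have := h2 _ (add_theta_mem_of_centralizes C hb hZ' h')
    rw [← lie_skew, neg_eq_zero, lie_add, h1] at this
    exact (neg_add_eq_zero.1 this).symm
  have hk : ⁅Z, Z'⁆ ∈ k := by
    rw [← C.fixed_iff _ (g.lie_mem hZ hZ'), C.theta_lie Z hZ Z' hZ', h3]
  have hbb : ⁅Z, Z'⁆ ∈ b := hb.mem_of_centralizes _ hk fun Y hY => by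
    rw [leibniz_lie, h Y hY, h' Y hY, zero_lie, lie_zero, add_zero]
  by_contra hne
  refine (C.form_neg hk hne).ne ?_
  rw [C.invariant Z hZ Z' hZ' _ (C.le hk), ← lie_skew, h' _ hbb, neg_zero, map_zero]

variable {Y : b}

/-- The real and imaginary parts of a matrix commuting with a generic element centralize the torus. -/
theorem centralizes_of_mem_centralizerOf (C : CartanForm g k) (hb : IsTorusAlgebra k b)
    (hY : IsGeneric g.toSubmodule b Y) {X : Matrix (Fin n) (Fin n) ℂ}
    (hX : X ∈ centralizerOf g.toSubmodule
      (Complex.I • toComplex (Y : Matrix (Fin n) (Fin n) ℝ))) :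
    (reM X ∈ g ∧ ∀ Z ∈ b, ⁅Z, reM X⁆ = 0) ∧ (imM X ∈ g ∧ ∀ Z ∈ b, ⁅Z, imM X⁆ = 0) := by
  rw [mem_centralizerOf, smul_lie_matrix] at hX
  obtain ⟨h1, h2⟩ := mem_complexify_iff.1 hX.2
  have h3 : ∀ Z ∈ b, ⁅toComplex Z, X⁆ = 0 := fun Z hZ => hY.lie_eq_zero C hb hX.2
    ((smul_eq_zero.1 hX.1).resolve_left Complex.I_ne_zero) ⟨Z, hZ⟩
  exact ⟨⟨h1, fun Z hZ => by rw [← reM_lie_toComplex, h3 Z hZ, map_zero]⟩,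
    ⟨h2, fun Z hZ => by rw [← imM_lie_toComplex, h3 Z hZ, map_zero]⟩⟩

/-- The centralizer of a generic element is abelian. -/
theorem lie_eq_zero_of_mem_centralizerOf (C : CartanForm g k) (hb : IsTorusAlgebra k b)
    (hY : IsGeneric g.toSubmodule b Y) {X X' : Matrix (Fin n) (Fin n) ℂ}
    (hX : X ∈ centralizerOf g.toSubmodule
      (Complex.I • toComplex (Y : Matrix (Fin n) (Fin n) ℝ)))
    (hX' : X' ∈ centralizerOf g.toSubmodule
      (Complex.I • toComplex (Y : Matrix (Fin n) (Fin n) ℝ))) : ⁅X, X'⁆ = 0 := by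
  obtain ⟨⟨h1, h2⟩, h3, h4⟩ := centralizes_of_mem_centralizerOf C hb hY hX
  obtain ⟨⟨h1', h2'⟩, h3', h4'⟩ := centralizes_of_mem_centralizerOf C hb hY hX'
  rw [← toComplex_re_add_im X, ← toComplex_re_add_im X']
  simp only [add_lie, lie_add, smul_lie_matrix, lie_smul_matrix, ← toComplex_lie]
  rw [lie_eq_zero_of_centralizes C hb h1 h2 h1' h2', lie_eq_zero_of_centralizes C hb h1 h2 h3' h4',
    lie_eq_zero_of_centralizes C hb h3 h4 h1' h2', lie_eq_zero_of_centralizes C hb h3 h4 h3' h4']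
  simp [toComplex_zero]

end Centralizer

end RealReductive

namespace RealReductive

/-! ### Uniqueness of the induced isomorphism -/

section Uniqueness

attribute [local instance] LieRing.ofAssociativeRing

variable {n : ℕ} {G : Subgroup (GL (Fin n) ℂ)} {x : Matrix (Fin n) (Fin n) ℂ}

/-- The sum of the eigenspaces of `ad x` with positive eigenvalue. -/
noncomputable def posSub (G : Subgroup (GL (Fin n) ℂ)) (x : Matrix (Fin n) (Fin n) ℂ) :
    Submodule ℂ (gComplex G) :=
  Submodule.span ℂ {v | ∃ c : ℝ, 0 < c ∧ ⁅x, (v : Matrix (Fin n) (Fin n) ℂ)⁆ =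
    (c : ℂ) • (v : Matrix (Fin n) (Fin n) ℂ)}

theorem mk_mem_posSub {X : Matrix (Fin n) (Fin n) ℂ} (hX : X ∈ gComplex G) {c : ℝ} (hc : 0 < c)
    (h : ⁅x, X⁆ = (c : ℂ) • X) : (⟨X, hX⟩ : gComplex G) ∈ posSub G x :=
  Submodule.subset_span ⟨c, hc, h⟩

/-- The positive part consists of the brackets of the centralizer with the parabolic subalgebra. -/
theorem lie_mem_posSub {H X : Matrix (Fin n) (Fin n) ℂ}
    (habel : ∀ H ∈ centralizerOf (gReal G).toSubmodule x,
      ∀ H' ∈ centralizerOf (gReal G).toSubmodule x, ⁅H, H'⁆ = 0)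
    (hH : H ∈ centralizerOf (gReal G).toSubmodule x) (hX : X ∈ qOf (gReal G).toSubmodule x) :
    ⁅H, X⁆ ∈ (posSub G x).map (gComplex G).subtype := by
  have h1 : qOf (gReal G).toSubmodule x ≤ ((posSub G x).map (gComplex G).subtype).comap
      (LieAlgebra.ad ℂ (Matrix (Fin n) (Fin n) ℂ) H) := by
    refine iSup₂_le fun c hc X hX => ?_
    obtain ⟨hX1, hX2⟩ := hX
    rw [SetLike.mem_coe, mem_eigenspace_ad] at hX1
    rw [Submodule.mem_comap, LieAlgebra.ad_apply]
    rcases hc.eq_or_lt with rfl | hc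
    · rw [habel H hH X (mem_centralizerOf.2 ⟨by simpa using hX1, hX2⟩)]
      exact Submodule.zero_mem _
    · obtain ⟨hH1, hH2⟩ := mem_centralizerOf.1 hH
      have h2 : ⁅H, X⁆ ∈ gComplex G := lie_mem_complexify
        (fun _ h1 _ h2 => (gReal G).lie_mem h1 h2) hH2 hX2
      refine ⟨⟨_, h2⟩, mk_mem_posSub h2 hc ?_, rfl⟩
      rw [leibniz_lie, hH1, zero_lie, zero_add, hX1, lie_smul_matrix]
  exact h1 hX

/-- The positive part is stable under every element of `G` that preserves `q` and the centralizer. -/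
theorem Ad_mem_posSub (hG : IsZariskiClosedOverReal G)
    (habel : ∀ H ∈ centralizerOf (gReal G).toSubmodule x,
      ∀ H' ∈ centralizerOf (gReal G).toSubmodule x, ⁅H, H'⁆ = 0)
    (hx : x ∈ gComplex G) {g : GL (Fin n) ℂ} (hg : g ∈ G)
    (hh : ∀ X ∈ centralizerOf (gReal G).toSubmodule x,
      Ad g X ∈ centralizerOf (gReal G).toSubmodule x)
    (hq : ∀ X ∈ qOf (gReal G).toSubmodule x, Ad g X ∈ qOf (gReal G).toSubmodule x)
    {v : gComplex G} (hv : v ∈ posSub G x) : adEnd hG hg v ∈ posSub G x := by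
  have h1 : posSub G x ≤ (posSub G x).comap (adEnd hG hg) := by
    refine Submodule.span_le.2 ?_
    rintro v ⟨c, hc, hv⟩
    have h2 := lie_mem_posSub habel (hh x (mem_centralizerOf.2 ⟨lie_self x, hx⟩))
      (hq v (mem_qOf hc.le hv v.2))
    rw [← Ad_lie, hv, map_smul] at h2
    obtain ⟨w, hw, e⟩ := h2
    have h3 : w = (c : ℂ) • adEnd hG hg v := Subtype.ext e
    have hc0 : (c : ℂ) ≠ 0 := by exact_mod_cast hc.ne'
    have h4 : adEnd hG hg v = (c : ℂ)⁻¹ • w := by rw [h3, smul_smul, inv_mul_cancel₀ hc0, one_smul]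
    rw [SetLike.mem_coe, Submodule.mem_comap, h4]
    exact Submodule.smul_mem _ _ hw
  exact h1 hv

theorem qOf_le_sup : (qOf (gReal G).toSubmodule x).comap (gComplex G).subtype ≤
    (centralizerOf (gReal G).toSubmodule x).comap (gComplex G).subtype ⊔ posSub G x := by
  have h1 : qOf (gReal G).toSubmodule x ≤
      ((centralizerOf (gReal G).toSubmodule x).comap (gComplex G).subtype ⊔ posSub G x).map
        (gComplex G).subtype := by
    refine iSup₂_le fun c hc X hX => ?_
    obtain ⟨hX1, hX2⟩ := hX
    rw [SetLike.mem_coe, mem_eigenspace_ad] at hX1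
    refine ⟨⟨X, hX2⟩, ?_, rfl⟩
    rcases hc.eq_or_lt with rfl | hc
    · exact Submodule.mem_sup_left (mem_centralizerOf.2 ⟨by simpa using hX1, hX2⟩)
    · exact Submodule.mem_sup_right (mk_mem_posSub hX2 hc hX1)
  intro v hv
  obtain ⟨w, hw, e⟩ := h1 hv
  rwa [← Subtype.ext e]

theorem posSub_le_qOf : posSub G x ≤ (qOf (gReal G).toSubmodule x).comap (gComplex G).subtype := by
  refine Submodule.span_le.2 ?_
  rintro v ⟨c, hc, hv⟩
  exact mem_qOf hc.le hv v.2

theorem disjoint_posSub :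
    Disjoint ((centralizerOf (gReal G).toSubmodule x).comap (gComplex G).subtype)
      (posSub G x) := by
  rw [Submodule.disjoint_def]
  intro v hv1 hv2
  have h1 : posSub G x ≤ (⨆ (c : ℂ) (_ : c ≠ 0), Module.End.eigenspace
      (LieAlgebra.ad ℂ (Matrix (Fin n) (Fin n) ℂ) x) c).comap (gComplex G).subtype := by
    refine Submodule.span_le.2 ?_
    rintro v ⟨c, hc, hv⟩
    exact Submodule.mem_iSup_of_mem (c : ℂ) (Submodule.mem_iSup_of_mem
      (by exact_mod_cast hc.ne') (mem_eigenspace_ad.2 hv))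
  exact Subtype.ext ((Submodule.disjoint_def.1 (Module.End.eigenspaces_iSupIndep
    (LieAlgebra.ad ℂ (Matrix (Fin n) (Fin n) ℂ) x) 0)) v hv1.1 (h1 hv2))

section Generic

variable {k : LieSubalgebra ℝ (Matrix (Fin n) (Fin n) ℝ)}
  {b : Submodule ℝ (Matrix (Fin n) (Fin n) ℝ)} {Y : b}

/-- The action of an element `i Y` of `i b` on the complexification of `g` is diagonalizable with
real eigenvalues. -/
theorem mem_span_real_eigenvectors (C : CartanForm (gReal G) k) (hb : IsTorusAlgebra k b)
    {Z : Matrix (Fin n) (Fin n) ℂ} (hZ : Z ∈ gComplex G) :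
    Z ∈ Submodule.span ℂ {X | X ∈ gComplex G ∧ ∃ c : ℝ,
      ⁅Complex.I • toComplex (Y : Matrix (Fin n) (Fin n) ℝ), X⁆ = (c : ℂ) • X} := by
  refine Submodule.span_mono ?_ (mem_span_weight_vectors C hb.le hb.abelian (W := gComplex G)
    le_rfl (fun Y hY X hX => C.lie_toComplex_mem (hb.le Y hY) hX) hZ)
  rintro X ⟨hX, c, hc⟩
  refine ⟨hX, -c Y, ?_⟩
  rw [smul_lie_matrix, hc, smul_smul, ← mul_assoc, Complex.I_mul_I]
  congr 1
  push_cast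
  ring

/-- The complexified Lie algebra is the sum of the centralizer and the image of `ad x`. -/
theorem exists_lie_add_eq (C : CartanForm (gReal G) k) (hb : IsTorusAlgebra k b)
    {Z : Matrix (Fin n) (Fin n) ℂ} (hZ : Z ∈ gComplex G) :
    ∃ W ∈ gComplex G, ∃ H ∈ centralizerOf (gReal G).toSubmodule
      (Complex.I • toComplex (Y : Matrix (Fin n) (Fin n) ℝ)),
      ⁅W, Complex.I • toComplex (Y : Matrix (Fin n) (Fin n) ℝ)⁆ + H = Z := by
  set x := Complex.I • toComplex (Y : Matrix (Fin n) (Fin n) ℝ) with hx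
  have h1 : Z ∈ (gComplex G).map (LieAlgebra.ad ℂ (Matrix (Fin n) (Fin n) ℂ) x) ⊔
      centralizerOf (gReal G).toSubmodule x := by
    refine Submodule.span_le.2 ?_ (mem_span_real_eigenvectors (Y := Y) C hb hZ)
    rintro X ⟨hX, c, hc⟩
    by_cases h0 : c = 0
    · exact Submodule.mem_sup_right (mem_centralizerOf.2 ⟨by rw [hc, h0]; simp, hX⟩)
    · refine Submodule.mem_sup_left ⟨(c : ℂ)⁻¹ • X, Submodule.smul_mem _ _ hX, ?_⟩
      have hc0 : (c : ℂ) ≠ 0 := by exact_mod_cast h0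
      rw [LieAlgebra.ad_apply, lie_smul_matrix, hc, smul_smul, inv_mul_cancel₀ hc0, one_smul]
  obtain ⟨_, ⟨W, hW, rfl⟩, H, hH, e⟩ := Submodule.mem_sup.1 h1
  refine ⟨-W, neg_mem hW, H, hH, ?_⟩
  rw [← e, neg_lie, lie_skew, LieAlgebra.ad_apply]

/-- An element of `G` whose adjoint action preserves `q` and the centralizer of the torus acts
unipotently on the latter. -/
theorem exists_pow_adEnd_sub_one_eq_zero (hG : IsZariskiClosedOverReal G)
    (hc : IsZariskiConnected G) (C : CartanForm (gReal G) k) (hb : IsTorusAlgebra k b)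
    (hY : IsGeneric (gReal G).toSubmodule b Y)
    (hx : x = Complex.I • toComplex (Y : Matrix (Fin n) (Fin n) ℝ))
    {g : GL (Fin n) ℂ} (hg : g ∈ G)
    (hh : ∀ X ∈ centralizerOf (gReal G).toSubmodule x,
      Ad g X ∈ centralizerOf (gReal G).toSubmodule x)
    (hh' : ∀ X ∈ centralizerOf (gReal G).toSubmodule x,
      Ad g⁻¹ X ∈ centralizerOf (gReal G).toSubmodule x)
    (hq : ∀ X ∈ qOf (gReal G).toSubmodule x, Ad g X ∈ qOf (gReal G).toSubmodule x)
    (hq' : ∀ X ∈ qOf (gReal G).toSubmodule x, Ad g⁻¹ X ∈ qOf (gReal G).toSubmodule x)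
    {H : gComplex G} (hH : (H : Matrix (Fin n) (Fin n) ℂ) ∈ centralizerOf (gReal G).toSubmodule x) :
    ∃ m : ℕ, ((adEnd hG hg - 1) ^ m) H = 0 := by
  have habel : ∀ H ∈ centralizerOf (gReal G).toSubmodule x,
      ∀ H' ∈ centralizerOf (gReal G).toSubmodule x, ⁅H, H'⁆ = 0 := fun H hH H' hH' => by
    rw [hx] at hH hH'
    exact lie_eq_zero_of_mem_centralizerOf C hb hY hH hH'
  have hxg : x ∈ gComplex G := by
    rw [hx]
    exact Submodule.smul_mem _ _ (toComplex_mem_complexify (C.le (hb.le _ Y.2)))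
  have hxh : x ∈ centralizerOf (gReal G).toSubmodule x := mem_centralizerOf.2 ⟨lie_self x, hxg⟩
  have hsm : ∀ s : ℝ, expGL ((s : ℂ) • x) ∈ G := fun s =>
    expGL_mem hG (Submodule.smul_mem _ _ hxg)
  let E : ℝ → Module.End ℂ (gComplex G) := fun s => adEnd hG (hsm s)
  have hE : ∀ (s : ℝ) (v : gComplex G) (c : ℝ), ⁅x, (v : Matrix (Fin n) (Fin n) ℂ)⁆ =
      (c : ℂ) • (v : Matrix (Fin n) (Fin n) ℂ) → E s v = (Real.exp (s * c) : ℂ) • v := by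
    intro s v c h
    refine Subtype.ext ?_
    have h1 : ⁅(s : ℂ) • x, (v : Matrix (Fin n) (Fin n) ℂ)⁆ =
        (s * c : ℂ) • (v : Matrix (Fin n) (Fin n) ℂ) := by rw [smul_lie_matrix, h, smul_smul]
    rw [adEnd_apply, Ad_expGL_of_lie_eq_smul h1]
    push_cast
    rfl
  refine exists_pow_sub_one_apply_eq_zero (D := adEnd hG hg) (D' := adEnd hG (inv_mem hg))
    (fun v => Subtype.ext (Ad_inv_Ad g v)) (E := E) (fun s v => Subtype.ext ?_)
    (h := (centralizerOf (gReal G).toSubmodule x).comap (gComplex G).subtype)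
    (n := posSub G x) (q := (qOf (gReal G).toSubmodule x).comap (gComplex G).subtype)
    qOf_le_sup ?_ posSub_le_qOf disjoint_posSub (fun v hv => hh v hv)
    (fun v hv => Ad_mem_posSub hG habel hxg hg hh hq hv) (fun v hv => hq v hv)
    (fun v hv => Ad_mem_posSub hG habel hxg (inv_mem hg) hh' hq' hv) (fun s v hv => ?_)
    (S := {v | ∃ c : ℝ, 0 < c ∧ ⁅x, (v : Matrix (Fin n) (Fin n) ℂ)⁆ =
      (c : ℂ) • (v : Matrix (Fin n) (Fin n) ℂ)})
    (fun v ⟨c, hc, hv⟩ => ⟨c, hc, fun s => hE s v c hv⟩) rfl ?_ (fun s => ?_) hH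
  · change Ad (expGL (((-s : ℝ) : ℂ) • x)) (Ad (expGL ((s : ℂ) • x)) v) = v
    rw [Complex.ofReal_neg, neg_smul, ← expGL_inv, Ad_inv_Ad]
  · intro v hv
    exact mem_qOf le_rfl (by simpa using (mem_centralizerOf.1 hv).1) v.2
  · have := hE s v 0 (by simpa using (mem_centralizerOf.1 hv).1)
    simpa using this
  · rw [eq_top_iff]
    intro v _
    have h1 : (v : Matrix (Fin n) (Fin n) ℂ) ∈
        ((qOf (gReal G).toSubmodule x).comap (gComplex G).subtype ⊔ Submodule.span ℂ
          {v | ∃ c : ℝ, c < 0 ∧ ∀ s : ℝ, E s v = (Real.exp (s * c) : ℂ) • v}).map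
          (gComplex G).subtype := by
      refine Submodule.span_le.2 ?_ (mem_span_real_eigenvectors (Y := Y) C hb v.2)
      rintro X ⟨hX, c, hXc⟩
      rw [← hx] at hXc
      refine ⟨⟨X, hX⟩, ?_, rfl⟩
      rcases le_or_gt 0 c with h0 | h0
      · exact Submodule.mem_sup_left (mem_qOf h0 hXc hX)
      · exact Submodule.mem_sup_right (Submodule.subset_span ⟨c, h0, fun s => hE s _ c hXc⟩)
    obtain ⟨w, hw, e⟩ := h1
    rwa [← Subtype.ext e]
  · have h1 := finrank_le_finrank_maxGenEigenspace hG hc hxh inf_le_right habel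
      (fun Z hZ => by
        rw [hx]
        exact exists_lie_add_eq C hb hZ) (mul_mem hg (hsm s))
    have h2 : adEnd hG (mul_mem hg (hsm s)) = adEnd hG hg * E s :=
      LinearMap.ext fun v => Subtype.ext (Ad_mul _ _ _)
    rw [h2] at h1
    exact (Submodule.comapSubtypeEquivOfLe inf_le_right).finrank_eq.trans_le h1

end Generic

end Uniqueness

end RealReductive

namespace RealReductive

/-! ### Elements carrying a triple to itself -/

section Carries

attribute [local instance] LieRing.ofAssociativeRing

variable {n : ℕ} {G : Subgroup (GL (Fin n) ℂ)} {K : Subgroup (GL (Fin n) ℝ)}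
  {θ : gReal G →ₗ⁅ℝ⁆ gReal G}

theorem map_Ad_mul (g g' : GL (Fin n) ℂ) (W : Submodule ℂ (Matrix (Fin n) (Fin n) ℂ)) :
    W.map (Ad (g * g')) = (W.map (Ad g')).map (Ad g) := by
  rw [← Submodule.map_comp]
  congr 1
  exact LinearMap.ext fun X => Ad_mul g g' X

theorem map_Ad_inv_eq {g : GL (Fin n) ℂ} {W W' : Submodule ℂ (Matrix (Fin n) (Fin n) ℂ)}
    (h : W.map (Ad g) = W') : W'.map (Ad g⁻¹) = W := by
  rw [← h, ← map_Ad_mul, inv_mul_cancel]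
  ext X
  simp [Ad_one]

namespace TripleDatum

theorem Carries.trans {g g' : GL (Fin n) ℂ} {T T' T'' : TripleDatum G K}
    (h : Carries θ g T T') (h' : Carries θ g' T' T'') : Carries θ (g' * g) T T'' where
  map_a := by rw [map_Ad_mul, h.map_a, h'.map_a]
  map_b := by rw [map_Ad_mul, h.map_b, h'.map_b]
  map_q := by rw [map_Ad_mul, h.map_q, h'.map_q]
  map_aReal := MapsReal.trans h.map_aReal h'.map_aReal

theorem Carries.inv {g : GL (Fin n) ℂ} {T T' : TripleDatum G K} (h : Carries θ g T T') :
    Carries θ g⁻¹ T' T where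
  map_a := map_Ad_inv_eq h.map_a
  map_b := map_Ad_inv_eq h.map_b
  map_q := map_Ad_inv_eq h.map_q
  map_aReal := by
    rw [← h.map_aReal, Set.image_image]
    simp only [Ad_inv_Ad, Set.image_id']

variable {C : CartanForm (gReal G) (lieAlg K)}

theorem mem_aReal_iff (hC : ∀ X : gReal G, C.theta X = θ X) (T : TripleDatum G K)
    {X : Matrix (Fin n) (Fin n) ℝ} : X ∈ T.aReal θ ↔
      X ∈ gReal G ∧ (∀ Y ∈ lieAlg T.B, ⁅Y, X⁆ = 0) ∧ C.theta X = -X := by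
  rw [← SetLike.mem_coe, T.coe_aReal C hC]
  rfl

/-- The centralizer of the generic element of a triple is spanned by the torus and `a`. -/
theorem centralizerOf_x (hK : IsCompact (K : Set (GL (Fin n) ℝ)))
    (hC : ∀ X : gReal G, C.theta X = θ X) (T : TripleDatum G K) :
    centralizerOf (gReal G).toSubmodule (T.x : Matrix (Fin n) (Fin n) ℂ) = T.b ⊔ T.a θ := by
  have hb := T.isTorusAlgebra hK
  obtain ⟨Y, hx, hY⟩ := T.exists_generic
  rw [hx]
  refine le_antisymm (fun X hX => ?_) (sup_le ?_ ?_)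
  · have key : ∀ Z, Z ∈ gReal G ∧ (∀ W ∈ (lieAlg T.B).toSubmodule, ⁅W, Z⁆ = 0) →
        toComplex Z ∈ T.b ⊔ T.a θ := by
      rintro Z ⟨hZ, hZb⟩
      have h1 := add_theta_mem_of_centralizes C hb hZ hZb
      have h2 : Z - C.theta Z ∈ T.aReal θ := by
        refine (mem_aReal_iff hC T).2 ⟨sub_mem hZ (C.theta_mem Z hZ), fun W hW => ?_,
          C.theta_sub_theta hZ⟩
        rw [lie_sub, ← C.theta_lie_of_mem (hb.le W hW) hZ, hZb W hW, map_zero, sub_zero]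
      have h3 : toComplex Z = (2⁻¹ : ℂ) • toComplex (Z + C.theta Z) +
          (2⁻¹ : ℂ) • toComplex (Z - C.theta Z) := by
        rw [toComplex_add, toComplex_sub]
        module
      rw [h3]
      exact add_mem
        (Submodule.mem_sup_left (Submodule.smul_mem _ _ (toComplex_mem_complexify h1)))
        (Submodule.mem_sup_right (Submodule.smul_mem _ _ (toComplex_mem_complexify h2)))
    obtain ⟨h1, h2⟩ := centralizes_of_mem_centralizerOf C hb hY hX
    rw [← toComplex_re_add_im X]
    exact add_mem (key _ h1) (Submodule.smul_mem _ _ (key _ h2))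
  · refine Submodule.span_le.2 ?_
    rintro _ ⟨Z, hZ, rfl⟩
    refine mem_centralizerOf.2 ⟨?_, toComplex_mem_complexify (C.le (hb.le Z hZ))⟩
    rw [smul_lie_matrix, ← toComplex_lie, hb.abelian _ Y.2 _ hZ, toComplex_zero, smul_zero]
  · refine Submodule.span_le.2 ?_
    rintro _ ⟨Z, hZ, rfl⟩
    obtain ⟨h1, h2, -⟩ := (mem_aReal_iff hC T).1 hZ
    refine mem_centralizerOf.2 ⟨?_, toComplex_mem_complexify h1⟩
    rw [smul_lie_matrix, ← toComplex_lie, h2 _ Y.2, toComplex_zero, smul_zero]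

/-- A unipotent isometry of a positive definite form is trivial. -/
theorem Ad_toComplex_eq_of_pow_eq_zero (hG : IsZariskiClosedOverReal G)
    (hc : IsZariskiConnected G) (hC : ∀ X : gReal G, C.theta X = θ X) (T : TripleDatum G K)
    {g : GL (Fin n) ℂ} (hg : g ∈ G)
    (hst : ∀ X ∈ T.aReal θ, ∃ X' ∈ T.aReal θ, Ad g (toComplex X) = toComplex X') (m : ℕ) :
    ∀ X ∈ T.aReal θ, ∀ H : gComplex G, (H : Matrix (Fin n) (Fin n) ℂ) = toComplex X →
      ((adEnd hG hg - 1) ^ m) H = 0 → Ad g (toComplex X) = toComplex X := by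
  induction m with
  | zero =>
    intro X _ H hH h
    have h0 : H = 0 := h
    rw [← hH, h0]
    exact map_zero _
  | succ m ih =>
    intro X hX H hH h
    obtain ⟨X', hX', e⟩ := hst X hX
    have hd : X' - X ∈ T.aReal θ := sub_mem hX' hX
    have e1 : Ad g (toComplex (X' - X)) = toComplex (X' - X) := by
      refine ih _ hd ((adEnd hG hg - 1) H) ?_ (by rwa [pow_succ, Module.End.mul_apply] at h)
      change Ad g H - H = _
      rw [hH, e, toComplex_sub]
    have hm : ∀ X ∈ T.aReal θ, toComplex X ∈ gComplex G := fun X hX =>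
      toComplex_mem_complexify ((mem_aReal_iff hC T).1 hX).1
    have f2 := complexForm_Ad hG hc C hg (hm X hX) (hm _ hd)
    rw [e, e1, complexForm_toComplex, complexForm_toComplex] at f2
    have f2' : C.form X' (X' - X) = C.form X (X' - X) := by exact_mod_cast f2
    have h0 : X' - X = 0 := by
      by_contra hne
      obtain ⟨h1, -, h3⟩ := (mem_aReal_iff hC T).1 hd
      refine (C.form_pos h1 h3 hne).ne' ?_
      rw [LinearMap.map_sub₂, f2', sub_self]
    rw [e, sub_eq_zero.1 h0]

/-- An element of `G` that carries a triple to itself acts trivially on `a`. -/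
theorem Carries.Ad_eq_self (hG : IsZariskiClosedOverReal G) (hc : IsZariskiConnected G)
    (hK : IsCompact (K : Set (GL (Fin n) ℝ))) (hC : ∀ X : gReal G, C.theta X = θ X)
    {T : TripleDatum G K} {g : GL (Fin n) ℂ} (hg : g ∈ G) (h : Carries θ g T T)
    {X : Matrix (Fin n) (Fin n) ℂ} (hX : X ∈ T.a θ) : Ad g X = X := by
  have hb := T.isTorusAlgebra hK
  obtain ⟨Y, hx, hY⟩ := T.exists_generic
  have hcent : ∀ {g : GL (Fin n) ℂ}, Carries θ g T T →
      ∀ X ∈ centralizerOf (gReal G).toSubmodule (T.x : Matrix (Fin n) (Fin n) ℂ),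
        Ad g X ∈ centralizerOf (gReal G).toSubmodule (T.x : Matrix (Fin n) (Fin n) ℂ) := by
    intro g h X hX
    rw [centralizerOf_x hK hC] at hX ⊢
    have h1 := Submodule.mem_map_of_mem (f := Ad g) hX
    rwa [Submodule.map_sup, h.map_a, h.map_b] at h1
  have hq : ∀ {g : GL (Fin n) ℂ}, Carries θ g T T →
      ∀ X ∈ qOf (gReal G).toSubmodule (T.x : Matrix (Fin n) (Fin n) ℂ),
        Ad g X ∈ qOf (gReal G).toSubmodule (T.x : Matrix (Fin n) (Fin n) ℂ) := by
    intro g h X hX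
    have h1 := Submodule.mem_map_of_mem (f := Ad g) hX
    rwa [← T.q_eq, h.map_q] at h1
  have hreal : ∀ X ∈ T.aReal θ, Ad g (toComplex X) = toComplex X := by
    intro X hX
    have hXg : toComplex X ∈ gComplex G :=
      toComplex_mem_complexify ((mem_aReal_iff hC T).1 hX).1
    obtain ⟨m, hm⟩ := exists_pow_adEnd_sub_one_eq_zero hG hc C hb hY hx hg (hcent h)
      (hcent h.inv) (hq h) (hq h.inv) (H := ⟨toComplex X, hXg⟩) (by
        rw [centralizerOf_x hK hC]
        exact Submodule.mem_sup_right (toComplex_mem_complexify hX))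
    refine Ad_toComplex_eq_of_pow_eq_zero hG hc hC T hg (fun X hX => ?_) m X hX _ rfl hm
    have h1 : Ad g (toComplex X) ∈ toComplex '' (T.aReal θ : Set (Matrix (Fin n) (Fin n) ℝ)) :=
      h.map_aReal ▸ ⟨_, ⟨X, hX, rfl⟩, rfl⟩
    obtain ⟨X', hX', e⟩ := h1
    exact ⟨X', hX', e.symm⟩
  refine LinearMap.eqOn_span (f := Ad g) (g := LinearMap.id) ?_ hX
  rintro _ ⟨X, hX, rfl⟩
  exact hreal X hX

/-- Two elements of `G` that carry one triple to another agree on `a`. -/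
theorem Carries.Ad_eq_Ad (hG : IsZariskiClosedOverReal G) (hc : IsZariskiConnected G)
    (hK : IsCompact (K : Set (GL (Fin n) ℝ))) (hC : ∀ X : gReal G, C.theta X = θ X)
    {T T' : TripleDatum G K} {g g' : GL (Fin n) ℂ} (hg : g ∈ G) (hg' : g' ∈ G)
    (h : Carries θ g T T') (h' : Carries θ g' T T')
    {X : Matrix (Fin n) (Fin n) ℂ} (hX : X ∈ T.a θ) : Ad g X = Ad g' X := by
  have h1 := (h.trans h'.inv).Ad_eq_self hG hc hK hC (mul_mem (inv_mem hg') hg) hX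
  rw [Ad_mul] at h1
  rw [← Ad_Ad_inv g' (Ad g X), h1]

end TripleDatum

end Carries

end RealReductive

theorem proposition3p1 {n : ℕ} (G : Subgroup (GL (Fin n) ℂ))
    (hG : RealReductive.IsReductiveOverReal G)
    (K : Subgroup (GL (Fin n) ℝ))
    (hK : RealReductive.IsMaximalCompact (RealReductive.realPoints G) K)
    (θ : RealReductive.gReal G →ₗ⁅ℝ⁆ RealReductive.gReal G)
    (hθ : RealReductive.IsCartanInvolution G K θ) :
    (∀ T T' : RealReductive.TripleDatum G K,
      (∃ g ∈ G, RealReductive.TripleDatum.Carries θ g T T') ∧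
      ∀ g ∈ G, ∀ g' ∈ G, RealReductive.TripleDatum.Carries θ g T T' →
        RealReductive.TripleDatum.Carries θ g' T T' →
        ∀ X ∈ T.a θ, RealReductive.Ad g X = RealReductive.Ad g' X) ∧
    (∀ T : RealReductive.TripleDatum G K,
      Function.Bijective (fun v : RealReductive.aG G K θ => v.1 T)) ∧
    (∀ v ∈ RealReductive.aG G K θ, ∀ T T' : RealReductive.TripleDatum G K,
      (v T : Matrix (Fin n) (Fin n) ℂ) ∈
          RealReductive.toComplex '' (T.aReal θ : Set (Matrix (Fin n) (Fin n) ℝ)) →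
        (v T' : Matrix (Fin n) (Fin n) ℂ) ∈
          RealReductive.toComplex '' (T'.aReal θ : Set (Matrix (Fin n) (Fin n) ℝ))) := by
  have hKc := hK.1.2
  have hKG := hK.1.1
  have hA := hG.algebraic
  have hc := hG.connected
  obtain ⟨C, hC⟩ := hθ.exists_cartanForm fun _ hX => RealReductive.lieAlg_mono
    hKc.isClosed (RealReductive.isClosed_realPoints hA.isZariskiClosed) hKG hX
  have hex := RealReductive.TripleDatum.exists_carries hA hKG hKc hC
  refine ⟨fun T T' => ⟨hex T T', fun g hg g' hg' h h' X hX =>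
    h.Ad_eq_Ad hA hc hKc hC hg hg' h' hX⟩, fun T => ⟨fun v w hvw => ?_, fun u => ?_⟩,
    fun v hv T T' h => ?_⟩
  · refine Subtype.ext (funext fun T' => Subtype.ext ?_)
    obtain ⟨g, hg, h⟩ := hex T T'
    rw [← v.2 T T' g hg h, ← w.2 T T' g hg h]
    exact congrArg (fun u : T.a θ => RealReductive.Ad g u) hvw
  -- an element of `a` extends to a compatible family along any choice of conjugating elements, by
  -- uniqueness of the induced maps
  · choose g hg h using hex T
    have hmem : ∀ T', RealReductive.Ad (g T') u ∈ T'.a θ := fun T' =>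
      (h T').map_a ▸ Submodule.mem_map_of_mem u.2
    refine ⟨⟨fun T' => ⟨RealReductive.Ad (g T') u, hmem T'⟩, fun T₁ T₂ g' hg' h' => ?_⟩,
      Subtype.ext ((h T).Ad_eq_self hA hc hKc hC (hg T) u.2)⟩
    have h1 := ((h T₁).trans h').Ad_eq_Ad hA hc hKc hC (mul_mem hg' (hg T₁)) (hg T₂) (h T₂) u.2
    rwa [RealReductive.Ad_mul] at h1
  · obtain ⟨g, hg, hT⟩ := hex T T'
    rw [← hv T T' g hg hT, ← hT.map_aReal]
    exact Set.mem_image_of_mem _ h
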